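/- Let $f\colon X\to S$ be a morphism of $\mathbb{Q}$-schemes that is subintegral, i.e. $f$ is affine, the structure map $\mathcal{O}_S\to f_*\mathcal{O}_X$ is injective, and for every affine open $U\subseteq S$ the ring extension $A=\mathcal{O}_S(U)\hookrightarrow B=\mathcal{O}_X(f^{-1}U)$ is subintegral: $B$ is integral over $A$ and $\operatorname{Spec} B\to\operatorname{Spec} A$ is a bijection inducing isomorphisms on all residue fields. Let $\operatorname{Pic}(f)$ be the abelian group generated by symbols $[L_1,\alpha,L_2]$, where $L_1,L_2$ are line bundles on $S$ and $\alpha\colon f^*L_1\to f^*L_2$ is an isomorphism, subject to the relations 1. $[L_1,\alpha,L_2]+[L_1',\alpha',L_2']=[L_1\otimes L_1',\alpha\otimes\alpha',L_2\otimes L_2']$; 2. $[L_1,\alpha,L_2]+[L_2,\beta,L_3]=[L_1,\beta\alpha,L_3]$; 3. $[L_1,\alpha,L_2]=0$ if $\alpha=f^*(\alpha_0)$ for some isomorphism $\alpha_0\colon L_1\cong L_2$. Then there is an isomorphism of abelian groups $$\operatorname{Pic}(f)\;\cong\;H^0_{\mathrm{zar}}(S,\,f_*\mathcal{O}_X/\mathcal{O}_S),$$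 where $f_*\mathcal{O}_X/\mathcal{O}_S$ is the quotient sheaf of abelian groups on the Zariski site of $S$. -/

import Mathlib

open CategoryTheory Limits TopologicalSpace AlgebraicGeometry

universe u

/-! ### Subintegral morphisms -/

/-- A homomorphism of commutative rings `φ : A → B` is a subintegral extension if it is injective,
`B` is integral over `A`, and `Spec B → Spec A` is a bijection that induces isomorphisms on all
residue fields. -/
structure RingHom.IsSubintegral {A B : Type u} [CommRing A] [CommRing B] (φ : A →+* B) :
    Prop where
  injective : Function.Injective φ
  isIntegral : φ.IsIntegral
  bijective_comap : Function.Bijective (PrimeSpectrum.comap φ)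
  bijective_residueField : ∀ q : PrimeSpectrum B,
    Function.Bijective
      (Ideal.ResidueField.map (PrimeSpectrum.comap φ q).asIdeal q.asIdeal φ rfl)

namespace AlgebraicGeometry.Scheme

/-- A morphism of schemes `f : X ⟶ S` is subintegral if it is affine, the structure map
`𝒪_S → f_* 𝒪_X` is injective, and `𝒪_S(U) → 𝒪_X(f⁻¹ U)` is a subintegral extension for every
affine open `U` of `S`. -/
structure Hom.IsSubintegral {X S : Scheme.{u}} (f : X ⟶ S) : Prop where
  isAffineHom : IsAffineHom f
  injective : ∀ U : S.Opens, Function.Injective (f.app U).hom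
  isSubintegral : ∀ U : S.Opens, IsAffineOpen U → (f.app U).hom.IsSubintegral

/-! ### Tensor products of sheaves of modules, and their pullbacks -/

namespace Modules

noncomputable section

variable {X S : Scheme.{u}}

/-- The tensor product `U ↦ M(U) ⊗ N(U)` of `𝒪_X`-modules as a presheaf of modules. -/
def presheafTensorObj (M N : X.Modules) : X.PresheafOfModules :=
  PresheafOfModules.Monoidal.tensorObj (R := X.presheaf) M.val N.val

/-- The tensor product `M ⊗ N` of `𝒪_X`-modules: the sheaf associated to `U ↦ M(U) ⊗ N(U)`. -/
def tensorObj (M N : X.Modules) : X.Modules :=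
  (PresheafOfModules.sheafification (𝟙 X.ringCatSheaf.obj)).obj (presheafTensorObj M N)

/-- The tensor product `φ ⊗ ψ` of two morphisms of `𝒪_X`-modules. -/
def tensorHom {M M' N N' : X.Modules} (φ : M ⟶ M') (ψ : N ⟶ N') :
    tensorObj M N ⟶ tensorObj M' N' :=
  (PresheafOfModules.sheafification (𝟙 X.ringCatSheaf.obj)).map
    (X := presheafTensorObj M N) (Y := presheafTensorObj M' N')
    (PresheafOfModules.Monoidal.tensorHom (R := X.presheaf) φ.val ψ.val)

/-- The canonical map `M(U) ⊗ N(U) → (M ⊗ N)(U)`. -/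
def toTensorObj (M N : X.Modules) (U : X.Opens) :
    TensorProduct Γ(X, U) Γ(M, U) Γ(N, U) →ₗ[Γ(X, U)] Γ(tensorObj M N, U) :=
  ((PresheafOfModules.sheafificationHomEquiv (𝟙 X.ringCatSheaf.obj)
    (𝟙 (tensorObj M N))).app (.op U)).hom

/-- The section `s ⊗ t` of `M ⊗ N` over `U`, for sections `s` of `M` and `t` of `N` over `U`. -/
def tmul {M N : X.Modules} {U : X.Opens} (s : Γ(M, U)) (t : Γ(N, U)) : Γ(tensorObj M N, U) :=
  toTensorObj M N U (TensorProduct.tmul Γ(X, U) s t)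

lemma tmul_add {M N : X.Modules} {U : X.Opens} (s : Γ(M, U)) (t t' : Γ(N, U)) :
    tmul s (t + t') = tmul s t + tmul s t' := by
  simp [tmul, TensorProduct.tmul_add]

lemma add_tmul {M N : X.Modules} {U : X.Opens} (s s' : Γ(M, U)) (t : Γ(N, U)) :
    tmul (s + s') t = tmul s t + tmul s' t := by
  simp [tmul, TensorProduct.add_tmul]

lemma smul_tmul {M N : X.Modules} {U : X.Opens} (r : Γ(X, U)) (s : Γ(M, U)) (t : Γ(N, U)) :
    tmul (r • s) t = r • tmul s t := by
  unfold tmul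
  rw [← TensorProduct.smul_tmul', _root_.map_smul]

lemma tmul_smul {M N : X.Modules} {U : X.Opens} (r : Γ(X, U)) (s : Γ(M, U)) (t : Γ(N, U)) :
    tmul s (r • t) = r • tmul s t := by
  unfold tmul
  rw [TensorProduct.tmul_smul, _root_.map_smul]

lemma map_tmul {M N : X.Modules} {U V : X.Opens} (i : U ⟶ V) (s : Γ(M, V)) (t : Γ(N, V)) :
    (tensorObj M N).presheaf.map i.op (tmul s t) =
      tmul (M.presheaf.map i.op s) (N.presheaf.map i.op t) :=
  (PresheafOfModules.naturality_apply (PresheafOfModules.sheafificationHomEquiv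
    (𝟙 X.ringCatSheaf.obj) (𝟙 (tensorObj M N))) i.op
      (TensorProduct.tmul Γ(X, V) (M := Γ(M, V)) (N := Γ(N, V)) s t)).symm

/-- A family of bilinear maps `M(U) × N(U) → P(U)` that is compatible with restrictions induces a
morphism from the presheaf tensor product of `M` and `N` to `P`. -/
def presheafTensorLift {M N P : X.Modules}
    (β : ∀ U : X.Opens, Γ(M, U) →ₗ[Γ(X, U)] Γ(N, U) →ₗ[Γ(X, U)] Γ(P, U))
    (hβ : ∀ (U V : X.Opens) (i : U ⟶ V) (s : Γ(M, V)) (t : Γ(N, V)),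
      P.presheaf.map i.op (β V s t) = β U (M.presheaf.map i.op s) (N.presheaf.map i.op t)) :
    presheafTensorObj M N ⟶ P.val where
  app U := ModuleCat.ofHom (R := X.ringCatSheaf.obj.obj U) (X := (presheafTensorObj M N).obj U)
    (Y := P.val.obj U) (TensorProduct.lift (β U.unop))
  naturality i := ModuleCat.MonoidalCategory.tensor_ext
    (fun s t ↦ (hβ _ _ i.unop s t).symm)

/-- A family of bilinear maps `M(U) × N(U) → P(U)` that is compatible with restrictions induces a
morphism `M ⊗ N ⟶ P`. -/
def tensorLift {M N P : X.Modules}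
    (β : ∀ U : X.Opens, Γ(M, U) →ₗ[Γ(X, U)] Γ(N, U) →ₗ[Γ(X, U)] Γ(P, U))
    (hβ : ∀ (U V : X.Opens) (i : U ⟶ V) (s : Γ(M, V)) (t : Γ(N, V)),
      P.presheaf.map i.op (β V s t) = β U (M.presheaf.map i.op s) (N.presheaf.map i.op t)) :
    tensorObj M N ⟶ P :=
  (PresheafOfModules.sheafificationHomEquiv (𝟙 X.ringCatSheaf.obj)).symm (presheafTensorLift β hβ)

lemma tensorLift_tmul {M N P : X.Modules}
    (β : ∀ U : X.Opens, Γ(M, U) →ₗ[Γ(X, U)] Γ(N, U) →ₗ[Γ(X, U)] Γ(P, U))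
    (hβ) {U : X.Opens} (s : Γ(M, U)) (t : Γ(N, U)) :
    (tensorLift β hβ).app U (tmul s t) = β U s t := by
  have key (φ : tensorObj M N ⟶ P) (x : (presheafTensorObj M N).obj (.op U)) :
      φ.app U (toTensorObj M N U x) =
        ((PresheafOfModules.sheafificationHomEquiv (𝟙 X.ringCatSheaf.obj) φ).app
          (.op U)).hom x := rfl
  refine (key _ _).trans (congrArg (fun φ ↦ (φ.app (.op U)).hom
    (TensorProduct.tmul Γ(X, U) (M := Γ(M, U)) (N := Γ(N, U)) s t))
      ((PresheafOfModules.sheafificationHomEquiv (𝟙 X.ringCatSheaf.obj)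
        (P := presheafTensorObj M N) (F := P)).apply_symm_apply (presheafTensorLift β hβ)))

/-- The map `s ↦ f^* s` from sections of `M` over `U` to sections of `f^* M` over `f⁻¹ U`. -/
def pullbackSection (f : X ⟶ S) {M : S.Modules} {U : S.Opens} (s : Γ(M, U)) :
    Γ((pullback f).obj M, f ⁻¹ᵁ U) :=
  ((pullbackPushforwardAdjunction f).unit.app M).app U s

lemma pullbackSection_add (f : X ⟶ S) {M : S.Modules} {U : S.Opens} (s t : Γ(M, U)) :
    pullbackSection f (s + t) = pullbackSection f s + pullbackSection f t :=
  map_add (((pullbackPushforwardAdjunction f).unit.app M).app U).hom s t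

lemma pullbackSection_smul (f : X ⟶ S) {M : S.Modules} {U : S.Opens} (r : Γ(S, U))
    (s : Γ(M, U)) : pullbackSection f (r • s) = (f.app U).hom r • pullbackSection f s :=
  Hom.app_smul ((pullbackPushforwardAdjunction f).unit.app M) r s

lemma map_pullbackSection (f : X ⟶ S) {M : S.Modules} {U V : S.Opens} (i : U ⟶ V)
    (s : Γ(M, V)) :
    ((pullback f).obj M).presheaf.map ((Opens.map f.base).map i).op (pullbackSection f s) =
      pullbackSection f (M.presheaf.map i.op s) :=
  (ConcreteCategory.congr_hom
    (((pullbackPushforwardAdjunction f).unit.app M).mapPresheaf.naturality i.op) s).symm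

/-- The canonical comparison morphism `f^* (M ⊗ N) ⟶ f^* M ⊗ f^* N`, which sends `f^* (s ⊗ t)` to
`f^* s ⊗ f^* t`. -/
def pullbackTensor (f : X ⟶ S) (M N : S.Modules) :
    (pullback f).obj (tensorObj M N) ⟶
      tensorObj ((pullback f).obj M) ((pullback f).obj N) :=
  ((pullbackPushforwardAdjunction f).homEquiv _ _).symm <|
    tensorLift (P := (pushforward f).obj
        (tensorObj ((pullback f).obj M) ((pullback f).obj N)))
      (fun U ↦ LinearMap.mk₂ Γ(S, U)
          (fun s t ↦ tmul (pullbackSection f s) (pullbackSection f t))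
          (fun s s' t ↦ by rw [pullbackSection_add, add_tmul]; rfl)
          (fun r s t ↦ by rw [pullbackSection_smul, smul_tmul]; rfl)
          (fun s t t' ↦ by rw [pullbackSection_add, tmul_add]; rfl)
          (fun r s t ↦ by rw [pullbackSection_smul, tmul_smul]; rfl))
      (fun U V i s t ↦ by
        refine (map_tmul ((Opens.map f.base).map i) _ _).trans ?_
        rw [map_pullbackSection, map_pullbackSection]
        rfl)

lemma pullbackTensor_app (f : X ⟶ S) (M N : S.Modules) {U : S.Opens} (s : Γ(M, U))
    (t : Γ(N, U)) :
    (pullbackTensor f M N).app (f ⁻¹ᵁ U) (pullbackSection f (tmul s t)) =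
      tmul (pullbackSection f s) (pullbackSection f t) := by
  refine (ConcreteCategory.congr_hom (congrArg (fun φ ↦ Hom.app φ U)
    (((pullbackPushforwardAdjunction f).homEquiv _ _).apply_symm_apply
      (tensorLift (P := (pushforward f).obj _) _ _))) (tmul s t)).trans ?_
  exact tensorLift_tmul _ _ s t

/-- A line bundle on `X` is an `𝒪_X`-module that is locally isomorphic to `𝒪_X`. -/
def IsLineBundle (L : X.Modules) : Prop :=
  ∀ x : X, ∃ U : X.Opens, x ∈ U ∧
    Nonempty (L.restrict U.ι ≅ (SheafOfModules.unit (U : Scheme.{u}).ringCatSheaf))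

end

end Modules

noncomputable section

variable {X S : Scheme.{u}}

/-! ### The relative Picard group -/

/-- The generators `[L₁, α, L₂]` of the relative Picard group of `f : X ⟶ S`: two line bundles
`L₁`, `L₂` on `S` and an isomorphism `α : f^* L₁ ≅ f^* L₂`. -/
structure Hom.RelPicGenerator (f : X ⟶ S) where
  L₁ : S.Modules
  L₂ : S.Modules
  isLineBundle₁ : L₁.IsLineBundle
  isLineBundle₂ : L₂.IsLineBundle
  α : (Modules.pullback f).obj L₁ ≅ (Modules.pullback f).obj L₂

/-- The relations that define the relative Picard group, as elements of the free abelian group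
on the generators. -/
inductive Hom.RelPicRelation (f : X ⟶ S) : FreeAbelianGroup (RelPicGenerator f) → Prop
  /-- `[L₁, α, L₂] + [L₁', α', L₂'] = [L₁ ⊗ L₁', α ⊗ α', L₂ ⊗ L₂']`. Here `α ⊗ α'` is regarded as
  an isomorphism `γ : f^* (L₁ ⊗ L₁') ≅ f^* (L₂ ⊗ L₂')` through the canonical comparison morphisms
  `f^* (M ⊗ N) ⟶ f^* M ⊗ f^* N`, which are isomorphisms. -/
  | tensor (L₁ L₂ L₁' L₂' : S.Modules) (h₁ : L₁.IsLineBundle) (h₂ : L₂.IsLineBundle)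
      (h₁' : L₁'.IsLineBundle) (h₂' : L₂'.IsLineBundle)
      (h₁'' : (Modules.tensorObj L₁ L₁').IsLineBundle)
      (h₂'' : (Modules.tensorObj L₂ L₂').IsLineBundle)
      (α : (Modules.pullback f).obj L₁ ≅ (Modules.pullback f).obj L₂)
      (α' : (Modules.pullback f).obj L₁' ≅ (Modules.pullback f).obj L₂')
      (γ : (Modules.pullback f).obj (Modules.tensorObj L₁ L₁') ≅
        (Modules.pullback f).obj (Modules.tensorObj L₂ L₂'))
      (comm : γ.hom ≫ Modules.pullbackTensor f L₂ L₂' =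
        Modules.pullbackTensor f L₁ L₁' ≫ Modules.tensorHom α.hom α'.hom) :
      RelPicRelation f (.of ⟨L₁, L₂, h₁, h₂, α⟩ + .of ⟨L₁', L₂', h₁', h₂', α'⟩ -
        .of ⟨Modules.tensorObj L₁ L₁', Modules.tensorObj L₂ L₂', h₁'', h₂'', γ⟩)
  /-- `[L₁, α, L₂] + [L₂, β, L₃] = [L₁, β ∘ α, L₃]`. -/
  | comp (L₁ L₂ L₃ : S.Modules) (h₁ : L₁.IsLineBundle) (h₂ : L₂.IsLineBundle)
      (h₃ : L₃.IsLineBundle)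
      (α : (Modules.pullback f).obj L₁ ≅ (Modules.pullback f).obj L₂)
      (β : (Modules.pullback f).obj L₂ ≅ (Modules.pullback f).obj L₃) :
      RelPicRelation f (.of ⟨L₁, L₂, h₁, h₂, α⟩ + .of ⟨L₂, L₃, h₂, h₃, β⟩ -
        .of ⟨L₁, L₃, h₁, h₃, α ≪≫ β⟩)
  /-- `[L₁, f^* α₀, L₂] = 0` for an isomorphism `α₀ : L₁ ≅ L₂`. -/
  | pullback (L₁ L₂ : S.Modules) (h₁ : L₁.IsLineBundle) (h₂ : L₂.IsLineBundle) (α₀ : L₁ ≅ L₂) :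
      RelPicRelation f (.of ⟨L₁, L₂, h₁, h₂, (Modules.pullback f).mapIso α₀⟩)

/-- The relative Picard group `Pic(f)` of a morphism of schemes `f : X ⟶ S`. -/
abbrev Hom.RelPic (f : X ⟶ S) : Type (u + 1) :=
  FreeAbelianGroup (RelPicGenerator f) ⧸ AddSubgroup.closure {r | RelPicRelation f r}

/-! ### The quotient sheaf -/

/-- The structure sheaf of `X` as a sheaf of abelian groups. -/
def abSheaf (X : Scheme.{u}) : TopCat.Sheaf Ab.{u} X :=
  (sheafCompose _ (forget₂ CommRingCat.{u} RingCat.{u} ⋙ forget₂ RingCat.{u} Ab.{u})).obj X.sheaf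

/-- `𝒪_S → f_* 𝒪_X` as a morphism of sheaves of abelian groups on `S`. -/
def Hom.structureMap (f : X ⟶ S) :
    S.abSheaf ⟶ (TopCat.Sheaf.pushforward Ab.{u} f.base).obj X.abSheaf :=
  ⟨Functor.whiskerRight f.c
    (forget₂ CommRingCat.{u} RingCat.{u} ⋙ forget₂ RingCat.{u} Ab.{u})⟩

/-- The quotient `f_* 𝒪_X / 𝒪_S`: the cokernel of `𝒪_S → f_* 𝒪_X` in the category of sheaves of
abelian groups on the Zariski site of `S`. -/
def Hom.quotientSheaf (f : X ⟶ S) : TopCat.Sheaf Ab.{u} S :=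
  cokernel (structureMap f)

end

end AlgebraicGeometry.Scheme

/-! For a subintegral extension A ⊆ B of ℚ-algebras, an exponential identifies B/A with the group of
invertible A-submodules of B. To b one attaches the A[T]-module M(b) = B[T] ∩ exp(bT) A[[T]] and
then sets T = 1. Once M(b) is known to be invertible with inverse M(-b) (`IsExpGood`), its value at
T = 1 is locally of the form uA with u a unit of B. The relation `IsLog A b u` expresses this
equality. Every u has such a b, unique modulo A, and b lies in A exactly when u is a unit of A. This
yields an isomorphism of sheaves (f_* 𝒪_X)ˣ / 𝒪_Sˣ ≅ f_* 𝒪_X / 𝒪_S, the logarithm.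

The algebra reduces to elementary extensions A ⊆ A' = A + Ay with y², y³ ∈ A, because a subintegral
extension is the union of finite towers of such steps (`eq_top_of_seminormal`). An elementary
extension has a surjection π + Dε : A' → K[ε], ε² = 0, with A = ker D. Invertibility descends from
A' to A (`exists_combination`): the obstruction is a logarithmic derivative q ∈ K[[T]]; its
T-derivative is a polynomial, so q is one in characteristic zero, and a polynomial factor with π = 1
and D = -q removes it. The same derivation shows that logarithms of units of A lie in A
(`IsLog.mem_of_isElementary`) and corrects a logarithm over A' to one over A
(`IsLog.exists_of_isElementary`).

On the geometric side, local frames of L₁ and L₂ turn α into a unit of f_* 𝒪_X that is well defined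
modulo 𝒪_Sˣ, and the logarithms of these units glue to a global section. If the section is zero,
then the units come from 𝒪_S and α descends to S (`mk_of_eq_zero`). Conversely, a section s defines
the line bundle inside f_* 𝒪_X generated locally by units with logarithm s, whose pullback is
canonically trivial (`exists_transitionClass_eq`). -/

/-! ### Derivations along a ring homomorphism -/

/-- A derivation `D : R → K` along a ring homomorphism `π : R → K`, such that `(π, D)` is
surjective. -/
structure TwistedDerivation (R K : Type*) [CommRing R] [CommRing K] where
  π : R →+* K
  D : R →+ K
  leibniz (a b : R) : D (a * b) = π a * D b + π b * D a
  surjective (x y : K) : ∃ r, π r = x ∧ D r = y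

/-! ### Polynomials inside a power series ring. -/

namespace PowerSeries

/-- The subring of polynomials in a ring of power series. -/
noncomputable def polynomials (R : Type*) [CommRing R] : Subring (PowerSeries R) :=
  (Polynomial.coeToPowerSeries.ringHom (R := R)).range

lemma mem_polynomials {R : Type*} [CommRing R] {f : PowerSeries R} :
    f ∈ polynomials R ↔ ∃ N, ∀ n, N ≤ n → coeff n f = 0 := by
  constructor
  · rintro ⟨p, rfl⟩
    refine ⟨p.natDegree + 1, fun n hn ↦ ?_⟩
    simpa using Polynomial.coeff_eq_zero_of_natDegree_lt (by omega)
  · rintro ⟨N, hN⟩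
    refine ⟨trunc N f, ?_⟩
    ext n
    simp only [Polynomial.coeToPowerSeries.ringHom_apply, Polynomial.coeff_coe, coeff_trunc]
    split_ifs with h
    · rfl
    · exact (hN n (not_lt.mp h)).symm

lemma coe_mem_polynomials {R : Type*} [CommRing R] (p : Polynomial R) :
    (p : PowerSeries R) ∈ polynomials R := ⟨p, rfl⟩

lemma derivative_mem_polynomials {R : Type*} [CommRing R] {f : PowerSeries R}
    (hf : f ∈ polynomials R) : derivative R f ∈ polynomials R := by
  obtain ⟨p, rfl⟩ := hf
  exact ⟨p.derivative, (derivative_coe p).symm⟩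

/-- Coefficients of positive index are recovered by dividing by n + 1, which is invertible over ℚ.
In characteristic p this fails, and with it the descent of invertibility. -/
lemma mem_polynomials_of_derivative {R : Type*} [CommRing R] [Algebra ℚ R] {f : PowerSeries R}
    (hf : derivative R f ∈ polynomials R) : f ∈ polynomials R := by
  rw [mem_polynomials] at hf ⊢
  obtain ⟨N, hN⟩ := hf
  refine ⟨N + 1, fun n hn ↦ ?_⟩
  obtain ⟨m, rfl⟩ : ∃ m, n = m + 1 := ⟨n - 1, by omega⟩
  have := hN m (by omega)
  rw [coeff_derivative] at this
  have hu : (algebraMap ℚ R (1 / (m + 1))) * ((m : R) + 1) = 1 := by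
    have : ((m : R) + 1) = algebraMap ℚ R (m + 1) := by simp
    rw [this, ← map_mul, one_div_mul_cancel (by positivity), map_one]
  calc coeff (m + 1) f = (coeff (m + 1) f * ((m : R) + 1)) * algebraMap ℚ R (1 / (m + 1)) := by
        rw [mul_assoc, mul_comm ((m : R) + 1), hu, mul_one]
    _ = 0 := by rw [this, zero_mul]

end PowerSeries

/-! ### Twisted derivations on power series and the descent of a presentation of 1. -/

namespace TwistedDerivation

open PowerSeries

variable {R K : Type*} [CommRing R] [CommRing K] (δ : TwistedDerivation R K)

/-- The coefficientwise extension of `δ.π` to power series. -/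
noncomputable def πs : R⟦X⟧ →+* K⟦X⟧ := PowerSeries.map δ.π

/-- The coefficientwise extension of `δ.D` to power series. -/
noncomputable def Ds : R⟦X⟧ →+ K⟦X⟧ where
  toFun f := PowerSeries.mk fun n ↦ δ.D (coeff n f)
  map_zero' := by ext; simp
  map_add' f g := by ext; simp

@[simp] lemma coeff_Ds (f : R⟦X⟧) (n : ℕ) : coeff n (δ.Ds f) = δ.D (coeff n f) := by simp [Ds]

@[simp] lemma coeff_πs (f : R⟦X⟧) (n : ℕ) : coeff n (δ.πs f) = δ.π (coeff n f) := by simp [πs]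

lemma Ds_mul (f g : R⟦X⟧) : δ.Ds (f * g) = δ.πs f * δ.Ds g + δ.πs g * δ.Ds f := by
  ext n
  rw [mul_comm (δ.πs g)]
  simp only [coeff_Ds, coeff_mul, map_add, map_sum, δ.leibniz, Finset.sum_add_distrib, coeff_πs,
    mul_comm (δ.π (coeff _ g))]

lemma D_one : δ.D 1 = 0 := by
  have := δ.leibniz 1 1
  simpa using this

lemma Ds_one : δ.Ds 1 = 0 := by
  ext n
  rw [coeff_Ds, coeff_one]
  split_ifs <;> simp [D_one]

lemma πs_mem {f : R⟦X⟧} (hf : f ∈ polynomials R) : δ.πs f ∈ polynomials K := by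
  rw [mem_polynomials] at hf ⊢
  obtain ⟨N, hN⟩ := hf
  exact ⟨N, fun n hn ↦ by rw [coeff_πs, hN n hn, map_zero]⟩

lemma Ds_mem {f : R⟦X⟧} (hf : f ∈ polynomials R) : δ.Ds f ∈ polynomials K := by
  rw [mem_polynomials] at hf ⊢
  obtain ⟨N, hN⟩ := hf
  exact ⟨N, fun n hn ↦ by rw [coeff_Ds, hN n hn, map_zero]⟩

lemma πs_derivative (f : R⟦X⟧) : δ.πs (derivative R f) = derivative K (δ.πs f) := by
  ext n
  simp [coeff_derivative]

lemma Ds_derivative (f : R⟦X⟧) : δ.Ds (derivative R f) = derivative K (δ.Ds f) := by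
  ext n
  have h : ∀ (m : ℕ) (r : R), δ.D (r * ((m : R) + 1)) = δ.D r * ((m : K) + 1) := fun m r ↦ by
    have : r * ((m : R) + 1) = (m + 1) • r := by simp; ring
    rw [this, map_nsmul]
    simp; ring
  simp [coeff_derivative, h]

lemma exists_lift {f g : K⟦X⟧} (hf : f ∈ polynomials K) (hg : g ∈ polynomials K) :
    ∃ h ∈ polynomials R, δ.πs h = f ∧ δ.Ds h = g := by
  rw [mem_polynomials] at hf hg
  obtain ⟨N, hN⟩ := hf
  obtain ⟨M, hM⟩ := hg
  choose s hs hs' using δ.surjective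
  refine ⟨PowerSeries.mk fun n ↦ if n < max N M then s (coeff n f) (coeff n g) else 0,
    mem_polynomials.mpr ⟨max N M, fun n hn ↦ ?_⟩, ?_, ?_⟩
  · rw [coeff_mk, if_neg (not_lt.mpr hn)]
  · ext n
    rw [coeff_πs, coeff_mk]
    split_ifs with h
    · exact hs _ _
    · rw [map_zero, hN n (le_trans (le_max_left _ _) (not_lt.mp h))]
  · ext n
    rw [coeff_Ds, coeff_mk]
    split_ifs with h
    · exact hs' _ _
    · rw [map_zero, hM n (le_trans (le_max_right _ _) (not_lt.mp h))]

/-- Let `a`, `a'` be families of power series over `R` with `∑ aᵢ a'ᵢ = 1` such that all the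
`aᵢ a'ⱼ` and all the `(d aᵢ) a'ⱼ` are polynomials. Then there are polynomial linear combinations
of `a` and of `a'` with the same property that are killed by `D`. -/
lemma exists_combination [Algebra ℚ K] {ι : Type} [Fintype ι] (a a' : ι → R⟦X⟧)
    (h1 : ∑ i, a i * a' i = 1) (hp : ∀ i j, a i * a' j ∈ polynomials R)
    (hd : ∀ i j, derivative R (a i) * a' j ∈ polynomials R) :
    ∃ Z W : ι ⊕ ι → ι → R⟦X⟧, (∀ k i, Z k i ∈ polynomials R) ∧ (∀ k i, W k i ∈ polynomials R) ∧
      (∀ k, δ.Ds (∑ i, Z k i * a i) = 0) ∧ (∀ k, δ.Ds (∑ i, W k i * a' i) = 0) ∧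
      ∑ k, (∑ i, Z k i * a i) * (∑ i, W k i * a' i) = 1 := by
  classical
  -- The logarithmic derivative of the family with respect to `D`; a priori only a power series.
  set q : K⟦X⟧ := ∑ j, δ.πs (a' j) * δ.Ds (a j) with hq
  have hα : ∑ i, δ.πs (a i) * δ.πs (a' i) = 1 := by
    rw [← map_one δ.πs, ← h1, map_sum]; simp only [map_mul]
  have hα' : ∑ i, δ.πs (a' i) * δ.πs (a i) = 1 := by
    rw [← hα]; exact Finset.sum_congr rfl fun i _ ↦ mul_comm _ _
  have hq' : ∑ j, δ.πs (a j) * δ.Ds (a' j) = -q := by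
    rw [eq_neg_iff_add_eq_zero, hq, ← Finset.sum_add_distrib, ← δ.Ds_one, ← h1, map_sum]
    exact Finset.sum_congr rfl fun i _ ↦ (δ.Ds_mul _ _).symm
  -- The idempotent matrix with entries π(aᵢ a'ⱼ) is polynomial. It lifts to a polynomial matrix E
  -- killed by `D`, and after applying E to both families `D` acts as multiplication by q on one and
  -- by -q on the other, up to π.
  have he : ∀ i j, ∃ h ∈ polynomials R, δ.πs h = δ.πs (a i) * δ.πs (a' j) ∧ δ.Ds h = 0 :=
    fun i j ↦ δ.exists_lift (by rw [← map_mul]; exact δ.πs_mem (hp i j)) (zero_mem _)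
  choose E hE hEπ hED using he
  let b : ι → R⟦X⟧ := fun i ↦ ∑ k, E i k * a k
  let b' : ι → R⟦X⟧ := fun i ↦ ∑ k, E k i * a' k
  have hbπ : ∀ i, δ.πs (b i) = δ.πs (a i) := fun i ↦ by
    simp only [b, map_sum, map_mul, hEπ, mul_assoc]
    rw [← Finset.mul_sum, hα', mul_one]
  have hb'π : ∀ i, δ.πs (b' i) = δ.πs (a' i) := fun i ↦ by
    simp only [b', map_sum, map_mul, hEπ, mul_assoc, mul_comm (δ.πs (a _)) (δ.πs (a' i) * _)]
    rw [← Finset.mul_sum, hα', mul_one]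
  have hbD : ∀ i, δ.Ds (b i) = δ.πs (a i) * q := fun i ↦ by
    simp only [b, map_sum, Ds_mul, hEπ, hED, mul_zero, add_zero, mul_assoc]
    rw [← Finset.mul_sum]
  have hb'D : ∀ i, δ.Ds (b' i) = - (δ.πs (a' i) * q) := fun i ↦ by
    simp only [b', map_sum, Ds_mul, hEπ, hED, mul_zero, add_zero]
    rw [← mul_neg, ← hq', Finset.mul_sum]
    exact Finset.sum_congr rfl fun k _ ↦ by ring
  -- The element ∑ (d bᵢ) b'ᵢ is a polynomial whose image under `D` is dq, because the terms with q
  -- undifferentiated cancel. So dq, and then q, is a polynomial.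
  have hθ : ∑ i, derivative R (b i) * b' i ∈ polynomials R := by
    refine sum_mem fun i _ ↦ ?_
    simp only [b, b', map_sum, Derivation.leibniz, smul_eq_mul, Finset.sum_mul, Finset.mul_sum]
    refine sum_mem fun k _ ↦ sum_mem fun l _ ↦ ?_
    have : (E i l * derivative R (a l) + a l * derivative R (E i l)) * (E k i * a' k) =
        (derivative R (a l) * a' k) * (E i l * E k i) +
          (a l * a' k) * (derivative R (E i l) * E k i) := by ring
    rw [this]
    exact add_mem (mul_mem (hd _ _) (mul_mem (hE _ _) (hE _ _)))
      (mul_mem (hp _ _) (mul_mem (derivative_mem_polynomials (hE _ _)) (hE _ _)))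
  have hdq : δ.Ds (∑ i, derivative R (b i) * b' i) = derivative K q := by
    have : ∀ i, δ.Ds (derivative R (b i) * b' i) =
        (δ.πs (a' i) * δ.πs (a i)) * derivative K q := fun i ↦ by
      rw [Ds_mul, πs_derivative, Ds_derivative, hbπ, hb'π, hbD, hb'D, Derivation.leibniz,
        smul_eq_mul, smul_eq_mul]
      ring
    rw [map_sum, Finset.sum_congr rfl fun i _ ↦ this i, ← Finset.sum_mul, hα', one_mul]
  have hqp : q ∈ polynomials K := mem_polynomials_of_derivative (hdq ▸ δ.Ds_mem hθ)
  -- F and F' play the roles of 1 - qε and 1 + qε: multiplying by them cancels the logarithmic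
  -- derivatives ±q.
  obtain ⟨F, hF, hFπ, hFD⟩ := δ.exists_lift (one_mem _) (neg_mem hqp)
  obtain ⟨F', hF', hF'π, hF'D⟩ := δ.exists_lift (one_mem _) hqp
  have hbF : ∀ i, δ.Ds (F * b i) = 0 := fun i ↦ by
    rw [Ds_mul, hFπ, hFD, hbD, hbπ]; ring
  have hbF' : ∀ i, δ.Ds (F' * b' i) = 0 := fun i ↦ by
    rw [Ds_mul, hF'π, hF'D, hb'D, hb'π]; ring
  -- The corrected families pair to S rather than to 1, but 1 - S is killed by both π and `D`; hence
  -- `D` kills every multiple of 1 - S.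
  set S : R⟦X⟧ := ∑ i, (F * b i) * (F' * b' i) with hS
  have hSD : δ.Ds S = 0 := by
    rw [hS, map_sum]
    exact Finset.sum_eq_zero fun i _ ↦ by rw [Ds_mul, hbF, hbF', mul_zero, mul_zero, add_zero]
  have hSπ : δ.πs S = 1 := by
    rw [hS, map_sum, ← hα]
    exact Finset.sum_congr rfl fun i _ ↦ by
      rw [map_mul, map_mul, map_mul, hFπ, hF'π, hbπ, hb'π, one_mul, one_mul]
  have hSp : S ∈ polynomials R := by
    refine sum_mem fun i _ ↦ ?_
    simp only [b, b', Finset.sum_mul, Finset.mul_sum]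
    refine sum_mem fun k _ ↦ sum_mem fun l _ ↦ ?_
    have : F * (E i l * a l) * (F' * (E k i * a' k)) =
      (a l * a' k) * (F * F' * E i l * E k i) := by ring
    rw [this]
    exact mul_mem (hp _ _) (mul_mem (mul_mem (mul_mem hF hF') (hE _ _)) (hE _ _))
  have hcp : 1 - S ∈ polynomials R := sub_mem (one_mem _) hSp
  have hcπ : δ.πs (1 - S) = 0 := by rw [map_sub, hSπ, map_one, sub_self]
  have hcD : δ.Ds (1 - S) = 0 := by rw [map_sub, hSD, Ds_one, sub_self]
  -- The second copy of the index set carries (1 - S) a and (1 - S) a'. The factor 2 - S is chosen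
  -- so that (2 - S) S + (1 - S)² = 1.
  let Z : ι ⊕ ι → ι → R⟦X⟧ :=
    Sum.elim (fun i k ↦ F * E i k) (fun i k ↦ if i = k then 1 - S else 0)
  let W : ι ⊕ ι → ι → R⟦X⟧ :=
    Sum.elim (fun i k ↦ (2 - S) * (F' * E k i)) (fun i k ↦ if i = k then 1 - S else 0)
  have hZl : ∀ i, ∑ k, Z (.inl i) k * a k = F * b i := fun i ↦ by
    simp only [Z, b, Sum.elim_inl, Finset.mul_sum, mul_assoc]
  have hWl : ∀ i, ∑ k, W (.inl i) k * a' k = (2 - S) * (F' * b' i) := fun i ↦ by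
    simp only [W, b', Sum.elim_inl, Finset.mul_sum, mul_assoc]
  have hZr : ∀ i, ∑ k, Z (.inr i) k * a k = (1 - S) * a i := fun i ↦ by
    simp [Z]
  have hWr : ∀ i, ∑ k, W (.inr i) k * a' k = (1 - S) * a' i := fun i ↦ by
    simp [W]
  have h2S : (2 - S : R⟦X⟧) = 1 + (1 - S) := by ring
  refine ⟨Z, W, ?_, ?_, ?_, ?_, ?_⟩
  · rintro (i | i) k
    · exact mul_mem hF (hE _ _)
    · simp only [Z, Sum.elim_inr]
      split_ifs
      exacts [hcp, zero_mem _]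
  · rintro (i | i) k
    · exact mul_mem (h2S ▸ add_mem (one_mem _) hcp) (mul_mem hF' (hE _ _))
    · simp only [W, Sum.elim_inr]
      split_ifs
      exacts [hcp, zero_mem _]
  · rintro (i | i)
    · rw [hZl, hbF]
    · rw [hZr, Ds_mul, hcπ, hcD, zero_mul, mul_zero, add_zero]
  · rintro (i | i)
    · rw [hWl, Ds_mul, hbF', h2S, map_add δ.Ds, hcD, Ds_one, add_zero, mul_zero, mul_zero, add_zero]
    · rw [hWr, Ds_mul, hcπ, hcD, zero_mul, mul_zero, add_zero]
  · rw [Fintype.sum_sum_type]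
    simp only [hZl, hWl, hZr, hWr]
    have e1 : ∑ i, F * b i * ((2 - S) * (F' * b' i)) = (2 - S) * S := by
      rw [hS, Finset.mul_sum]
      exact Finset.sum_congr rfl fun i _ ↦ by ring
    have e2 : ∑ i, (1 - S) * a i * ((1 - S) * a' i) = (1 - S) ^ 2 := by
      rw [← mul_one ((1 - S) ^ 2), ← h1, Finset.mul_sum]
      exact Finset.sum_congr rfl fun i _ ↦ by ring
    rw [e1, e2]
    ring

end TwistedDerivation

/-! ### Elementary extensions and the invertibility of B[T] ∩ exp(bT) A[[T]]. -/

namespace Subalgebra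

variable {B : Type u} [CommRing B] [Algebra ℚ B]

/-! ### Elementary subintegral extensions -/

/-- `A'` is an elementary subintegral extension `A + A y` of `A`, with `y ^ 2, y ^ 3 ∈ A`. -/
def IsElementary (A A' : Subalgebra ℚ B) : Prop :=
  ∃ y : B, y ^ 2 ∈ A ∧ y ^ 3 ∈ A ∧ ∀ z, z ∈ A' ↔ ∃ p ∈ A, ∃ r ∈ A, z = p + r * y

lemma IsElementary.le {A A' : Subalgebra ℚ B} (h : IsElementary A A') : A ≤ A' := by
  obtain ⟨y, -, -, h⟩ := h
  exact fun a ha ↦ (h a).mpr ⟨a, ha, 0, zero_mem _, by ring⟩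

lemma exists_isElementary (A : Subalgebra ℚ B) {y : B} (h2 : y ^ 2 ∈ A) (h3 : y ^ 3 ∈ A) :
    ∃ A', IsElementary A A' ∧ y ∈ A' := by
  refine ⟨{ carrier := {z | ∃ p ∈ A, ∃ r ∈ A, z = p + r * y}
            mul_mem' := ?_
            add_mem' := ?_
            algebraMap_mem' := ?_ }, ⟨y, h2, h3, fun z ↦ Iff.rfl⟩,
            ⟨0, zero_mem _, 1, one_mem _, by ring⟩⟩
  · rintro _ _ ⟨p, hp, r, hr, rfl⟩ ⟨p', hp', r', hr', rfl⟩
    exact ⟨p * p' + r * r' * y ^ 2, add_mem (mul_mem hp hp') (mul_mem (mul_mem hr hr') h2),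
      p * r' + r * p', add_mem (mul_mem hp hr') (mul_mem hr hp'), by ring⟩
  · rintro _ _ ⟨p, hp, r, hr, rfl⟩ ⟨p', hp', r', hr', rfl⟩
    exact ⟨p + p', add_mem hp hp', r + r', add_mem hr hr', by ring⟩
  · exact fun r ↦ ⟨_, A.algebraMap_mem r, 0, zero_mem _, by ring⟩

/-- An elementary subintegral extension `A ⊆ A'` is the kernel of a derivation of `A'` along a
ring homomorphism. -/
lemma IsElementary.exists_twistedDerivation {A A' : Subalgebra ℚ B} (h : IsElementary A A') :
    ∃ (K : Type u) (_ : CommRing K) (_ : Algebra ℚ K) (δ : TwistedDerivation A' K),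
      ∀ a : A', δ.D a = 0 ↔ (a : B) ∈ A := by
  obtain ⟨y, h2, h3, h⟩ := h
  -- K will be A/c, with π and `D` the coordinates p and r of p + ry modulo c. Then `D` vanishes
  -- exactly when ry ∈ A.
  let c : Ideal A :=
    { carrier := {a | (a : B) * y ∈ A}
      zero_mem' := by simp
      add_mem' := fun {a b} ha hb ↦ by
        simp only [Set.mem_ofPred_eq, AddMemClass.coe_add, add_mul] at *
        exact add_mem ha hb
      smul_mem' := fun a b hb ↦ by
        simp only [Set.mem_ofPred_eq, smul_eq_mul, MulMemClass.coe_mul, mul_assoc] at *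
        exact mul_mem a.2 hb }
  have hc : ∀ a : A, a ∈ c ↔ (a : B) * y ∈ A := fun a ↦ Iff.rfl
  -- The coordinates of p + ry are not unique, but they are unique modulo c: multiplying a relation
  -- by y and using y² ∈ A handles p.
  have key : ∀ (p r p' r' : A), (p : B) + r * y = p' + r' * y →
      Ideal.Quotient.mk c p = Ideal.Quotient.mk c p' ∧
      Ideal.Quotient.mk c r = Ideal.Quotient.mk c r' := by
    intro p r p' r' e
    rw [Ideal.Quotient.eq, Ideal.Quotient.eq, hc, hc]
    push_cast
    constructor
    · have : ((p : B) - p') * y = (r' - r) * y ^ 2 := by linear_combination y * e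
      rw [this]
      exact mul_mem (sub_mem r'.2 r.2) h2
    · have : ((r : B) - r') * y = p' - p := by linear_combination e
      rw [this]
      exact sub_mem p'.2 p.2
  have hex : ∀ z : A', ∃ p r : A, (z : B) = p + r * y := fun z ↦ by
    obtain ⟨p, hp, r, hr, e⟩ := (h z).mp z.2
    exact ⟨⟨p, hp⟩, ⟨r, hr⟩, e⟩
  choose p r hpr using hex
  have mk : ∀ (z : A') (p' r' : A), (z : B) = p' + r' * y →
      Ideal.Quotient.mk c (p z) = Ideal.Quotient.mk c p' ∧
      Ideal.Quotient.mk c (r z) = Ideal.Quotient.mk c r' :=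
    fun z p' r' e ↦ key _ _ _ _ ((hpr z).symm.trans e)
  -- The condition y³ ∈ A says that y² lies in c, which makes π multiplicative.
  have hy2 : Ideal.Quotient.mk c ⟨y ^ 2, h2⟩ = 0 := by
    rw [Ideal.Quotient.eq_zero_iff_mem, hc, ← pow_succ]
    exact h3
  have emul : ∀ a b : A', ((a * b : A') : B) =
      ((p a * p b + r a * r b * ⟨y ^ 2, h2⟩ : A) : B) + ((p a * r b + p b * r a : A) : B) * y := by
    intro a b
    push_cast
    rw [hpr a, hpr b]
    ring
  have eadd : ∀ a b : A', ((a + b : A') : B) =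
      ((p a + p b : A) : B) + ((r a + r b : A) : B) * y := by
    intro a b
    push_cast
    rw [hpr a, hpr b]
    ring
  refine ⟨A ⧸ c, inferInstance, inferInstance,
    { π :=
        { toFun := fun z ↦ Ideal.Quotient.mk c (p z)
          map_one' := by rw [(mk 1 1 0 (by simp)).1, map_one]
          map_zero' := by rw [(mk 0 0 0 (by simp)).1, map_zero]
          map_mul' := fun a b ↦ by
            rw [(mk _ _ _ (emul a b)).1, map_add, map_mul, map_mul, hy2, mul_zero, add_zero]
          map_add' := fun a b ↦ by rw [(mk _ _ _ (eadd a b)).1, map_add] }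
      D :=
        { toFun := fun z ↦ Ideal.Quotient.mk c (r z)
          map_zero' := by rw [(mk 0 0 0 (by simp)).2, map_zero]
          map_add' := fun a b ↦ by rw [(mk _ _ _ (eadd a b)).2, map_add] }
      leibniz := fun a b ↦ ?_
      surjective := fun x x' ↦ ?_ }, fun a ↦ ?_⟩
  · exact (mk _ _ _ (emul a b)).2.trans (by rw [map_add, map_mul, map_mul]; rfl)
  · obtain ⟨x, rfl⟩ := Ideal.Quotient.mk_surjective x
    obtain ⟨x', rfl⟩ := Ideal.Quotient.mk_surjective x'
    exact ⟨⟨x + x' * y, (h _).mpr ⟨x, x.2, x', x'.2, rfl⟩⟩, mk _ _ _ rfl⟩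
  · change Ideal.Quotient.mk c (r a) = 0 ↔ _
    rw [Ideal.Quotient.eq_zero_iff_mem, hc, hpr a]
    exact ⟨fun h ↦ add_mem (p a).2 h, fun h ↦ (add_mem_cancel_left (p a).2).mp h⟩

/-- `A'` is obtained from `A` by finitely many elementary subintegral extensions. -/
inductive Reach (A : Subalgebra ℚ B) : Subalgebra ℚ B → Prop
  | refl : Reach A A
  | step {A₁ A₂ : Subalgebra ℚ B} : Reach A A₁ → IsElementary A₁ A₂ → Reach A A₂

lemma Reach.le {A A' : Subalgebra ℚ B} (h : Reach A A') : A ≤ A' := by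
  induction h with
  | refl => exact le_rfl
  | step _ h ih => exact ih.trans h.le

/-- The elements adjoined in one tower can be adjoined on top of the other, since their squares and
cubes remain in the larger ring. -/
lemma Reach.directed {A A₁ A₂ : Subalgebra ℚ B} (h₁ : Reach A A₁) (h₂ : Reach A A₂) :
    ∃ A', Reach A A' ∧ A₁ ≤ A' ∧ A₂ ≤ A' := by
  induction h₂ with
  | refl => exact ⟨A₁, h₁, le_rfl, h₁.le⟩
  | step _ h ih =>
    obtain ⟨A', hA', h1, h2⟩ := ih
    obtain ⟨y, hy2, hy3, hy⟩ := h
    obtain ⟨A'', hA'', hyA''⟩ := exists_isElementary A' (h2 hy2) (h2 hy3)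
    refine ⟨A'', hA'.step hA'', h1.trans hA''.le, fun z hz ↦ ?_⟩
    obtain ⟨p, hp, r, hr, rfl⟩ := (hy z).mp hz
    exact add_mem (hA''.le (h2 hp)) (mul_mem (hA''.le (h2 hr)) hyA'')

/-! ### Exponentials -/

open PowerSeries

/-- The power series `exp (b T)`. -/
noncomputable def expT (b : B) : B⟦X⟧ := rescale b (exp B)

lemma coeff_expT (b : B) (n : ℕ) : coeff n (expT b) = b ^ n * algebraMap ℚ B (1 / n.factorial) := by
  rw [expT, coeff_rescale, coeff_exp]

lemma expT_add (a b : B) : expT (a + b) = expT a * expT b :=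
  (exp_mul_exp_eq_exp_add a b).symm

lemma expT_zero : expT (0 : B) = 1 := by
  rw [expT, rescale_zero_apply, constantCoeff_exp, map_one]

lemma expT_mul_neg (b : B) : expT b * expT (-b) = 1 := by
  rw [← expT_add, add_neg_cancel, expT_zero]

lemma derivative_expT (b : B) : derivative B (expT b) = C b * expT b := by
  ext n
  rw [coeff_derivative, coeff_expT, coeff_C_mul, coeff_expT]
  have : (n : B) + 1 = algebraMap ℚ B (n + 1) := by simp
  rw [this, mul_assoc, ← map_mul, ← mul_assoc, ← pow_succ']
  congr 2
  rw [Nat.factorial_succ]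
  push_cast
  field_simp

/-- The power series with coefficients in `A`. -/
noncomputable def seriesOver (A : Subalgebra ℚ B) : Subring B⟦X⟧ := (PowerSeries.map A.val.toRingHom).range

lemma mem_seriesOver {A : Subalgebra ℚ B} {f : B⟦X⟧} :
    f ∈ A.seriesOver ↔ ∀ n, coeff n f ∈ A := by
  constructor
  · rintro ⟨g, rfl⟩ n
    rw [coeff_map]
    exact (coeff n g).2
  · intro h
    exact ⟨PowerSeries.mk fun n ↦ ⟨_, h n⟩, by ext n; simp⟩

lemma seriesOver_mono {A A' : Subalgebra ℚ B} (h : A ≤ A') : A.seriesOver ≤ A'.seriesOver :=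
  fun _ hf ↦ mem_seriesOver.mpr fun n ↦ h (mem_seriesOver.mp hf n)

lemma expT_mem {A : Subalgebra ℚ B} {b : B} (hb : b ∈ A) : expT b ∈ A.seriesOver :=
  mem_seriesOver.mpr fun n ↦ by
    rw [coeff_expT]
    exact mul_mem (pow_mem hb n) (A.algebraMap_mem _)

/-- `P ∈ B[T] ∩ exp (b T) A[[T]]`. -/
def ExpMem (A : Subalgebra ℚ B) (b : B) (P : Polynomial B) : Prop :=
  (P : B⟦X⟧) * expT (-b) ∈ A.seriesOver

lemma ExpMem.mul {A : Subalgebra ℚ B} {b b' : B} {P P' : Polynomial B} (h : ExpMem A b P)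
    (h' : ExpMem A b' P') : ExpMem A (b + b') (P * P') := by
  have : ((P * P' : Polynomial B) : B⟦X⟧) * expT (-(b + b')) =
      (P * expT (-b)) * (P' * expT (-b')) := by
    rw [neg_add, expT_add, Polynomial.coe_mul]
    ring
  rw [ExpMem, this]
  exact mul_mem h h'

lemma ExpMem.mono {A A' : Subalgebra ℚ B} (hA : A ≤ A') {b : B} {P : Polynomial B}
    (h : ExpMem A b P) : ExpMem A' b P := seriesOver_mono hA h

lemma expMem_zero_iff {A : Subalgebra ℚ B} {P : Polynomial B} :
    ExpMem A 0 P ↔ ∀ n, P.coeff n ∈ A := by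
  rw [ExpMem, neg_zero, expT_zero, mul_one, mem_seriesOver]
  simp

/-- For b ∈ A the series exp(bT) is a unit of A[[T]], so the twist has no effect. -/
lemma expMem_iff_of_mem {A : Subalgebra ℚ B} {b : B} (hb : b ∈ A) {P : Polynomial B} :
    ExpMem A b P ↔ ∀ n, P.coeff n ∈ A := by
  rw [← expMem_zero_iff, ExpMem, ExpMem]
  constructor
  · intro h
    have := mul_mem h (expT_mem hb)
    rwa [mul_assoc, mul_comm (expT (-b)), expT_mul_neg, mul_one, ← mul_one (P : B⟦X⟧),
      ← expT_zero (B := B), ← neg_zero] at this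
  · intro h
    have := mul_mem h (expT_mem (neg_mem hb))
    rwa [neg_zero, expT_zero, mul_one] at this

lemma eval_one_mem {A : Subalgebra ℚ B} {P : Polynomial B} (h : ∀ n, P.coeff n ∈ A) :
    P.eval 1 ∈ A := by
  rw [Polynomial.eval_eq_sum]
  exact sum_mem fun n _ ↦ by simpa using h n

/-- The `A[T]`-module `B[T] ∩ exp (b T) A[[T]]` is invertible, with inverse
`B[T] ∩ exp (- b T) A[[T]]`. -/
def IsExpGood (A : Subalgebra ℚ B) (b : B) : Prop :=
  ∃ (ι : Type) (_ : Fintype ι) (P N : ι → Polynomial B), (∀ i, ExpMem A b (P i)) ∧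
    (∀ i, ExpMem A (-b) (N i)) ∧ ∑ i, P i * N i = 1

lemma isExpGood_of_mem {A : Subalgebra ℚ B} {b : B} (hb : b ∈ A) : IsExpGood A b := by
  refine ⟨Unit, inferInstance, fun _ ↦ 1, fun _ ↦ 1, fun _ ↦ ?_, fun _ ↦ ?_, by simp⟩
  · rw [ExpMem, Polynomial.coe_one, one_mul]
    exact expT_mem (neg_mem hb)
  · rw [ExpMem, Polynomial.coe_one, one_mul, neg_neg]
    exact expT_mem hb

/-- The descent step: `exists_combination` is applied to aᵢ = Pᵢ exp(-bT) and a'ᵢ = Nᵢ exp(bT) over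
A'. The resulting combinations are killed by `D`, so their coefficients lie in A. -/
lemma IsExpGood.of_isElementary {A A' : Subalgebra ℚ B} (h : IsElementary A A') {b : B}
    (hb : IsExpGood A' b) : IsExpGood A b := by
  obtain ⟨K, _, _, δ, hδ⟩ := h.exists_twistedDerivation
  obtain ⟨ι, _, P, N, hP, hN, h1⟩ := hb
  choose a ha using hP
  choose a' ha' using hN
  set v := PowerSeries.map A'.val.toRingHom with hv
  have hvinj : Function.Injective v := PowerSeries.map_injective _ Subtype.val_injective
  have hvpol : ∀ f, v f ∈ polynomials B → f ∈ polynomials A' := by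
    intro f hf
    rw [mem_polynomials] at hf ⊢
    obtain ⟨M, hM⟩ := hf
    refine ⟨M, fun n hn ↦ Subtype.val_injective ?_⟩
    have := hM n hn
    rwa [hv, coeff_map] at this
  have hvd : ∀ f, v (derivative A' f) = derivative B (v f) := by
    intro f
    ext n
    simp [hv, coeff_derivative]
  have e : expT (-b) * expT b = 1 := by rw [mul_comm, expT_mul_neg]
  have haa : ∀ i j, v (a i * a' j) = ((P i * N j : Polynomial B) : B⟦X⟧) := fun i j ↦ by
    rw [map_mul, ha, ha', neg_neg, Polynomial.coe_mul]
    linear_combination (P i : B⟦X⟧) * N j * e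
  obtain ⟨Z, W, hZ, hW, hZD, hWD, h1'⟩ := δ.exists_combination a a'
    (hvinj (by
      rw [map_sum, map_one, Finset.sum_congr rfl fun i _ ↦ haa i i]
      have := congrArg Polynomial.coeToPowerSeries.ringHom h1
      simpa only [map_sum, map_one, Polynomial.coeToPowerSeries.ringHom_apply] using this))
    (fun i j ↦ hvpol _ (haa i j ▸ coe_mem_polynomials _))
    (fun i j ↦ hvpol _ (by
      -- The derivative of P exp(-bT) is (P' - bP) exp(-bT), and the exponential cancels against
      -- that of a'ⱼ.
      have : v (derivative A' (a i) * a' j) =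
          (((P i).derivative * N j - Polynomial.C b * P i * N j : Polynomial B) : B⟦X⟧) := by
        rw [map_mul, hvd, ha, ha', neg_neg, Derivation.leibniz, derivative_expT, derivative_coe,
          smul_eq_mul, smul_eq_mul, Polynomial.coe_sub, Polynomial.coe_mul, Polynomial.coe_mul,
          Polynomial.coe_mul, Polynomial.coe_C, map_neg]
        linear_combination ((P i).derivative * N j - C b * P i * N j : B⟦X⟧) * e
      rw [this]
      exact coe_mem_polynomials _))
  choose z hz using hZ
  choose w hw using hW
  have hzv : ∀ k i, (((z k i).map A'.val.toRingHom : Polynomial B) : B⟦X⟧) = v (Z k i) := by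
    intro k i
    rw [← hz, hv]
    ext n
    simp
  have hwv : ∀ k i, (((w k i).map A'.val.toRingHom : Polynomial B) : B⟦X⟧) = v (W k i) := by
    intro k i
    rw [← hw, hv]
    ext n
    simp
  have mem : ∀ f, δ.Ds f = 0 → v f ∈ A.seriesOver := by
    intro f hf
    refine mem_seriesOver.mpr fun n ↦ ?_
    have := congrArg (coeff n) hf
    rw [TwistedDerivation.coeff_Ds, map_zero, hδ] at this
    rwa [hv, coeff_map]
  let P' : ι ⊕ ι → Polynomial B := fun k ↦ ∑ i, (z k i).map A'.val.toRingHom * P i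
  let N' : ι ⊕ ι → Polynomial B := fun k ↦ ∑ i, (w k i).map A'.val.toRingHom * N i
  have hP' : ∀ k, (P' k : B⟦X⟧) * expT (-b) = v (∑ i, Z k i * a i) := by
    intro k
    simp only [P', ← Polynomial.coeToPowerSeries.ringHom_apply, map_sum, map_mul, ha,
      Finset.sum_mul]
    simp only [Polynomial.coeToPowerSeries.ringHom_apply, hzv, mul_assoc]
  have hN' : ∀ k, (N' k : B⟦X⟧) * expT b = v (∑ i, W k i * a' i) := by
    intro k
    simp only [N', ← Polynomial.coeToPowerSeries.ringHom_apply, map_sum, map_mul, ha',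
      Finset.sum_mul]
    simp only [Polynomial.coeToPowerSeries.ringHom_apply, hwv, mul_assoc, neg_neg]
  refine ⟨ι ⊕ ι, inferInstance, P', N', fun k ↦ ?_, fun k ↦ ?_, ?_⟩
  · rw [ExpMem, hP']
    exact mem _ (hZD k)
  · rw [ExpMem, neg_neg, hN']
    exact mem _ (hWD k)
  · apply Polynomial.coe_injective
    have := congrArg v h1'
    rw [map_sum, map_one] at this
    rw [Polynomial.coe_one, ← this, ← Polynomial.coeToPowerSeries.ringHom_apply, map_sum]
    refine Finset.sum_congr rfl fun k _ ↦ ?_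
    rw [Polynomial.coeToPowerSeries.ringHom_apply, Polynomial.coe_mul, map_mul, ← hP', ← hN']
    linear_combination -(P' k : B⟦X⟧) * N' k * e

/-- Over the top of the tower b is a scalar and the module is trivially invertible; invertibility
then descends one elementary step at a time. -/
lemma Reach.isExpGood {A A' : Subalgebra ℚ B} (h : Reach A A') {b : B} (hb : b ∈ A') :
    IsExpGood A b := by
  suffices IsExpGood A' b → IsExpGood A b from this (isExpGood_of_mem hb)
  clear hb
  induction h with
  | refl => exact id
  | step _ h ih => exact fun hb ↦ ih (.of_isElementary h hb)

end Subalgebra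

/-! ### Logarithms of units for a ring extension. -/

namespace Subalgebra

lemma eval_one_map {B B' : Type u} [CommRing B] [CommRing B'] (ψ : B →+* B') (P : Polynomial B) :
    (P.map ψ).eval 1 = ψ (P.eval 1) := by
  rw [Polynomial.eval_map, ← map_one ψ, Polynomial.eval₂_at_apply]

variable {B : Type u} [CommRing B] [Algebra ℚ B]

/-- Invertibility gives M(b + b') = M(b) M(b'): expand R = ∑ Pᵢ (Nᵢ R), where Nᵢ R lies in M(b'). -/
lemma IsExpGood.expMem_induction {A : Subalgebra ℚ B} {b b' : B} (hb : IsExpGood A b)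
    {p : Polynomial B → Prop} (hadd : ∀ P Q, p P → p Q → p (P + Q)) (h0 : p 0)
    (hmul : ∀ P Q, ExpMem A b P → ExpMem A b' Q → p (P * Q)) {R : Polynomial B}
    (hR : ExpMem A (b + b') R) : p R := by
  obtain ⟨ι, _, P, N, hP, hN, h1⟩ := hb
  have : R = ∑ i, P i * (N i * R) := by
    simp only [← mul_assoc]
    rw [← Finset.sum_mul, h1, one_mul]
  rw [this]
  refine Finset.sum_induction _ p hadd h0 fun i _ ↦ hmul _ _ (hP i) ?_
  have := (hN i).mul hR
  rwa [neg_add_cancel_left] at this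

/-! ### The logarithm of a unit -/

/-- The unit `u` represents the exponential of `b`, modulo units of `A`: the `A`-modules
`(B[T] ∩ exp (± b T) A[[T]])|_{T = 1}` are contained in `u^{± 1} A`. -/
structure IsLog (A : Subalgebra ℚ B) (b : B) (u : Bˣ) : Prop where
  mem (P : Polynomial B) (hP : ExpMem A b P) : ↑u⁻¹ * P.eval 1 ∈ A
  mem_neg (P : Polynomial B) (hP : ExpMem A (-b) P) : ↑u * P.eval 1 ∈ A

variable {A A' : Subalgebra ℚ B}

lemma isLog_of_mem {b : B} {u : Bˣ} (hb : b ∈ A) (hu : ↑u ∈ A) (hu' : ↑u⁻¹ ∈ A) :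
    IsLog A b u where
  mem _ hP := mul_mem hu' (eval_one_mem ((expMem_iff_of_mem hb).mp hP))
  mem_neg _ hP := mul_mem hu (eval_one_mem ((expMem_iff_of_mem (neg_mem hb)).mp hP))

lemma IsLog.neg {b : B} {u : Bˣ} (h : IsLog A b u) : IsLog A (-b) u⁻¹ where
  mem P hP := by simpa using h.mem_neg P hP
  mem_neg P hP := h.mem P (by simpa using hP)

lemma IsLog.add {b b' : B} {u u' : Bˣ} (hb : IsExpGood A b) (hb' : IsExpGood A (-b))
    (h : IsLog A b u) (h' : IsLog A b' u') : IsLog A (b + b') (u * u') where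
  mem P hP := by
    refine hb.expMem_induction (p := fun P ↦ ↑(u * u')⁻¹ * P.eval 1 ∈ A) ?_ (by simp) ?_ hP
    · intro _ _ hP hQ
      rw [Polynomial.eval_add, mul_add]
      exact add_mem hP hQ
    · intro P Q hP hQ
      have := mul_mem (h.mem P hP) (h'.mem Q hQ)
      rw [Polynomial.eval_mul, mul_inv, Units.val_mul]
      convert this using 1
      ring
  mem_neg P hP := by
    rw [neg_add] at hP
    refine hb'.expMem_induction (p := fun P ↦ ↑(u * u') * P.eval 1 ∈ A) ?_ (by simp) ?_ hP
    · intro _ _ hP hQ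
      rw [Polynomial.eval_add, mul_add]
      exact add_mem hP hQ
    · intro P Q hP hQ
      have := mul_mem (h.mem_neg P hP) (h'.mem_neg Q hQ)
      rw [Polynomial.eval_mul, Units.val_mul]
      convert this using 1
      ring

/-- Criterion for `IsLog` in terms of a presentation of `1`. -/
lemma isLog_of_sum {b : B} {u : Bˣ} {ι : Type} [Fintype ι] (P N : ι → Polynomial B)
    (hP : ∀ i, ExpMem A b (P i)) (hN : ∀ i, ExpMem A (-b) (N i))
    (h1 : ∑ i, (P i).eval 1 * (N i).eval 1 = 1)
    (hPu : ∀ i, ↑u⁻¹ * (P i).eval 1 ∈ A) (hNu : ∀ i, ↑u * (N i).eval 1 ∈ A) : IsLog A b u where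
  mem Q hQ := by
    have : ↑u⁻¹ * Q.eval 1 = ∑ i, (↑u⁻¹ * (P i).eval 1) * (Q * N i).eval 1 := by
      trans (↑u⁻¹ * Q.eval 1) * ∑ i, (P i).eval 1 * (N i).eval 1
      · rw [h1, mul_one]
      rw [Finset.mul_sum]
      refine Finset.sum_congr rfl fun i _ ↦ ?_
      rw [Polynomial.eval_mul]
      ring
    rw [this]
    refine sum_mem fun i _ ↦ mul_mem (hPu i) (eval_one_mem (expMem_zero_iff.mp ?_))
    simpa using hQ.mul (hN i)
  mem_neg Q hQ := by
    have : ↑u * Q.eval 1 = ∑ i, (↑u * (N i).eval 1) * (P i * Q).eval 1 := by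
      trans (↑u * Q.eval 1) * ∑ i, (P i).eval 1 * (N i).eval 1
      · rw [h1, mul_one]
      rw [Finset.mul_sum]
      refine Finset.sum_congr rfl fun i _ ↦ ?_
      rw [Polynomial.eval_mul]
      ring
    rw [this]
    refine sum_mem fun i _ ↦ mul_mem (hNu i) (eval_one_mem (expMem_zero_iff.mp ?_))
    simpa using (hP i).mul hQ

lemma expT_map {B' : Type u} [CommRing B'] [Algebra ℚ B'] (ψ : B →+* B') (b : B) :
    PowerSeries.map ψ (expT b) = expT (ψ b) := by
  ext n
  rw [PowerSeries.coeff_map, coeff_expT, coeff_expT, map_mul, map_pow]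
  congr 1
  exact (DFunLike.congr_fun (Subsingleton.elim (ψ.comp (algebraMap ℚ B)) (algebraMap ℚ B')) _)

lemma ExpMem.map {B' : Type u} [CommRing B'] [Algebra ℚ B'] {A' : Subalgebra ℚ B'} (ψ : B →+* B')
    (hψ : ∀ a ∈ A, ψ a ∈ A') {b : B} {P : Polynomial B} (hP : ExpMem A b P) :
    ExpMem A' (ψ b) (P.map ψ) := by
  have : ((P.map ψ : Polynomial B') : PowerSeries B') * expT (-ψ b) =
      PowerSeries.map ψ (P * expT (-b)) := by
    rw [map_mul, expT_map, map_neg]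
    congr 1
    ext; simp
  rw [ExpMem, this, mem_seriesOver]
  intro n
  rw [PowerSeries.coeff_map]
  exact hψ _ (mem_seriesOver.mp hP n)

/-- The images of Pᵢ and Nᵢ still present 1, so by `isLog_of_sum` the membership conditions need
only be tested on them. -/
lemma IsLog.map {B' : Type u} [CommRing B'] [Algebra ℚ B'] {A' : Subalgebra ℚ B'} (ψ : B →+* B')
    (hψ : ∀ a ∈ A, ψ a ∈ A') {b : B} {u : Bˣ} (hb : IsExpGood A b) (h : IsLog A b u) :
    IsLog A' (ψ b) (Units.map (ψ : B →* B') u) := by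
  obtain ⟨ι, _, P, N, hP, hN, h1⟩ := hb
  have h1' : ∑ i, (P i).eval 1 * (N i).eval 1 = 1 := by
    simpa [Polynomial.eval_finsetSum] using congrArg (Polynomial.eval 1) h1
  refine isLog_of_sum (fun i ↦ (P i).map ψ) (fun i ↦ (N i).map ψ) (fun i ↦ (hP i).map ψ hψ)
    (fun i ↦ by simpa using (hN i).map ψ hψ) ?_ (fun i ↦ ?_) (fun i ↦ ?_)
  · simp only [eval_one_map, ← map_mul, ← map_sum, h1', map_one]
  · simpa [eval_one_map] using hψ _ (h.mem _ (hP i))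
  · simpa [eval_one_map] using hψ _ (h.mem_neg _ (hN i))

/-- Locally, every element has an exponential. -/
lemma IsExpGood.exists_isLog {b : B} (hb : IsExpGood A b) :
    ∃ (ι : Type) (_ : Fintype ι) (p n : ι → B), (∀ i, p i * n i ∈ A) ∧ ∑ i, p i * n i = 1 ∧
      ∀ (B' : Type u) [CommRing B'] [Algebra ℚ B'] (A' : Subalgebra ℚ B') (ψ : B →+* B')
        (_ : ∀ a ∈ A, ψ a ∈ A') (i : ι) (v : B') (_ : v ∈ A') (_ : ψ (p i * n i) * v = 1),
        ∃ u : B'ˣ, IsLog A' (ψ b) u := by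
  obtain ⟨ι, _, P, N, hP, hN, h1⟩ := hb
  refine ⟨ι, inferInstance, fun i ↦ (P i).eval 1, fun i ↦ (N i).eval 1, fun i ↦ ?_, ?_, ?_⟩
  · rw [← Polynomial.eval_mul]
    refine eval_one_mem (expMem_zero_iff.mp ?_)
    simpa using (hP i).mul (hN i)
  · simpa [Polynomial.eval_finsetSum] using congrArg (Polynomial.eval 1) h1
  · intro B' _ _ A' ψ hψ i v hv hv1
    -- Where Pᵢ(1) Nᵢ(1) ∈ A becomes invertible, the module at T = 1 is generated by Pᵢ(1), which is
    -- a unit with inverse Nᵢ(1) v.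
    let u : B'ˣ := ⟨ψ ((P i).eval 1), ψ ((N i).eval 1) * v, by rw [← hv1, map_mul, mul_assoc],
      by rw [← hv1, map_mul]; ring⟩
    have hPi := (hP i).map ψ hψ
    have hNi := (hN i).map ψ hψ
    rw [map_neg] at hNi
    refine ⟨u, fun Q hQ ↦ ?_, fun Q hQ ↦ ?_⟩
    · have : ↑u⁻¹ * Q.eval 1 = v * (Q * (N i).map ψ).eval 1 := by
        rw [Polynomial.eval_mul, eval_one_map]
        change ψ ((N i).eval 1) * v * Q.eval 1 = _
        ring
      rw [this]
      refine mul_mem hv (eval_one_mem (expMem_zero_iff.mp ?_))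
      simpa using hQ.mul hNi
    · have : ↑u * Q.eval 1 = ((P i).map ψ * Q).eval 1 := by
        rw [Polynomial.eval_mul, eval_one_map]
      rw [this]
      refine eval_one_mem (expMem_zero_iff.mp ?_)
      simpa using hPi.mul hQ

lemma IsLog.of_le (hA : A ≤ A') {b : B} {u : Bˣ} (hb : IsExpGood A b) (h : IsLog A b u) :
    IsLog A' b u := by
  simpa using h.map (RingHom.id B) hA hb

/-- The chain rule: `D` acts on coefficients, so T is a constant for it and bT contributes the
factor D(b) T. -/
lemma _root_.TwistedDerivation.Ds_expT {R K : Type u} [CommRing R] [CommRing K] [Algebra ℚ R]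
    [Algebra ℚ K] (δ : TwistedDerivation R K) (b : R) :
    δ.Ds (expT b) = δ.πs (expT b) * PowerSeries.C (δ.D b) * PowerSeries.X := by
  have hpow : ∀ n : ℕ, δ.D (b ^ (n + 1)) = (n + 1) * δ.π b ^ n * δ.D b := fun n ↦ by
    induction n with
    | zero => simp
    | succ n ih =>
      rw [pow_succ, δ.leibniz, ih, map_pow]
      push_cast
      ring
  have hsmul : ∀ (r : ℚ) (x : R), δ.D (x * algebraMap ℚ R r) = algebraMap ℚ K r * δ.D x :=
    fun r x ↦ by rw [mul_comm, ← Algebra.smul_def, ← Algebra.smul_def, map_rat_smul]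
  ext n
  rcases n with _ | n
  · rw [TwistedDerivation.coeff_Ds, coeff_expT, pow_zero, one_mul]
    simp [δ.D_one]
  · rw [PowerSeries.coeff_succ_mul_X, TwistedDerivation.coeff_Ds, PowerSeries.coeff_mul_C,
      TwistedDerivation.coeff_πs, coeff_expT, coeff_expT, hsmul, hpow, map_mul, map_pow]
    have : δ.π (algebraMap ℚ R (1 / n.factorial)) = algebraMap ℚ K (1 / n.factorial) :=
      DFunLike.congr_fun (Subsingleton.elim (δ.π.comp (algebraMap ℚ R)) (algebraMap ℚ K)) _
    rw [this]
    have h2 : algebraMap ℚ K (1 / (n + 1).factorial) * ((n : K) + 1) =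
        algebraMap ℚ K (1 / n.factorial) := by
      have : ((n : K) + 1) = algebraMap ℚ K (n + 1) := by simp
      rw [this, ← map_mul]
      congr 1
      rw [Nat.factorial_succ]
      push_cast
      field_simp
    linear_combination (δ.π b ^ n * δ.D b) * h2

/-- In an elementary extension, the derivation computes logarithms. -/
lemma ExpMem.D_eval {K : Type u} [CommRing K] [Algebra ℚ K]
    {δ : TwistedDerivation A' K} (hδ : ∀ a : A', δ.D a = 0 ↔ (a : B) ∈ A) (hA : A ≤ A')
    {b : A'} {P : Polynomial B} (hP : ExpMem A (b : B) P) {p : A'} (hp : (p : B) = P.eval 1) :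
    δ.D p = δ.π p * δ.D b := by
  obtain ⟨P, rfl⟩ : ∃ P' : Polynomial A', P'.map A'.val.toRingHom = P := by
    have := (expMem_iff_of_mem b.2).mp (hP.mono hA)
    exact (Polynomial.mem_lifts _).mp
      ((Polynomial.lifts_iff_coeff_lifts _).mpr fun n ↦ ⟨⟨_, this n⟩, rfl⟩)
  obtain rfl : p = P.eval 1 := Subtype.val_injective (hp.trans (eval_one_map _ _))
  have hg : δ.Ds (P * expT (-b)) = 0 := by
    ext n
    rw [TwistedDerivation.coeff_Ds, map_zero, hδ]
    have := mem_seriesOver.mp hP n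
    have e : ((P.map A'.val.toRingHom : Polynomial B) : PowerSeries B) * expT (-(b : B)) =
        PowerSeries.map A'.val.toRingHom (P * expT (-b)) := by
      rw [map_mul, expT_map, map_neg]
      congr 1
      ext; simp
    rw [e, PowerSeries.coeff_map] at this
    exact this
  -- Since P exp(-bT) is killed by `D`, the series P has the same logarithmic derivative D(b) T as
  -- exp(bT). Setting T = 1 gives the claim.
  have hf : δ.Ds (P : PowerSeries A') =
      δ.πs P * PowerSeries.C (δ.D b) * PowerSeries.X := by
    have e : (P : PowerSeries A') = P * expT (-b) * expT b := by
      rw [mul_assoc, mul_comm (expT (-b)), expT_mul_neg, mul_one]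
    rw [e, TwistedDerivation.Ds_mul, hg, mul_zero, add_zero, δ.Ds_expT, map_mul δ.πs _ (expT b)]
    ring
  have hcoeff : ∀ n, δ.D (P.coeff n) =
      ((P.map δ.π) * Polynomial.C (δ.D b) * Polynomial.X).coeff n := fun n ↦ by
    have := congrArg (PowerSeries.coeff n) hf
    rw [TwistedDerivation.coeff_Ds, Polynomial.coeff_coe] at this
    rw [this, ← Polynomial.coeff_coe, Polynomial.coe_mul, Polynomial.coe_mul, Polynomial.coe_C,
      Polynomial.coe_X]
    congr 3
    ext; simp
  -- The right-hand side has an extra factor T; the degree bound allows both sides to be summed over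
  -- the same range at T = 1.
  have hdeg : (P.map δ.π * Polynomial.C (δ.D b) * Polynomial.X).natDegree < P.natDegree + 1 := by
    rw [Nat.lt_succ_iff, Polynomial.natDegree_le_iff_coeff_eq_zero]
    intro n hn
    rw [← hcoeff, Polynomial.coeff_eq_zero_of_natDegree_lt hn, map_zero]
  have := Polynomial.eval_eq_sum_range' hdeg 1
  rw [Polynomial.eval_eq_sum_range, map_sum]
  simp only [one_pow, mul_one, ← hcoeff, Polynomial.eval_mul, Polynomial.eval_C,
    Polynomial.eval_X, eval_one_map] at this ⊢
  rw [← this, Polynomial.eval_eq_sum_range]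
  simp

/-- Logarithms of units of `A` lie in `A`. -/
lemma IsLog.mem_of_isElementary (h : IsElementary A A') {b : B} {u : Bˣ} (hb : IsExpGood A b)
    (hu : ↑u ∈ A) (hu' : ↑u⁻¹ ∈ A) (hbu : IsLog A b u) (hbA : b ∈ A') : b ∈ A := by
  obtain ⟨K, _, _, δ, hδ⟩ := h.exists_twistedDerivation
  obtain ⟨ι, _, P, N, hP, hN, h1⟩ := hb
  have hPA : ∀ i, (P i).eval 1 ∈ A := fun i ↦ by
    simpa using mul_mem hu (hbu.mem _ (hP i))
  have hNA : ∀ i, (N i).eval 1 ∈ A := fun i ↦ by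
    simpa using mul_mem hu' (hbu.mem_neg _ (hN i))
  have h1' : ∑ i, (P i).eval 1 * (N i).eval 1 = 1 := by
    simpa [Polynomial.eval_finsetSum] using congrArg (Polynomial.eval 1) h1
  let p : ι → A' := fun i ↦ ⟨_, h.le (hPA i)⟩
  let n : ι → A' := fun i ↦ ⟨_, h.le (hNA i)⟩
  have h1'' : ∑ i, p i * n i = 1 := Subtype.val_injective (by simpa [p, n] using h1')
  -- Here pᵢ = u (u⁻¹ pᵢ) lies in A, so 0 = D(pᵢ) = π(pᵢ) D(b). The π(pᵢ) generate the unit ideal,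
  -- which forces D(b) = 0.
  have hD : ∀ i, δ.π (p i) * δ.D ⟨b, hbA⟩ = 0 := fun i ↦ by
    rw [← ExpMem.D_eval hδ h.le (b := ⟨b, hbA⟩) (hP i) (p := p i) rfl, hδ]
    exact hPA i
  refine (hδ ⟨b, hbA⟩).mp ?_
  rw [← one_mul (δ.D _), ← map_one δ.π, ← h1'', map_sum, Finset.sum_mul]
  refine Finset.sum_eq_zero fun i _ ↦ ?_
  rw [map_mul, mul_right_comm, hD, zero_mul]

/-- All w = u⁻¹ P(1) with P ∈ M(b) have the same logarithmic derivative d. Adding to b an element c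
of A' with D(c) = -d cancels it, so that the new values are killed by `D` and lie in A. -/
lemma IsLog.exists_of_isElementary (h : IsElementary A A') {b : B} {u : Bˣ} (hb : IsExpGood A b)
    (hb' : IsExpGood A (-b)) (hbu : IsLog A' b u) : ∃ b', IsLog A b' u := by
  obtain ⟨K, _, _, δ, hδ⟩ := h.exists_twistedDerivation
  obtain ⟨ι, _, P, N, hP, hN, h1⟩ := id hb
  have h1' : ∑ i, (P i).eval 1 * (N i).eval 1 = 1 := by
    simpa [Polynomial.eval_finsetSum] using congrArg (Polynomial.eval 1) h1
  let v : ι → A' := fun i ↦ ⟨_, hbu.mem _ ((hP i).mono h.le)⟩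
  let n : ι → A' := fun i ↦ ⟨_, hbu.mem_neg _ ((hN i).mono h.le)⟩
  have hvn : ∑ i, v i * n i = 1 := Subtype.val_injective (by
    rw [AddSubmonoidClass.coe_finsetSum, OneMemClass.coe_one, ← h1']
    refine Finset.sum_congr rfl fun i _ ↦ ?_
    change (↑u⁻¹ * (P i).eval 1) * (↑u * (N i).eval 1) = _
    linear_combination ((P i).eval 1 * (N i).eval 1) * u.inv_mul)
  have hπ : ∑ i, δ.π (v i) * δ.π (n i) = 1 := by
    rw [← map_one δ.π, ← hvn, map_sum]
    simp only [map_mul]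
  set d := ∑ i, δ.D (v i) * δ.π (n i) with hd
  have hd' : ∑ i, δ.π (v i) * δ.D (n i) = -d := by
    rw [eq_neg_iff_add_eq_zero, hd, ← Finset.sum_add_distrib, ← δ.D_one, ← hvn, map_sum]
    exact Finset.sum_congr rfl fun i _ ↦ by rw [δ.leibniz]; ring
  have hDP : ∀ (Q : Polynomial B) (hQ : ExpMem A b Q),
      δ.D ⟨_, hbu.mem _ (hQ.mono h.le)⟩ = δ.π ⟨_, hbu.mem _ (hQ.mono h.le)⟩ * d := by
    intro Q hQ
    set w : A' := ⟨_, hbu.mem _ (hQ.mono h.le)⟩ with hw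
    -- In w nᵢ the factors u and u⁻¹ cancel and the twists b and -b cancel, which leaves an element
    -- of A.
    have h0 : ∀ i, δ.D (w * n i) = 0 := fun i ↦ by
      rw [hδ]
      have : ((w * n i : A') : B) = (Q * N i).eval 1 := by
        change (↑u⁻¹ * Q.eval 1) * (↑u * (N i).eval 1) = _
        rw [Polynomial.eval_mul]
        linear_combination (Q.eval 1 * (N i).eval 1) * u.inv_mul
      rw [this]
      refine eval_one_mem (expMem_zero_iff.mp ?_)
      simpa using hQ.mul (hN i)
    have h2 : ∀ i, δ.D w * (δ.π (v i) * δ.π (n i)) = - (δ.π w * (δ.π (v i) * δ.D (n i))) :=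
      fun i ↦ by
        have := h0 i
        rw [δ.leibniz] at this
        linear_combination δ.π (v i) * this
    rw [← mul_one (δ.D w), ← hπ, Finset.mul_sum, Finset.sum_congr rfl fun i _ ↦ h2 i,
      Finset.sum_neg_distrib, ← Finset.mul_sum, hd']
    ring
  have hDN : ∀ (Q : Polynomial B) (hQ : ExpMem A (-b) Q),
      δ.D ⟨_, hbu.mem_neg _ (hQ.mono h.le)⟩ = - (δ.π ⟨_, hbu.mem_neg _ (hQ.mono h.le)⟩ * d) := by
    intro Q hQ
    set w : A' := ⟨_, hbu.mem_neg _ (hQ.mono h.le)⟩ with hw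
    have h0 : ∀ i, δ.D (w * v i) = 0 := fun i ↦ by
      rw [hδ]
      have : ((w * v i : A') : B) = (P i * Q).eval 1 := by
        change (↑u * Q.eval 1) * (↑u⁻¹ * (P i).eval 1) = _
        rw [Polynomial.eval_mul]
        linear_combination (Q.eval 1 * (P i).eval 1) * u.inv_mul
      rw [this]
      refine eval_one_mem (expMem_zero_iff.mp ?_)
      simpa using (hP i).mul hQ
    have h2 : ∀ i, δ.D w * (δ.π (v i) * δ.π (n i)) = - (δ.π w * (δ.D (v i) * δ.π (n i))) :=
      fun i ↦ by
        have := h0 i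
        rw [δ.leibniz] at this
        linear_combination δ.π (n i) * this
    rw [← mul_one (δ.D w), ← hπ, Finset.mul_sum, Finset.sum_congr rfl fun i _ ↦ h2 i,
      Finset.sum_neg_distrib, ← Finset.mul_sum]
  -- Only D(c) matters; the value 0 for π(c) is arbitrary.
  obtain ⟨c, -, hc⟩ := δ.surjective 0 (-d)
  refine ⟨b + c, fun Q hQ ↦ ?_, fun Q hQ ↦ ?_⟩
  · refine hb.expMem_induction (p := fun P ↦ ↑u⁻¹ * P.eval 1 ∈ A) ?_ (by simp) ?_ hQ
    · intro _ _ hP hQ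
      rw [Polynomial.eval_add, mul_add]
      exact add_mem hP hQ
    · intro P Q hP hQ
      have hQA : Q.eval 1 ∈ A' := eval_one_mem ((expMem_iff_of_mem c.2).mp (hQ.mono h.le))
      have hDQ := ExpMem.D_eval hδ h.le hQ (p := ⟨_, hQA⟩) rfl
      have : δ.D (⟨_, hbu.mem _ (hP.mono h.le)⟩ * ⟨_, hQA⟩) = 0 := by
        rw [δ.leibniz, hDQ, hDP P hP, hc]
        ring
      rw [hδ] at this
      rw [Polynomial.eval_mul, ← mul_assoc]
      exact this
  · rw [neg_add] at hQ
    refine hb'.expMem_induction (p := fun P ↦ ↑u * P.eval 1 ∈ A) ?_ (by simp) ?_ hQ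
    · intro _ _ hP hQ
      rw [Polynomial.eval_add, mul_add]
      exact add_mem hP hQ
    · intro P Q hP hQ
      have hQA : Q.eval 1 ∈ A' :=
        eval_one_mem ((expMem_iff_of_mem (neg_mem c.2)).mp (hQ.mono h.le))
      have hDQ := ExpMem.D_eval hδ h.le (b := -c) hQ (p := ⟨_, hQA⟩) rfl
      have : δ.D (⟨_, hbu.mem_neg _ (hP.mono h.le)⟩ * ⟨_, hQA⟩) = 0 := by
        rw [δ.leibniz, hDQ, hDN P hP, map_neg, hc]
        ring
      rw [hδ] at this
      rw [Polynomial.eval_mul, ← mul_assoc]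
      exact this

lemma IsExpGood.mono (hA : A ≤ A') {b : B} (h : IsExpGood A b) : IsExpGood A' b := by
  obtain ⟨ι, _, P, N, hP, hN, h1⟩ := h
  exact ⟨ι, _, P, N, fun i ↦ (hP i).mono hA, fun i ↦ (hN i).mono hA, h1⟩

lemma Reach.mem_of_isLog (h : Reach A A') (hA : ∀ b, IsExpGood A b) {b : B} {u : Bˣ}
    (hu : ↑u ∈ A) (hu' : ↑u⁻¹ ∈ A) (hbu : IsLog A b u) (hb : b ∈ A') : b ∈ A := by
  induction h with
  | refl => exact hb
  | step hr h ih =>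
    exact ih (IsLog.mem_of_isElementary h ((hA b).mono hr.le) (hr.le hu) (hr.le hu')
      (hbu.of_le hr.le (hA b)) hb)

/-- Over a ring containing u and u⁻¹ the element 0 is a logarithm; it is then corrected at each step
down the tower. -/
lemma Reach.exists_isLog (h : Reach A A') (hA : ∀ b, IsExpGood A b) {u : Bˣ}
    (hu : ↑u ∈ A') (hu' : ↑u⁻¹ ∈ A') : ∃ b, IsLog A b u := by
  suffices (∃ b, IsLog A' b u) → ∃ b, IsLog A b u from
    this ⟨0, isLog_of_mem (zero_mem _) hu hu'⟩
  clear hu hu'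
  induction h with
  | refl => exact id
  | step hr h ih =>
    rintro ⟨b, hb⟩
    exact ih (hb.exists_of_isElementary h ((hA b).mono hr.le) ((hA (-b)).mono hr.le))

end Subalgebra

/-! ### Subintegral extensions are exhausted by towers of elementary ones. -/

namespace Subalgebra

variable {B : Type u} [CommRing B] [Algebra ℚ B]

/-- The union of all subalgebras that are reached from `A` by elementary extensions. -/
def reachClosure (A : Subalgebra ℚ B) : Subalgebra ℚ B where
  carrier := {x | ∃ A', Reach A A' ∧ x ∈ A'}
  mul_mem' := by
    rintro x y ⟨A₁, h₁, hx⟩ ⟨A₂, h₂, hy⟩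
    obtain ⟨A', h, h1, h2⟩ := h₁.directed h₂
    exact ⟨A', h, mul_mem (h1 hx) (h2 hy)⟩
  add_mem' := by
    rintro x y ⟨A₁, h₁, hx⟩ ⟨A₂, h₂, hy⟩
    obtain ⟨A', h, h1, h2⟩ := h₁.directed h₂
    exact ⟨A', h, add_mem (h1 hx) (h2 hy)⟩
  algebraMap_mem' := fun r ↦ ⟨A, .refl, A.algebraMap_mem r⟩

lemma mem_reachClosure_of_sq_of_cube {A : Subalgebra ℚ B} {x : B} (h2 : x ^ 2 ∈ A.reachClosure)
    (h3 : x ^ 3 ∈ A.reachClosure) : x ∈ A.reachClosure := by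
  obtain ⟨A₁, h₁, hx⟩ := h2
  obtain ⟨A₂, h₂, hy⟩ := h3
  obtain ⟨A', h, h1, h2⟩ := h₁.directed h₂
  obtain ⟨A'', h', hx'⟩ := exists_isElementary A' (h1 hx) (h2 hy)
  exact ⟨A'', h.step h', hx'⟩

/-- The elements of `B` that are subintegral over `A`, tested on prime ideals. -/
structure IsSubintegral (A : Subalgebra ℚ B) : Prop where
  isIntegral : Algebra.IsIntegral A B
  inj (P Q : Ideal B) (hP : P.IsPrime) (hQ : Q.IsPrime) (h : ∀ a ∈ A, a ∈ P ↔ a ∈ Q) : P = Q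
  residue (P : Ideal B) (hP : P.IsPrime) (x : B) : ∃ s ∈ A, ∃ a ∈ A, s ∉ P ∧ s * x - a ∈ P

lemma le_reachClosure (A : Subalgebra ℚ B) : A ≤ A.reachClosure := fun _ ha ↦ ⟨A, .refl, ha⟩

/-- A subintegral extension that is seminormal is trivial. -/
lemma IsSubintegral.eq_top_of_seminormal {A C : Subalgebra ℚ B} (hA : A.IsSubintegral)
    (hAC : A ≤ C) (hC : ∀ x : B, x ^ 2 ∈ C → x ^ 3 ∈ C → x ∈ C) (x : B) : x ∈ C := by
  by_contra hx
  have hint : Algebra.IsIntegral C B := ⟨fun b ↦ by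
    obtain ⟨p, hp, e⟩ := hA.isIntegral.isIntegral b
    refine ⟨p.map (inclusion hAC).toRingHom, hp.map _, ?_⟩
    rw [Polynomial.eval₂_map]
    exact e⟩
  let C' : Subalgebra C B := Algebra.adjoin C {x}
  have hxC' : x ∈ C' := Algebra.self_mem_adjoin_singleton C x
  -- The conductor of C in C[x], a proper ideal because x ∉ C.
  let c : Ideal C' :=
    { carrier := {z | ∀ w : C', (z * w : B) ∈ C}
      zero_mem' := fun w ↦ by simp
      add_mem' := fun {a b} ha hb w ↦ by
        push_cast
        rw [add_mul]
        exact add_mem (ha w) (hb w)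
      smul_mem' := fun a b hb w ↦ by
        have := hb (a * w)
        push_cast [smul_eq_mul] at this ⊢
        rwa [mul_comm (a : B), mul_assoc] }
  have hc : ∀ z : C', z ∈ c ↔ ∀ w : C', (z * w : B) ∈ C := fun z ↦ Iff.rfl
  -- Seminormality enters here: if z² ∈ c, then (zw)² = z² w² and (zw)³ = z² (z w³) lie in C, hence
  -- so does zw.
  have hrad : c.IsRadical := by
    rw [Ideal.isRadical_iff_pow_one_lt 2 (by norm_num)]
    intro z hz w
    refine hC _ ?_ ?_
    · have := hz (w ^ 2)
      push_cast at this
      rwa [← mul_pow] at this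
    · have := hz (z * w ^ 3)
      push_cast at this
      convert this using 1
      ring
  have hc1 : c.comap (algebraMap C C') ≠ ⊤ := by
    rw [Ne, Ideal.eq_top_iff_one, Ideal.mem_comap, map_one, hc]
    intro h
    exact hx (by simpa using h ⟨x, hxC'⟩)
  obtain ⟨p, hp⟩ := Ideal.nonempty_minimalPrimes hc1
  have hpp : p.IsPrime := hp.1.1
  obtain ⟨q, -, hqp, hq⟩ := Ideal.exists_ideal_over_prime_of_isIntegral (S := B) p ⊥ (by
    intro y hy
    have : y = 0 := Subtype.val_injective (Ideal.mem_bot.mp (Ideal.mem_comap.mp hy))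
    rw [this]
    exact zero_mem _)
  obtain ⟨s, hs, a, ha, hsq, hz⟩ := hA.residue q hqp x
  let z : C' := ⟨s * x - a, sub_mem (mul_mem (C'.algebraMap_mem ⟨s, hAC hs⟩) hxC')
    (C'.algebraMap_mem ⟨a, hAC ha⟩)⟩
  have hmem : ∀ y : C, y ∈ p ↔ (y : B) ∈ q := fun y ↦ by rw [← hq]; rfl
  -- A prime of C[x] containing c and disjoint from M would contract to p, hence lie below q, the
  -- only prime of B over p, and so contain z. Thus c meets M, which gives tzⁿ ∈ c with t ∉ p, and
  -- tz ∈ c by radicality.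
  let M : Submonoid C' := p.primeCompl.map (algebraMap C C') ⊔ Submonoid.powers z
  have hM : ¬ Disjoint (c : Set C') M := by
    intro hdis
    obtain ⟨Q, hQp, hcQ, hQM⟩ := Ideal.exists_le_prime_disjoint c M hdis
    have hQC : Q.comap (algebraMap C C') ≤ p := fun y hy ↦ by
      by_contra hyp
      exact Set.disjoint_left.mp hQM hy (Submonoid.mem_sup_left ⟨y, hyp, rfl⟩)
    have hQC' : Q.comap (algebraMap C C') = p := le_antisymm hQC
      (hp.2 ⟨inferInstance, Ideal.comap_mono hcQ⟩ hQC)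
    have : Algebra.IsIntegral C' B := ⟨fun b ↦ (hint.isIntegral b).tower_top⟩
    obtain ⟨Q', -, hQ'p, hQ'⟩ := Ideal.exists_ideal_over_prime_of_isIntegral (S := B) Q ⊥ (by
      intro y hy
      have : y = 0 := Subtype.val_injective (Ideal.mem_bot.mp (Ideal.mem_comap.mp hy))
      rw [this]
      exact zero_mem _)
    have hQq : Q' = q := hA.inj _ _ hQ'p hqp fun b hb ↦ by
      have h1 := hmem ⟨b, hAC hb⟩
      rw [← hQC', ← hQ'] at h1
      exact h1
    have hzQ : z ∈ Q := by
      rw [← hQ', hQq]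
      exact hz
    exact Set.disjoint_left.mp hQM hzQ (Submonoid.mem_sup_right ⟨1, pow_one z⟩)
  obtain ⟨y, hyc, hyM⟩ := Set.not_disjoint_iff.mp hM
  obtain ⟨_, ⟨t, ht, rfl⟩, _, ⟨n, rfl⟩, rfl⟩ := Submonoid.mem_sup.mp hyM
  have htz : algebraMap C C' t * z ∈ c := by
    apply hrad
    refine ⟨n + 1, ?_⟩
    have : (algebraMap C C' t * z) ^ (n + 1) =
        (algebraMap C C' t ^ n * z) * (algebraMap C C' t * z ^ n) := by ring
    rw [this]
    exact c.mul_mem_left _ hyc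
  -- The residue condition sx ≡ a modulo q now becomes τx ∈ C with τ = ts outside p.
  let τ : C := t * ⟨s, hAC hs⟩
  have hτ : τ ∉ p := fun h ↦ (hpp.mem_or_mem h).elim ht
    (fun h ↦ hsq ((hmem ⟨s, hAC hs⟩).mp h))
  have hτx : (τ : B) * x ∈ C := by
    have h1 := htz 1
    have h2 : (τ : B) * x = (algebraMap C C' t * z : C') * (1 : C') + t * a := by
      change (t : B) * s * x = (t : B) * (s * x - a) * 1 + t * a
      ring
    rw [h2]
    exact add_mem h1 (mul_mem t.2 (hAC ha))
  have hpow : ∀ w ∈ C', ∃ n : ℕ, ∀ m, n ≤ m → (τ : B) ^ m * w ∈ C := by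
    intro w hw
    induction hw using Algebra.adjoin_induction with
    | mem y hy =>
      obtain rfl : y = x := hy
      refine ⟨1, fun m hm ↦ ?_⟩
      obtain ⟨k, rfl⟩ := Nat.exists_eq_add_of_le' hm
      rw [pow_succ, mul_assoc]
      exact mul_mem (pow_mem τ.2 _) hτx
    | algebraMap r => exact ⟨0, fun m _ ↦ mul_mem (pow_mem τ.2 _) r.2⟩
    | add u v _ _ hu hv =>
      obtain ⟨n, hn⟩ := hu
      obtain ⟨k, hk⟩ := hv
      refine ⟨max n k, fun m hm ↦ ?_⟩
      rw [mul_add]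
      exact add_mem (hn m (le_trans (le_max_left _ _) hm)) (hk m (le_trans (le_max_right _ _) hm))
    | mul u v _ _ hu hv =>
      obtain ⟨n, hn⟩ := hu
      obtain ⟨k, hk⟩ := hv
      refine ⟨n + k, fun m hm ↦ ?_⟩
      obtain ⟨l, rfl⟩ := Nat.exists_eq_add_of_le hm
      have : (τ : B) ^ (n + k + l) * (u * v) = (τ ^ n * u) * (τ ^ (k + l) * v) := by ring
      rw [this]
      exact mul_mem (hn _ le_rfl) (hk _ (Nat.le_add_right _ _))
  -- As x is integral, C[x] is a finite C-module, so one power of τ carries all of it into C.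
  obtain ⟨S, hS⟩ := (hint.isIntegral x).fg_adjoin_singleton
  have hSC : ∀ w ∈ S, w ∈ C' := fun w hw ↦ by
    have : w ∈ Submodule.span C (S : Set B) := Submodule.subset_span hw
    rwa [hS] at this
  have hN : ∃ N : ℕ, ∀ w ∈ S, (τ : B) ^ N * w ∈ C := by
    choose! n hn using fun w hw ↦ hpow w (hSC w hw)
    exact ⟨S.sup n, fun w hw ↦ hn w hw _ (Finset.le_sup hw)⟩
  obtain ⟨N, hN⟩ := hN
  have hτc : algebraMap C C' (τ ^ N) ∈ c := by
    rintro ⟨w, hw⟩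
    change ((τ ^ N : C) : B) * w ∈ C
    push_cast
    have hw' : w ∈ Submodule.span C (S : Set B) := by rw [hS]; exact hw
    induction hw' using Submodule.span_induction with
    | mem y hy => exact hN y hy
    | zero => simp
    | add u v hu hv hu' hv' =>
      rw [mul_add]
      rw [hS] at hu hv
      exact add_mem (hu' hu) (hv' hv)
    | smul r u hu hu' =>
      rw [hS] at hu
      rw [Algebra.smul_def, mul_left_comm]
      exact mul_mem r.2 (hu' hu)
  exact hτ (hpp.mem_of_pow_mem N (hp.1.2 hτc))

variable {A : Subalgebra ℚ B}

/-- The union of all towers is seminormal in B, since an element whose square and cube lie in it can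
be adjoined in one more step; hence it is B. -/
lemma IsSubintegral.exists_reach (hA : A.IsSubintegral) (x : B) : ∃ A', Reach A A' ∧ x ∈ A' :=
  hA.eq_top_of_seminormal A.le_reachClosure (fun _ ↦ mem_reachClosure_of_sq_of_cube) x

lemma IsSubintegral.isExpGood (hA : A.IsSubintegral) (b : B) : IsExpGood A b := by
  obtain ⟨A', h, hb⟩ := hA.exists_reach b
  exact h.isExpGood hb

lemma IsSubintegral.exists_isLog_unit (hA : A.IsSubintegral) (u : Bˣ) : ∃ b, IsLog A b u := by
  obtain ⟨A₁, h₁, hu₁⟩ := hA.exists_reach u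
  obtain ⟨A₂, h₂, hu₂⟩ := hA.exists_reach ↑u⁻¹
  obtain ⟨A', h, h1, h2⟩ := h₁.directed h₂
  exact h.exists_isLog hA.isExpGood (h1 hu₁) (h2 hu₂)

lemma IsLog.mem_unit {b : B} {u : Bˣ} (h : IsLog A b u) (hb : b ∈ A) :
    ↑u ∈ A ∧ ↑u⁻¹ ∈ A := by
  have h1 : ∀ b ∈ A, ExpMem A b 1 := fun b hb ↦
    (expMem_iff_of_mem hb).mpr (expMem_zero_iff.mp (by
      simp [ExpMem, expT_zero, one_mem]))
  have h2 := h.mem 1 (h1 b hb)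
  have h3 := h.mem_neg 1 (h1 _ (neg_mem hb))
  simp only [Polynomial.eval_one, mul_one] at h2 h3
  exact ⟨h3, h2⟩

lemma IsLog.mem_of_unit (hA : A.IsSubintegral) {b : B} {u : Bˣ} (h : IsLog A b u) (hu : ↑u ∈ A)
    (hu' : ↑u⁻¹ ∈ A) : b ∈ A := by
  obtain ⟨A', hr, hb⟩ := hA.exists_reach b
  exact hr.mem_of_isLog hA.isExpGood hu hu' h hb

end Subalgebra

/-- For the residue condition, the class of x in κ(P) is the image of a fraction a/s from the
residue field below; clearing the denominator gives sx - a ∈ P with s ∉ P. -/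
lemma RingHom.IsSubintegral.range {A B : Type u} [CommRing A] [CommRing B] [Algebra ℚ A]
    [Algebra ℚ B] {φ : A →+* B} (h : φ.IsSubintegral) :
    φ.toRatAlgHom.range.IsSubintegral where
  isIntegral := ⟨fun b ↦ by
    obtain ⟨p, hp, e⟩ := h.isIntegral b
    refine ⟨p.map φ.toRatAlgHom.rangeRestrict.toRingHom, hp.map _, ?_⟩
    rw [Polynomial.eval₂_map]
    exact e⟩
  inj P Q hP hQ hPQ := by
    have : PrimeSpectrum.comap φ ⟨P, hP⟩ = PrimeSpectrum.comap φ ⟨Q, hQ⟩ := by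
      ext a
      exact hPQ (φ a) ⟨a, rfl⟩
    exact congrArg PrimeSpectrum.asIdeal (h.bijective_comap.injective this)
  residue P hP x := by
    obtain ⟨y, hy⟩ := (h.bijective_residueField ⟨P, hP⟩).surjective
      (algebraMap B P.ResidueField x)
    obtain ⟨y, rfl⟩ := IsLocalRing.residue_surjective y
    obtain ⟨a, s, rfl⟩ := IsLocalization.exists_mk'_eq
      (PrimeSpectrum.comap φ ⟨P, hP⟩).asIdeal.primeCompl y
    refine ⟨φ s, ⟨s, rfl⟩, φ a, ⟨a, rfl⟩, s.2, ?_⟩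
    rw [← Ideal.algebraMap_residueField_eq_zero, map_sub, map_mul, ← hy,
      ← Ideal.ResidueField.map_algebraMap (PrimeSpectrum.comap φ ⟨P, hP⟩).asIdeal P φ rfl,
      ← Ideal.ResidueField.map_algebraMap (PrimeSpectrum.comap φ ⟨P, hP⟩).asIdeal P φ rfl,
      ← map_mul, ← map_sub]
    have : algebraMap A (PrimeSpectrum.comap φ ⟨P, hP⟩).asIdeal.ResidueField s *
        IsLocalRing.residue _ (IsLocalization.mk' (Localization.AtPrime
          (PrimeSpectrum.comap φ ⟨P, hP⟩).asIdeal) a s) =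
        algebraMap A (PrimeSpectrum.comap φ ⟨P, hP⟩).asIdeal.ResidueField a := by
      rw [IsScalarTower.algebraMap_apply A (Localization.AtPrime
          (PrimeSpectrum.comap φ ⟨P, hP⟩).asIdeal), IsScalarTower.algebraMap_apply A
          (Localization.AtPrime (PrimeSpectrum.comap φ ⟨P, hP⟩).asIdeal) _ a,
        IsLocalRing.ResidueField.algebraMap_eq, ← map_mul, IsLocalization.mk'_spec']
    rw [this, sub_self, map_zero]

/-! ### Sections of the quotient sheaf. -/

namespace AlgebraicGeometry.Scheme

noncomputable section

variable {X S : Scheme.{u}} (f : X ⟶ S)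

/-! ### Sections of `f_* 𝒪_X` and of the quotient sheaf -/

/-- The restriction maps of `f_* 𝒪_X`. -/
def Hom.res {U V : S.Opens} (h : V ≤ U) : Γ(X, f ⁻¹ᵁ U) →+* Γ(X, f ⁻¹ᵁ V) :=
  (X.presheaf.map (homOfLE (f.preimage_mono h)).op).hom

/-- The restriction maps of `𝒪_S`. -/
def res {U V : S.Opens} (h : V ≤ U) : Γ(S, U) →+* Γ(S, V) :=
  (S.presheaf.map (homOfLE h).op).hom

lemma Hom.res_res {U V W : S.Opens} (h : V ≤ U) (h' : W ≤ V) (b : Γ(X, f ⁻¹ᵁ U)) :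
    f.res h' (f.res h b) = f.res (h'.trans h) b := by
  simp only [Hom.res]
  rw [← CommRingCat.comp_apply, ← Functor.map_comp]
  rfl

lemma Hom.res_self {U : S.Opens} (b : Γ(X, f ⁻¹ᵁ U)) : f.res le_rfl b = b :=
  congrArg (fun φ ↦ φ.hom b) (X.presheaf.map_id _)

lemma Hom.res_app {U V : S.Opens} (h : V ≤ U) (a : Γ(S, U)) :
    f.res h ((f.app U).hom a) = (f.app V).hom (Scheme.res h a) :=
  (congrArg (fun φ ↦ φ.hom a) (f.naturality (homOfLE h).op)).symm

/-- The projection `f_* 𝒪_X → f_* 𝒪_X / 𝒪_S` on sections. -/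
def Hom.toQuotient (U : S.Opens) : Γ(X, f ⁻¹ᵁ U) →+ f.quotientSheaf.obj.obj (.op U) :=
  ((cokernel.π f.structureMap).hom.app (.op U)).hom

/-- The restriction maps of `f_* 𝒪_X / 𝒪_S`. -/
def Hom.quotientRes {U V : S.Opens} (h : V ≤ U) :
    f.quotientSheaf.obj.obj (.op U) →+ f.quotientSheaf.obj.obj (.op V) :=
  (f.quotientSheaf.obj.map (homOfLE h).op).hom

lemma Hom.quotientRes_res {U V W : S.Opens} (h : V ≤ U) (h' : W ≤ V)
    (s : f.quotientSheaf.obj.obj (.op U)) :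
    f.quotientRes h' (f.quotientRes h s) = f.quotientRes (h'.trans h) s := by
  simp only [Hom.quotientRes]
  rw [← AddCommGrpCat.comp_apply, ← Functor.map_comp]
  rfl

lemma Hom.quotientRes_self {U : S.Opens} (s : f.quotientSheaf.obj.obj (.op U)) :
    f.quotientRes le_rfl s = s :=
  congrArg (fun φ ↦ φ.hom s) (f.quotientSheaf.obj.map_id _)

lemma Hom.quotientRes_toQuotient {U V : S.Opens} (h : V ≤ U) (b : Γ(X, f ⁻¹ᵁ U)) :
    f.quotientRes h (f.toQuotient U b) = f.toQuotient V (f.res h b) :=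
  (congrArg (fun φ ↦ φ.hom b)
    ((cokernel.π f.structureMap).hom.naturality (homOfLE h).op)).symm

lemma Hom.quotient_eq_of_locally {U : S.Opens} {s t : f.quotientSheaf.obj.obj (.op U)}
    (h : ∀ x ∈ U, ∃ (V : S.Opens) (hV : V ≤ U), x ∈ V ∧
      f.quotientRes hV s = f.quotientRes hV t) : s = t := by
  choose V hV hx e using h
  refine f.quotientSheaf.eq_of_locally_eq' (fun x : U ↦ V x x.2) U
    (fun x ↦ homOfLE (hV x x.2)) (fun x hxU ↦ ?_) s t (fun x ↦ e x x.2)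
  exact Opens.mem_iSup.mpr ⟨⟨x, hxU⟩, hx _ _⟩

lemma Hom.exists_toQuotient {U : S.Opens} (s : f.quotientSheaf.obj.obj (.op U)) {x : S}
    (hx : x ∈ U) : ∃ (V : S.Opens) (hV : V ≤ U) (b : Γ(X, f ⁻¹ᵁ V)), x ∈ V ∧
      f.toQuotient V b = f.quotientRes hV s := by
  have h : TopCat.Presheaf.IsLocallySurjective (cokernel.π f.structureMap).hom :=
    (TopCat.Sheaf.isLocallySurjective_iff_epi _).mpr inferInstance
  rw [TopCat.Presheaf.isLocallySurjective_iff] at h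
  obtain ⟨V, hV, ⟨b, hb⟩, hxV⟩ := h U s x hx
  exact ⟨V, hV, b, hxV, hb⟩

lemma Hom.mono_structureMap (hf : ∀ U : S.Opens, Function.Injective (f.app U).hom) :
    Mono f.structureMap := by
  apply (sheafToPresheaf _ _).mono_of_mono_map
  have : ∀ U, Mono (((sheafToPresheaf _ _).map f.structureMap).app U) := fun U ↦
    ConcreteCategory.mono_of_injective _ (hf U.unop)
  exact NatTrans.mono_of_mono_app _

/-- Sections over U form a left exact functor, and a monomorphism of sheaves is the kernel of its
cokernel. -/
lemma Hom.toQuotient_eq_zero_iff (hf : ∀ U : S.Opens, Function.Injective (f.app U).hom)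
    {U : S.Opens} (b : Γ(X, f ⁻¹ᵁ U)) :
    f.toQuotient U b = 0 ↔ b ∈ (f.app U).hom.range := by
  let T : ShortComplex (TopCat.Sheaf Ab.{u} S) :=
    ⟨f.structureMap, cokernel.π f.structureMap, cokernel.condition _⟩
  let G₀ : TopCat.Sheaf Ab.{u} S ⥤ _ := sheafToPresheaf _ _
  let G : TopCat.Sheaf Ab.{u} S ⥤ Ab.{u} := G₀ ⋙ (CategoryTheory.evaluation _ _).obj (.op U)
  have : G.PreservesZeroMorphisms := ⟨fun _ _ ↦ rfl⟩
  have : PreservesLimits G₀ :=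
    (sheafificationAdjunction _ _).rightAdjoint_preservesLimits
  have : PreservesLimits G := comp_preservesLimits _ _
  have hT : T.Exact := ShortComplex.exact_cokernel _
  have hmono : Mono T.f := f.mono_structureMap hf
  have h2 : (T.map G).Exact := hT.map_of_mono_of_preservesKernel G hmono inferInstance
  rw [ShortComplex.ab_exact_iff_function_exact] at h2
  exact h2 b

end

end AlgebraicGeometry.Scheme

/-! ### The logarithm from units of f_* 𝒪_X to the quotient sheaf. -/

namespace AlgebraicGeometry.Scheme

noncomputable section

variable {X S : Scheme.{u}} (f : X ⟶ S)

/-- The restriction of a unit of `f_* 𝒪_X`. -/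
abbrev Hom.unitRes {U V : S.Opens} (h : V ≤ U) : Γ(X, f ⁻¹ᵁ U)ˣ →* Γ(X, f ⁻¹ᵁ V)ˣ :=
  Units.map (f.res h : Γ(X, f ⁻¹ᵁ U) →* Γ(X, f ⁻¹ᵁ V))

lemma Hom.unitRes_res {U V W : S.Opens} (h : V ≤ U) (h' : W ≤ V) (u : Γ(X, f ⁻¹ᵁ U)ˣ) :
    f.unitRes h' (f.unitRes h u) = f.unitRes (h'.trans h) u :=
  Units.ext (f.res_res h h' u)

lemma Hom.unitRes_self {U : S.Opens} (u : Γ(X, f ⁻¹ᵁ U)ˣ) : f.unitRes le_rfl u = u :=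
  Units.ext (f.res_self (u : Γ(X, f ⁻¹ᵁ U)))

lemma exists_isAffineOpen_mem_le {U : S.Opens} {x : S} (hx : x ∈ U) :
    ∃ V : S.Opens, IsAffineOpen V ∧ x ∈ V ∧ V ≤ U := by
  obtain ⟨_, ⟨V, hV, rfl⟩, hxV, hVU⟩ := (S.isBasis_affineOpens).exists_subset_of_mem_open hx U.2
  exact ⟨V, hV, hxV, hVU⟩

variable [∀ U : S.Opens, Algebra ℚ Γ(S, U)] [∀ U : X.Opens, Algebra ℚ Γ(X, U)]

/-- The image of `𝒪_S(U)` in `𝒪_X(f⁻¹ U)`. -/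
def Hom.subalgebra (U : S.Opens) : Subalgebra ℚ Γ(X, f ⁻¹ᵁ U) := (f.app U).hom.toRatAlgHom.range

variable {f}

lemma Hom.res_mem_subalgebra {U V : S.Opens} (h : V ≤ U) (b : Γ(X, f ⁻¹ᵁ U))
    (hb : b ∈ f.subalgebra U) : f.res h b ∈ f.subalgebra V := by
  obtain ⟨a, rfl⟩ := hb
  exact ⟨_, (f.res_app h a).symm⟩

lemma Hom.IsSubintegral.subalgebra (hf : f.IsSubintegral) {U : S.Opens} (hU : IsAffineOpen U) :
    (f.subalgebra U).IsSubintegral :=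
  (hf.isSubintegral U hU).range

/-- The section `s` of `f_* 𝒪_X / 𝒪_S` is the logarithm of the unit `u` of `f_* 𝒪_X`. -/
def Hom.IsLogSection {U : S.Opens} (u : Γ(X, f ⁻¹ᵁ U)ˣ)
    (s : f.quotientSheaf.obj.obj (.op U)) : Prop :=
  ∀ (V : S.Opens) (hV : V ≤ U) (b : Γ(X, f ⁻¹ᵁ V)), IsAffineOpen V →
    (f.subalgebra V).IsLog b (f.unitRes hV u) → f.quotientRes hV s = f.toQuotient V b

lemma Hom.IsSubintegral.isLog_res (hf : f.IsSubintegral) {U V : S.Opens} (hU : IsAffineOpen U)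
    (h : V ≤ U) {b : Γ(X, f ⁻¹ᵁ U)} {u : Γ(X, f ⁻¹ᵁ U)ˣ} (hb : (f.subalgebra U).IsLog b u) :
    (f.subalgebra V).IsLog (f.res h b) (f.unitRes h u) :=
  hb.map (f.res h) (Hom.res_mem_subalgebra h) ((hf.subalgebra hU).isExpGood b)

/-- The difference of two logarithms of u is a logarithm of 1, hence lies in 𝒪_S(U). -/
lemma Hom.IsSubintegral.toQuotient_eq (hf : f.IsSubintegral) {U : S.Opens} (hU : IsAffineOpen U)
    {b b' : Γ(X, f ⁻¹ᵁ U)} {u : Γ(X, f ⁻¹ᵁ U)ˣ} (hb : (f.subalgebra U).IsLog b u)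
    (hb' : (f.subalgebra U).IsLog b' u) : f.toQuotient U b = f.toQuotient U b' := by
  have hg := (hf.subalgebra hU).isExpGood
  have := hb.add (hg _) (hg _) hb'.neg
  rw [mul_inv_cancel, ← sub_eq_add_neg] at this
  rw [← sub_eq_zero, ← map_sub, f.toQuotient_eq_zero_iff hf.injective]
  exact this.mem_of_unit (hf.subalgebra hU) (by simp [one_mem]) (by simp [one_mem])

/-- Logarithms exist on every affine open and are compatible with restriction modulo 𝒪_S, so their
classes glue. -/
lemma Hom.IsSubintegral.existsUnique_isLogSection (hf : f.IsSubintegral) {U : S.Opens}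
    (u : Γ(X, f ⁻¹ᵁ U)ˣ) : ∃! s, f.IsLogSection u s := by
  let ι := {V : S.Opens // V ≤ U ∧ IsAffineOpen V}
  have hcov : ∀ x ∈ U, ∃ i : ι, x ∈ i.1 := fun x hx ↦ by
    obtain ⟨V, hV, hxV, hVU⟩ := exists_isAffineOpen_mem_le hx
    exact ⟨⟨V, hVU, hV⟩, hxV⟩
  choose b hb using fun i : ι ↦ (hf.subalgebra i.2.2).exists_isLog_unit (f.unitRes i.2.1 u)
  have hcompat : TopCat.Presheaf.IsCompatible f.quotientSheaf.obj (fun i : ι ↦ i.1)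
      (fun i ↦ f.toQuotient i.1 (b i)) := by
    intro i j
    change f.quotientRes inf_le_left _ = f.quotientRes inf_le_right _
    refine f.quotient_eq_of_locally fun x hx ↦ ?_
    obtain ⟨V, hV, hxV, hVU⟩ := exists_isAffineOpen_mem_le hx
    refine ⟨V, hVU, hxV, ?_⟩
    rw [f.quotientRes_res, f.quotientRes_res, f.quotientRes_toQuotient, f.quotientRes_toQuotient]
    have h1 := hf.isLog_res i.2.2 (hVU.trans inf_le_left) (hb i)
    have h2 := hf.isLog_res j.2.2 (hVU.trans inf_le_right) (hb j)
    rw [f.unitRes_res] at h1 h2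
    exact hf.toQuotient_eq hV h1 h2
  obtain ⟨s, hs, -⟩ := f.quotientSheaf.existsUnique_gluing' (fun i : ι ↦ i.1) U
    (fun i ↦ homOfLE i.2.1) (fun x hx ↦ Opens.mem_iSup.mpr (hcov x hx)) _ hcompat
  refine ⟨s, fun V hV b' hVa hb' ↦ ?_, fun t ht ↦ ?_⟩
  · exact (hs ⟨V, hV, hVa⟩).trans (hf.toQuotient_eq hVa (hb ⟨V, hV, hVa⟩) hb')
  · refine f.quotient_eq_of_locally fun x hx ↦ ?_
    obtain ⟨i, hi⟩ := hcov x hx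
    exact ⟨i.1, i.2.1, hi, (ht i.1 i.2.1 (b i) i.2.2 (hb i)).trans (hs i).symm⟩

/-- The logarithm of a unit of `f_* 𝒪_X` as a section of `f_* 𝒪_X / 𝒪_S`. -/
def Hom.IsSubintegral.log (hf : f.IsSubintegral) {U : S.Opens} (u : Γ(X, f ⁻¹ᵁ U)ˣ) :
    f.quotientSheaf.obj.obj (.op U) :=
  (hf.existsUnique_isLogSection u).choose

lemma Hom.IsSubintegral.isLogSection_log (hf : f.IsSubintegral) {U : S.Opens}
    (u : Γ(X, f ⁻¹ᵁ U)ˣ) : f.IsLogSection u (hf.log u) :=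
  (hf.existsUnique_isLogSection u).choose_spec.1

lemma Hom.IsSubintegral.log_eq (hf : f.IsSubintegral) {U : S.Opens} (hU : IsAffineOpen U)
    {u : Γ(X, f ⁻¹ᵁ U)ˣ} {b : Γ(X, f ⁻¹ᵁ U)} (hb : (f.subalgebra U).IsLog b u) :
    hf.log u = f.toQuotient U b := by
  have := hf.isLogSection_log u U le_rfl b hU
  rw [f.quotientRes_self] at this
  refine this ?_
  convert hb
  exact f.unitRes_self u

lemma Hom.IsSubintegral.log_res (hf : f.IsSubintegral) {U V : S.Opens} (h : V ≤ U)
    (u : Γ(X, f ⁻¹ᵁ U)ˣ) : f.quotientRes h (hf.log u) = hf.log (f.unitRes h u) := by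
  refine (hf.existsUnique_isLogSection (f.unitRes h u)).unique (fun W hW b hWa hb ↦ ?_)
    (hf.isLogSection_log _)
  rw [f.unitRes_res] at hb
  rw [f.quotientRes_res]
  exact hf.isLogSection_log u W _ b hWa hb

lemma Hom.IsSubintegral.log_mul (hf : f.IsSubintegral) {U : S.Opens}
    (u v : Γ(X, f ⁻¹ᵁ U)ˣ) : hf.log (u * v) = hf.log u + hf.log v := by
  refine f.quotient_eq_of_locally fun x hx ↦ ?_
  obtain ⟨V, hV, hxV, hVU⟩ := exists_isAffineOpen_mem_le hx
  refine ⟨V, hVU, hxV, ?_⟩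
  rw [map_add, hf.log_res, hf.log_res, hf.log_res, map_mul]
  have hA := hf.subalgebra hV
  obtain ⟨b, hb⟩ := hA.exists_isLog_unit (f.unitRes hVU u)
  obtain ⟨c, hc⟩ := hA.exists_isLog_unit (f.unitRes hVU v)
  rw [hf.log_eq hV hb, hf.log_eq hV hc,
    hf.log_eq hV (hb.add (hA.isExpGood _) (hA.isExpGood _) hc), map_add]

/-- The kernel of the logarithm consists of the units of `𝒪_S`. -/
lemma Hom.IsSubintegral.log_eq_zero_iff (hf : f.IsSubintegral) {U : S.Opens} (hU : IsAffineOpen U)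
    (u : Γ(X, f ⁻¹ᵁ U)ˣ) : hf.log u = 0 ↔ ∃ a : Γ(S, U)ˣ, (f.app U).hom a = u := by
  have hA := hf.subalgebra hU
  obtain ⟨b, hb⟩ := hA.exists_isLog_unit u
  rw [hf.log_eq hU hb, f.toQuotient_eq_zero_iff hf.injective]
  constructor
  · intro h
    obtain ⟨⟨a, ha⟩, ⟨a', ha'⟩⟩ := hb.mem_unit h
    have ha1 : (f.app U).hom a = u := ha
    have ha2 : (f.app U).hom a' = ↑u⁻¹ := ha'
    have h1 : a * a' = 1 := hf.injective U (by rw [map_mul, ha1, ha2, map_one, u.mul_inv])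
    exact ⟨⟨a, a', h1, by rwa [mul_comm]⟩, ha⟩
  · rintro ⟨a, ha⟩
    refine hb.mem_of_unit hA ⟨a, ha⟩ ⟨↑a⁻¹, ?_⟩
    change (f.app U).hom ↑a⁻¹ = ↑u⁻¹
    rw [← Units.mul_right_inj u, Units.mul_inv, ← ha, ← map_mul, Units.mul_inv, map_one]

/-- The logarithm is locally surjective. -/
lemma Hom.IsSubintegral.exists_log (hf : f.IsSubintegral) {U : S.Opens}
    (s : f.quotientSheaf.obj.obj (.op U)) {x : S} (hx : x ∈ U) :
    ∃ (V : S.Opens) (hV : V ≤ U) (u : Γ(X, f ⁻¹ᵁ V)ˣ), IsAffineOpen V ∧ x ∈ V ∧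
      hf.log u = f.quotientRes hV s := by
  obtain ⟨V₀, hV₀, b₀, hxV₀, hb₀⟩ := f.exists_toQuotient s hx
  obtain ⟨V, hV, hxV, hVV₀⟩ := exists_isAffineOpen_mem_le hxV₀
  set b := f.res hVV₀ b₀ with hb
  obtain ⟨ι, _, p, n, hpn, h1, H⟩ := ((hf.subalgebra hV).isExpGood b).exists_isLog
  choose c hc using hpn
  have hc' : ∀ i, (f.app V).hom (c i) = p i * n i := hc
  have hc1 : ∑ i, c i = 1 := hf.injective V (by rw [map_sum, map_one, ← h1]; simp only [hc'])
  -- The cᵢ sum to 1 and the stalk at x is local, so some cᵢ is invertible near x.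
  obtain ⟨i, hi⟩ : ∃ i, x ∈ S.basicOpen (c i) := by
    by_contra! hcon
    have hx1 : x ∈ S.basicOpen (1 : Γ(S, V)) := by rwa [S.basicOpen_of_isUnit isUnit_one]
    rw [S.mem_basicOpen _ _ hxV] at hx1
    have hnon : ∀ i, S.presheaf.germ V x hxV (c i) ∈
        IsLocalRing.maximalIdeal (S.presheaf.stalk x) := fun i ↦ by
      have := hcon i
      rwa [S.mem_basicOpen _ _ hxV] at this
    have : S.presheaf.germ V x hxV (∑ i, c i) ∈ IsLocalRing.maximalIdeal (S.presheaf.stalk x) := by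
      rw [map_sum]
      exact sum_mem fun i _ ↦ hnon i
    rw [hc1] at this
    exact this hx1
  set W := S.basicOpen (c i) with hW
  have hWV : W ≤ V := S.basicOpen_le _
  have hWa : IsAffineOpen W := hV.basicOpen _
  have hunit : IsUnit (Scheme.res hWV (c i)) := RingedSpace.isUnit_res_basicOpen _ _
  obtain ⟨v, hv⟩ := hunit
  obtain ⟨u, hu⟩ := H _ (f.subalgebra W) (f.res hWV) (Hom.res_mem_subalgebra hWV) i
    ((f.app W).hom ↑v⁻¹) ⟨_, rfl⟩ (by
      rw [← hc', f.res_app, ← map_mul, ← hv, Units.mul_inv, map_one])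
  refine ⟨W, hWV.trans (hVV₀.trans hV₀), u, hWa, hi, ?_⟩
  rw [hf.log_eq hWa hu, hb, f.res_res, ← f.quotientRes_toQuotient (hWV.trans hVV₀), hb₀,
    f.quotientRes_res]

end

end AlgebraicGeometry.Scheme

/-! ### Frames of sheaves of modules and their universal property. -/

namespace AlgebraicGeometry.Scheme.Modules

noncomputable section

variable {X S : Scheme.{u}}

/-! ### Sections of sheaves of modules -/

/-- The restriction maps of a sheaf of modules. -/
def res (M : X.Modules) {U V : X.Opens} (h : V ≤ U) : Γ(M, U) →+ Γ(M, V) :=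
  (M.presheaf.map (homOfLE h).op).hom

lemma res_res (M : X.Modules) {U V W : X.Opens} (h : V ≤ U) (h' : W ≤ V) (s : Γ(M, U)) :
    M.res h' (M.res h s) = M.res (h'.trans h) s := by
  simp only [res]
  rw [← AddCommGrpCat.comp_apply, ← Functor.map_comp]
  rfl

lemma res_self (M : X.Modules) {U : X.Opens} (s : Γ(M, U)) : M.res le_rfl s = s :=
  congrArg (fun φ ↦ φ.hom s) (M.presheaf.map_id _)

lemma res_smul (M : X.Modules) {U V : X.Opens} (h : V ≤ U) (a : Γ(X, U)) (s : Γ(M, U)) :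
    M.res h (a • s) = Scheme.res h a • M.res h s :=
  M.map_smul (homOfLE h) a s

lemma app_res {M N : X.Modules} (φ : M ⟶ N) {U V : X.Opens} (h : V ≤ U) (s : Γ(M, U)) :
    φ.app V (M.res h s) = N.res h (φ.app U s) :=
  ConcreteCategory.congr_hom (φ.mapPresheaf.naturality (homOfLE h).op) s

lemma app_smul {M N : X.Modules} (φ : M ⟶ N) {U : X.Opens} (a : Γ(X, U)) (s : Γ(M, U)) :
    φ.app U (a • s) = a • φ.app U s := Hom.app_smul φ a s

lemma res_pullbackSection (f : X ⟶ S) {M : S.Modules} {U V : S.Opens} (h : V ≤ U)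
    (s : Γ(M, U)) : ((pullback f).obj M).res (f.preimage_mono h) (pullbackSection f s) =
      pullbackSection f (M.res h s) :=
  map_pullbackSection f (homOfLE h) s

lemma res_tmul {M N : X.Modules} {U V : X.Opens} (h : V ≤ U) (s : Γ(M, U)) (t : Γ(N, U)) :
    (tensorObj M N).res h (tmul s t) = tmul (M.res h s) (N.res h t) :=
  map_tmul (homOfLE h) s t

lemma eq_of_locally (M : X.Modules) {U : X.Opens} {s t : Γ(M, U)}
    (h : ∀ x ∈ U, ∃ (V : X.Opens) (hV : V ≤ U), x ∈ V ∧ M.res hV s = M.res hV t) : s = t := by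
  choose V hV hx e using h
  refine TopCat.Sheaf.eq_of_locally_eq' ⟨M.presheaf, M.isSheaf⟩ (fun x : U ↦ V x x.2) U
    (fun x ↦ homOfLE (hV x x.2)) (fun x hxU ↦ ?_) s t (fun x ↦ e x x.2)
  exact Opens.mem_iSup.mpr ⟨⟨x, hxU⟩, hx _ _⟩

/-- Construction of a morphism of sheaves of modules from its maps on sections. -/
def homMk {M N : X.Modules} (φ : ∀ U, Γ(M, U) →ₗ[Γ(X, U)] Γ(N, U))
    (hφ : ∀ (U V : X.Opens) (h : V ≤ U) (s : Γ(M, U)), N.res h (φ U s) = φ V (M.res h s)) :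
    M ⟶ N :=
  SheafOfModules.Hom.mk
    { app := fun U ↦ ModuleCat.ofHom (R := X.ringCatSheaf.obj.obj U) (X := M.val.obj U)
        (Y := N.val.obj U) (φ U.unop)
      naturality := fun {U V} i ↦ by
        ext s
        exact (hφ U.unop V.unop i.unop.le s).symm }

lemma hom_ext_apply {M N : X.Modules} {φ ψ : M ⟶ N}
    (h : ∀ (U : X.Opens) (s : Γ(M, U)), φ.app U s = ψ.app U s) : φ = ψ :=
  hom_ext _ _ fun U ↦ by
    ext s
    exact h U s

lemma tensor_hom_ext {M N P : X.Modules} {φ ψ : tensorObj M N ⟶ P}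
    (h : ∀ (U : X.Opens) (s : Γ(M, U)) (t : Γ(N, U)), φ.app U (tmul s t) = ψ.app U (tmul s t)) :
    φ = ψ := by
  apply (PresheafOfModules.sheafificationHomEquiv (𝟙 X.ringCatSheaf.obj)
    (P := presheafTensorObj M N) (F := P)).injective
  ext1 U
  exact ModuleCat.MonoidalCategory.tensor_ext fun s t ↦ h U.unop s t

/-! ### Frames -/

/-- A section `e` of `M` over `U` that freely generates `M` over `U`. -/
def IsFrame {M : X.Modules} {U : X.Opens} (e : Γ(M, U)) : Prop :=
  ∀ (V : X.Opens) (h : V ≤ U), Function.Bijective fun a : Γ(X, V) ↦ a • M.res h e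

namespace IsFrame

variable {M N : X.Modules} {U : X.Opens} {e : Γ(M, U)}

lemma res (he : IsFrame e) {V : X.Opens} (h : V ≤ U) : IsFrame (M.res h e) := fun W hW ↦ by
  simp only [res_res]
  exact he W (hW.trans h)

lemma exists_eq (he : IsFrame e) (s : Γ(M, U)) : ∃ a : Γ(X, U), s = a • e := by
  obtain ⟨a, ha⟩ := (he U le_rfl).surjective s
  exact ⟨a, by rw [← ha, res_self]⟩

lemma injective (he : IsFrame e) {a b : Γ(X, U)} (h : a • e = b • e) : a = b :=
  (he U le_rfl).injective (by simpa only [res_self] using h)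

/-- The coordinate over `V ⊓ U` of a section over `V` with respect to a frame over `U`. -/
def coord (he : IsFrame e) {V : X.Opens} (s : Γ(M, V)) : Γ(X, V ⊓ U) :=
  ((he (V ⊓ U) inf_le_right).surjective (M.res inf_le_left s)).choose

lemma coord_smul (he : IsFrame e) {V : X.Opens} (s : Γ(M, V)) :
    he.coord s • M.res inf_le_right e = M.res inf_le_left s :=
  ((he (V ⊓ U) inf_le_right).surjective (M.res inf_le_left s)).choose_spec

lemma coord_eq (he : IsFrame e) {V : X.Opens} {s : Γ(M, V)} {a : Γ(X, V ⊓ U)}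
    (h : a • M.res inf_le_right e = M.res inf_le_left s) : he.coord s = a :=
  (he (V ⊓ U) inf_le_right).injective ((he.coord_smul s).trans h.symm)

lemma coord_add (he : IsFrame e) {V : X.Opens} (s t : Γ(M, V)) :
    he.coord (s + t) = he.coord s + he.coord t :=
  he.coord_eq (by rw [add_smul, coord_smul, coord_smul, map_add])

lemma coord_smul' (he : IsFrame e) {V : X.Opens} (a : Γ(X, V)) (s : Γ(M, V)) :
    he.coord (a • s) = Scheme.res inf_le_left a * he.coord s :=
  he.coord_eq (by rw [mul_smul, coord_smul, res_smul])

lemma coord_res (he : IsFrame e) {V W : X.Opens} (h : W ≤ V) (s : Γ(M, V)) :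
    he.coord (M.res h s) = Scheme.res (inf_le_inf_right U h) (he.coord s) := by
  refine he.coord_eq ?_
  have := congrArg (M.res (inf_le_inf_right U h)) (he.coord_smul s)
  rwa [res_smul, res_res, res_res, ← res_res _ h inf_le_left] at this

lemma coord_self (he : IsFrame e) : he.coord e = 1 := he.coord_eq (by rw [one_smul])

end IsFrame

/-- The sections of `N` only depend on their restriction to `U`. -/
def IsLocalOn (N : X.Modules) (U : X.Opens) : Prop :=
  ∀ V : X.Opens, Function.Bijective (N.res (inf_le_left : V ⊓ U ≤ V))

namespace IsLocalOn

variable {N : X.Modules} {U : X.Opens}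

/-- The map `a ↦ a • n`, from `𝒪(V ⊓ U)` to `N(V)`, for a section `n` of `N` over `U`. -/
def extend (hN : N.IsLocalOn U) (n : Γ(N, U)) {V : X.Opens} (a : Γ(X, V ⊓ U)) : Γ(N, V) :=
  ((hN V).surjective (a • N.res inf_le_right n)).choose

lemma res_extend (hN : N.IsLocalOn U) (n : Γ(N, U)) {V : X.Opens} (a : Γ(X, V ⊓ U)) :
    N.res inf_le_left (hN.extend n a) = a • N.res inf_le_right n :=
  ((hN V).surjective (a • N.res inf_le_right n)).choose_spec

lemma ext (hN : N.IsLocalOn U) {V : X.Opens} {s t : Γ(N, V)}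
    (h : N.res (inf_le_left : V ⊓ U ≤ V) s = N.res inf_le_left t) : s = t := (hN V).injective h

lemma extend_add (hN : N.IsLocalOn U) (n : Γ(N, U)) {V : X.Opens} (a b : Γ(X, V ⊓ U)) :
    hN.extend n (a + b) = hN.extend n a + hN.extend n b :=
  hN.ext (by rw [map_add, res_extend, res_extend, res_extend, add_smul])

lemma extend_mul (hN : N.IsLocalOn U) (n : Γ(N, U)) {V : X.Opens} (a : Γ(X, V))
    (b : Γ(X, V ⊓ U)) : hN.extend n (Scheme.res inf_le_left a * b) = a • hN.extend n b :=
  hN.ext (by rw [res_smul, res_extend, res_extend, mul_smul])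

lemma extend_res (hN : N.IsLocalOn U) (n : Γ(N, U)) {V W : X.Opens} (h : W ≤ V)
    (a : Γ(X, V ⊓ U)) :
    hN.extend n (Scheme.res (inf_le_inf_right U h) a) = N.res h (hN.extend n a) := by
  refine hN.ext ?_
  rw [res_extend, res_res, ← res_res N inf_le_left (inf_le_inf_right U h), res_extend, res_smul,
    res_res]

lemma extend_one (hN : N.IsLocalOn U) (n : Γ(N, U)) : hN.extend n 1 = n :=
  hN.ext (by rw [res_extend, one_smul])

lemma pushforward (f : X ⟶ S) {N : X.Modules} {U : S.Opens} (hN : N.IsLocalOn (f ⁻¹ᵁ U)) :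
    ((pushforward f).obj N).IsLocalOn U := fun V ↦ hN (f ⁻¹ᵁ V)

end IsLocalOn

/-- Morphisms from `M` to sheaves of modules that are local on `U` correspond to sections over
`U` through evaluation at `e`. -/
def IsUniversal {M : X.Modules} {U : X.Opens} (e : Γ(M, U)) : Prop :=
  ∀ N : X.Modules, N.IsLocalOn U → Function.Bijective fun φ : M ⟶ N ↦ φ.app U e

/-- A morphism into N is determined over V ⊓ U by the image of e; locality of N on U extends the
values uniquely to V. -/
lemma IsFrame.isUniversal {M : X.Modules} {U : X.Opens} {e : Γ(M, U)} (he : IsFrame e) :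
    IsUniversal e := by
  refine fun N hN ↦ ⟨fun φ ψ h ↦ hom_ext_apply fun V s ↦ hN.ext ?_, fun n ↦ ?_⟩
  · have h : φ.app U e = ψ.app U e := h
    rw [← app_res, ← app_res, ← he.coord_smul, app_smul, app_smul, app_res, app_res, h]
  · refine ⟨homMk (fun V ↦
      { toFun := fun s ↦ hN.extend n (he.coord s)
        map_add' := fun s t ↦ by rw [he.coord_add, hN.extend_add]
        map_smul' := fun a s ↦ by rw [he.coord_smul', hN.extend_mul, RingHom.id_apply] })
      (fun U V h s ↦ ?_), ?_⟩
    · exact ((congrArg _ (he.coord_res h s)).trans (hN.extend_res n h _)).symm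
    · exact (congrArg _ he.coord_self).trans (hN.extend_one n)

/-- By adjunction, morphisms from the pullback to N are morphisms to its pushforward, which is local
on U when N is local on the preimage. -/
lemma IsUniversal.pullbackSection (f : X ⟶ S) {M : S.Modules} {U : S.Opens} {e : Γ(M, U)}
    (he : IsUniversal e) : IsUniversal (pullbackSection f e) := by
  intro N hN
  have h := (he _ (hN.pushforward f)).comp
    ((pullbackPushforwardAdjunction f).homEquiv M N).bijective
  have key : (fun φ : (pullback f).obj M ⟶ N ↦ φ.app (f ⁻¹ᵁ U) (Modules.pullbackSection f e)) =
      (fun φ : M ⟶ (Modules.pushforward f).obj N ↦ φ.app U e) ∘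
        (pullbackPushforwardAdjunction f).homEquiv M N := by
    funext φ
    simp only [Function.comp_apply, Adjunction.homEquiv_unit]
    rfl
  rw [key]
  exact h

lemma IsFrame.isUniversal_tmul {M M' : X.Modules} {U : X.Opens} {e : Γ(M, U)} {e' : Γ(M', U)}
    (he : IsFrame e) (he' : IsFrame e') : IsUniversal (tmul e e') := by
  refine fun N hN ↦ ⟨fun φ ψ h ↦ tensor_hom_ext fun V s t ↦ hN.ext ?_, fun n ↦ ?_⟩
  · have h : φ.app U (tmul e e') = ψ.app U (tmul e e') := h
    rw [← app_res, ← app_res, res_tmul, ← he.coord_smul, ← he'.coord_smul, smul_tmul, tmul_smul,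
      ← res_tmul]
    simp only [app_smul, app_res, h]
  · refine ⟨tensorLift (fun V ↦ LinearMap.mk₂ _
      (fun s t ↦ hN.extend n (he.coord s * he'.coord t))
      (fun s s' t ↦ by rw [he.coord_add, add_mul, hN.extend_add])
      (fun a s t ↦ by rw [he.coord_smul', mul_assoc, hN.extend_mul])
      (fun s t t' ↦ by rw [he'.coord_add, mul_add, hN.extend_add])
      (fun a s t ↦ by rw [he'.coord_smul', mul_left_comm, hN.extend_mul]))
      (fun V W i s t ↦ ?_), ?_⟩
    · change N.res i.le (hN.extend n _) = hN.extend n (he.coord (M.res i.le s) *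
        he'.coord (M'.res i.le t))
      rw [he.coord_res, he'.coord_res, ← map_mul, hN.extend_res]
    · refine (tensorLift_tmul _ _ e e').trans ?_
      change hN.extend n (he.coord e * he'.coord e') = n
      rw [he.coord_self, he'.coord_self, mul_one, hN.extend_one]

/-! ### Local sections -/

/-- The sheaf of modules `V ↦ M(V ⊓ U)`. -/
def localize (M : X.Modules) (U : X.Opens) : X.Modules :=
  (Modules.pushforward U.ι).obj (M.restrict U.ι)

lemma image_preimage_eq_of_le {U V : X.Opens} (h : V ≤ U) : U.ι ''ᵁ U.ι ⁻¹ᵁ V = V := by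
  rw [Hom.image_preimage_eq_opensRange_inf, Opens.opensRange_ι, inf_eq_right.mpr h]

lemma bijective_res_of_eq (M : X.Modules) {U V : X.Opens} (h : V = U) :
    Function.Bijective (M.res h.le) := by
  subst h
  exact ⟨fun s t h ↦ by simpa [res_self] using h, fun s ↦ ⟨s, M.res_self s⟩⟩

lemma isLocalOn_localize (M : X.Modules) (U : X.Opens) : (M.localize U).IsLocalOn U := by
  intro V
  have h : U.ι ''ᵁ U.ι ⁻¹ᵁ (V ⊓ U) = U.ι ''ᵁ U.ι ⁻¹ᵁ V := by
    simp only [Hom.image_preimage_eq_opensRange_inf, Opens.opensRange_ι, inf_comm V U, ← inf_assoc,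
      inf_idem]
  exact M.bijective_res_of_eq h

/-- The structure sheaf, as a sheaf of modules. -/
abbrev structureSheaf (X : Scheme.{u}) : X.Modules := SheafOfModules.unit X.ringCatSheaf

/-- The section `1` of the structure sheaf. -/
def one (U : X.Opens) : Γ(structureSheaf X, U) := (1 : Γ(X, U))

lemma isFrame_one (U : X.Opens) : IsFrame (one U) := by
  intro V h
  have : ∀ a : Γ(X, V), a • (structureSheaf X).res h (one U) = a := fun a ↦ by
    change a * Scheme.res h (1 : Γ(X, U)) = a
    rw [map_one, mul_one]
  exact ⟨fun a b hab ↦ (this a).symm.trans (hab.trans (this b)), fun a ↦ ⟨a, this a⟩⟩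

lemma image_preimage_le (U V : X.Opens) : U.ι ''ᵁ U.ι ⁻¹ᵁ V ≤ U := by
  rw [Hom.image_preimage_eq_opensRange_inf, Opens.opensRange_ι]
  exact inf_le_left

/-- The sections of the localization. -/
def localizeEquiv (M : X.Modules) (U V : X.Opens) :
    Γ(M.localize U, V) ≃+ Γ(M, U.ι ''ᵁ U.ι ⁻¹ᵁ V) := AddEquiv.refl _

lemma localizeEquiv_smul (M : X.Modules) {U V : X.Opens} (a : Γ(X, V)) (s : Γ(M.localize U, V)) :
    M.localizeEquiv U V (a • s) =
      Scheme.res (U.ι.image_preimage_le V) a • M.localizeEquiv U V s := by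
  have h1 : M.localizeEquiv U V (a • s) =
    (U.ι.appIso _).inv (U.ι.app V a) • M.localizeEquiv U V s := rfl
  rw [h1]
  congr 1
  rw [Opens.ι_appIso, Opens.ι_app]
  rfl

lemma localizeEquiv_res (M : X.Modules) {U V W : X.Opens} (h : W ≤ V) (s : Γ(M.localize U, V)) :
    M.localizeEquiv U W ((M.localize U).res h s) =
      M.res (U.ι.image_mono (U.ι.preimage_mono h)) (M.localizeEquiv U V s) := rfl

lemma localizeEquiv_symm_res (M : X.Modules) {U V W : X.Opens} (h : W ≤ V)
    (s : Γ(M, U.ι ''ᵁ U.ι ⁻¹ᵁ V)) :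
    (M.localize U).res h ((M.localizeEquiv U V).symm s) =
      (M.localizeEquiv U W).symm (M.res (U.ι.image_mono (U.ι.preimage_mono h)) s) := rfl

/-- The restriction morphism from `M` to its localization. -/
def toLocalize (M : X.Modules) (U : X.Opens) : M ⟶ M.localize U :=
  homMk (fun V ↦
    { toFun := fun s ↦ (M.localizeEquiv U V).symm (M.res (U.ι.image_preimage_le V) s)
      map_add' := fun s t ↦ by rw [map_add, map_add]
      map_smul' := fun a s ↦ (M.localizeEquiv U V).injective (by
        rw [RingHom.id_apply, localizeEquiv_smul, AddEquiv.apply_symm_apply,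
          AddEquiv.apply_symm_apply, res_smul]) })
    (fun V W h s ↦ by
      refine (localizeEquiv_symm_res _ _ _).trans (congrArg (M.localizeEquiv U W).symm ?_)
      exact (M.res_res _ _ _).trans (M.res_res _ _ _).symm)

/-- The multiplication of a section over `U` with functions. -/
def localizeSMul {M : X.Modules} {U : X.Opens} (e : Γ(M, U)) :
    localize (structureSheaf X) U ⟶ M.localize U :=
  homMk (fun V ↦
    { toFun := fun a ↦ (M.localizeEquiv U V).symm
        ((show Γ(X, U.ι ''ᵁ U.ι ⁻¹ᵁ V) from localizeEquiv (structureSheaf X) U V a) •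
          M.res (image_preimage_le U V) e)
      map_add' := fun a b ↦ by
        rw [← map_add, ← add_smul]
        rfl
      map_smul' := fun a b ↦ (M.localizeEquiv U V).injective (by
        rw [RingHom.id_apply, localizeEquiv_smul, localizeEquiv_smul, AddEquiv.apply_symm_apply,
          AddEquiv.apply_symm_apply]
        exact mul_smul _ _ _) })
    (fun V W h s ↦ by
      refine (localizeEquiv_symm_res _ _ _).trans (congrArg (M.localizeEquiv U W).symm ?_)
      refine (M.res_smul _ _ _).trans ?_
      rw [res_res]
      rfl)

/-- Universality gives a coordinate morphism φ with φ(e) = 1 into the localized structure sheaf.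
Multiplication by e after φ agrees with restriction on e, hence everywhere; this gives spanning, and
φ itself gives independence. -/
lemma IsUniversal.isFrame {M : X.Modules} {U : X.Opens} {e : Γ(M, U)} (he : IsUniversal e) :
    IsFrame e := by
  have hone : ∀ V : X.Opens, ∀ a : Γ(X, V), a • one V = (show Γ(structureSheaf X, V) from a) :=
    fun V a ↦ mul_one a
  obtain ⟨φ, hφ⟩ := (he _ (isLocalOn_localize (structureSheaf X) U)).surjective
    ((localizeEquiv (structureSheaf X) U U).symm (one (U.ι ''ᵁ U.ι ⁻¹ᵁ U)))
  have hφ : φ.app U e = (localizeEquiv (structureSheaf X) U U).symm (one _) := hφ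
  have hψ : φ ≫ localizeSMul e = toLocalize M U := by
    refine (he _ (isLocalOn_localize M U)).injective ?_
    refine (congrArg ((localizeSMul e).app U) hφ).trans ?_
    refine congrArg (M.localizeEquiv U U).symm ?_
    exact one_smul Γ(X, U.ι ''ᵁ U.ι ⁻¹ᵁ U) _
  have hs : ∀ (V : X.Opens) (s : Γ(M, V)), ∃ a : Γ(X, U.ι ''ᵁ U.ι ⁻¹ᵁ V),
      M.res (U.ι.image_preimage_le V) s = a • M.res (image_preimage_le U V) e := fun V s ↦
    ⟨localizeEquiv (structureSheaf X) U V (φ.app V s), (M.localizeEquiv U V).symm.injective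
      (congrArg (fun ψ ↦ Hom.app ψ V s) hψ).symm⟩
  intro V h
  have hV := image_preimage_eq_of_le h
  constructor
  · intro a b hab
    have := congrArg (fun s ↦ localizeEquiv (structureSheaf X) U V (φ.app V s)) hab
    simp only [app_smul, app_res, hφ, localizeEquiv_smul, localizeEquiv_res,
      AddEquiv.apply_symm_apply] at this
    refine ((structureSheaf X).bijective_res_of_eq hV).injective ?_
    exact ((isFrame_one _ _ (U.ι.image_mono (U.ι.preimage_mono h))).injective this)
  · intro s
    obtain ⟨a, ha⟩ := hs V s
    obtain ⟨b, rfl⟩ : ∃ b : Γ(X, V), Scheme.res (U.ι.image_preimage_le V) b = a :=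
      ((structureSheaf X).bijective_res_of_eq hV).surjective a
    refine ⟨b, (M.bijective_res_of_eq hV).injective ?_⟩
    simp only [res_smul, res_res]
    exact ha.symm

end

end AlgebraicGeometry.Scheme.Modules

/-! ### Gluing, line bundles through frames, and tensor comparison maps. -/

namespace AlgebraicGeometry.Scheme

/-- Gluing of local solutions that are unique. Since p is not assumed local, it is recovered only on
the members of a cover. -/
lemma exists_of_locally {X : Scheme.{u}} (F : TopCat.Sheaf Ab.{u} X) {U : X.Opens}
    (p : ∀ V : X.Opens, V ≤ U → F.obj.obj (.op V) → Prop)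
    (hres : ∀ (V W : X.Opens) (hV : V ≤ U) (h : W ≤ V) (s : F.obj.obj (.op V)), p V hV s →
      p W (h.trans hV) (F.obj.map (homOfLE h).op s))
    (hunique : ∀ (V : X.Opens) (hV : V ≤ U) (s t : F.obj.obj (.op V)), p V hV s → p V hV t → s = t)
    (hex : ∀ x ∈ U, ∃ (V : X.Opens) (hV : V ≤ U) (s : F.obj.obj (.op V)), x ∈ V ∧ p V hV s) :
    ∃ s : F.obj.obj (.op U), ∀ x ∈ U, ∃ (V : X.Opens) (hV : V ≤ U),
      x ∈ V ∧ p V hV (F.obj.map (homOfLE hV).op s) := by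
  choose V hV s hx hs using hex
  obtain ⟨t, ht, -⟩ := F.existsUnique_gluing' (fun x : U ↦ V x x.2) U
    (fun x ↦ homOfLE (hV x x.2)) (fun x hxU ↦ Opens.mem_iSup.mpr ⟨⟨x, hxU⟩, hx _ _⟩)
    (fun x ↦ s x x.2) (fun x y ↦ hunique _ (inf_le_left.trans (hV x x.2)) _ _
      (hres _ _ _ _ _ (hs _ _)) (hres _ _ _ inf_le_right _ (hs _ _)))
  refine ⟨t, fun x hxU ↦ ⟨V x hxU, hV x hxU, hx x hxU, ?_⟩⟩
  have := ht ⟨x, hxU⟩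
  change F.obj.map (homOfLE (hV x hxU)).op t = s x hxU at this
  rw [this]
  exact hs x hxU

namespace Modules

noncomputable section

variable {X S : Scheme.{u}}

lemma comp_app_apply {M N P : X.Modules} (φ : M ⟶ N) (ψ : N ⟶ P) {U : X.Opens} (s : Γ(M, U)) :
    (φ ≫ ψ).app U s = ψ.app U (φ.app U s) := rfl

lemma exists_of_locally (M : X.Modules) {U : X.Opens} (p : ∀ V : X.Opens, V ≤ U → Γ(M, V) → Prop)
    (hres : ∀ (V W : X.Opens) (hV : V ≤ U) (h : W ≤ V) (s : Γ(M, V)), p V hV s →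
      p W (h.trans hV) (M.res h s))
    (hunique : ∀ (V : X.Opens) (hV : V ≤ U) (s t : Γ(M, V)), p V hV s → p V hV t → s = t)
    (hex : ∀ x ∈ U, ∃ (V : X.Opens) (hV : V ≤ U) (s : Γ(M, V)), x ∈ V ∧ p V hV s) :
    ∃ s : Γ(M, U), ∀ x ∈ U, ∃ (V : X.Opens) (hV : V ≤ U), x ∈ V ∧ p V hV (M.res hV s) :=
  Scheme.exists_of_locally ⟨M.presheaf, M.isSheaf⟩ p hres hunique hex

/-- The pullback is defined by adjunction, without an explicit formula for sections; the universal
property transports the frame. -/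
lemma IsFrame.pullbackSection (f : X ⟶ S) {M : S.Modules} {U : S.Opens} {e : Γ(M, U)}
    (he : IsFrame e) : IsFrame (pullbackSection f e) :=
  (he.isUniversal.pullbackSection f).isFrame

lemma IsFrame.tmul {M N : X.Modules} {U : X.Opens} {e : Γ(M, U)} {e' : Γ(N, U)} (he : IsFrame e)
    (he' : IsFrame e') : IsFrame (tmul e e') :=
  (he.isUniversal_tmul he').isFrame

lemma IsFrame.of_isIso {M N : X.Modules} (φ : M ⟶ N) [IsIso φ] {U : X.Opens} {e : Γ(M, U)}
    (he : IsFrame e) : IsFrame (φ.app U e) := by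
  intro V h
  have h1 : Function.Bijective (φ.app V) :=
    ConcreteCategory.bijective_of_isIso (φ.app V)
  have := h1.comp (he V h)
  simpa only [Function.comp_def, app_smul, app_res] using this

lemma bijective_app_of_isFrame {M N : X.Modules} (φ : M ⟶ N)
    (H : ∀ x : X, ∃ (U : X.Opens) (e : Γ(M, U)), x ∈ U ∧ IsFrame e ∧ IsFrame (φ.app U e))
    (V : X.Opens) : Function.Bijective (φ.app V) := by
  have hinj : ∀ V : X.Opens, Function.Injective (φ.app V) := by
    intro V s t hst
    refine M.eq_of_locally fun x hx ↦ ?_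
    obtain ⟨U, e, hxU, he, he'⟩ := H x
    refine ⟨V ⊓ U, inf_le_left, ⟨hx, hxU⟩, ?_⟩
    obtain ⟨a, ha⟩ := (he.res inf_le_right).exists_eq (M.res (inf_le_left : V ⊓ U ≤ V) s)
    obtain ⟨b, hb⟩ := (he.res inf_le_right).exists_eq (M.res (inf_le_left : V ⊓ U ≤ V) t)
    have h1 := congrArg (N.res (inf_le_left : V ⊓ U ≤ V)) hst
    rw [← app_res, ← app_res, ha, hb, app_smul, app_smul, app_res] at h1
    rw [ha, hb, (he'.res _).injective h1]
  refine ⟨hinj V, fun n ↦ ?_⟩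
  obtain ⟨s, hs⟩ := M.exists_of_locally (U := V) (fun W hW s ↦ φ.app W s = N.res hW n)
    (fun W W' hW h s hs ↦ by rw [app_res, hs, res_res])
    (fun W hW s t hs ht ↦ hinj W (hs.trans ht.symm)) (fun x hx ↦ by
      obtain ⟨U, e, hxU, he, he'⟩ := H x
      obtain ⟨a, ha⟩ := (he'.res inf_le_right).exists_eq (N.res (inf_le_left : V ⊓ U ≤ V) n)
      exact ⟨V ⊓ U, inf_le_left, a • M.res inf_le_right e, ⟨hx, hxU⟩, by
        rw [app_smul, app_res, ha]⟩)
  refine ⟨s, N.eq_of_locally fun x hx ↦ ?_⟩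
  obtain ⟨W, hW, hxW, h⟩ := hs x hx
  exact ⟨W, hW, hxW, by rw [← app_res, h]⟩

lemma isIso_of_bijective_app {M N : X.Modules} (φ : M ⟶ N)
    (H : ∀ U, Function.Bijective (φ.app U)) : IsIso φ := by
  rw [Hom.isIso_iff_isIso_app]
  exact fun U ↦ (ConcreteCategory.isIso_iff_bijective (φ.app U)).mpr (H U)

lemma isIso_of_isFrame {M N : X.Modules} (φ : M ⟶ N)
    (H : ∀ x : X, ∃ (U : X.Opens) (e : Γ(M, U)), x ∈ U ∧ IsFrame e ∧ IsFrame (φ.app U e)) :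
    IsIso φ :=
  isIso_of_bijective_app φ (bijective_app_of_isFrame φ H)

lemma IsFrame.nonempty_iso {M : X.Modules} {e : Γ(M, ⊤)} (he : IsFrame e) :
    Nonempty (M ≅ structureSheaf X) := by
  obtain ⟨φ, hφ⟩ := ((isFrame_one (⊤ : X.Opens)).isUniversal M fun V ↦
    M.bijective_res_of_eq (inf_top_eq V)).surjective e
  have hφ : φ.app ⊤ (one _) = e := hφ
  have : IsIso φ := isIso_of_isFrame φ fun x ↦
    ⟨⊤, one ⊤, trivial, isFrame_one ⊤, by rwa [hφ]⟩
  exact ⟨(asIso φ).symm⟩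

/-- The sections of a restriction. -/
def restrictEquiv (M : X.Modules) (U : X.Opens) (V : (U : Scheme.{u}).Opens) :
    Γ(M.restrict U.ι, V) ≃+ Γ(M, U.ι ''ᵁ V) := AddEquiv.refl _

lemma restrictEquiv_smul (M : X.Modules) {U : X.Opens} {V : (U : Scheme.{u}).Opens}
    (a : Γ(X, U.ι ''ᵁ V)) (s : Γ(M.restrict U.ι, V)) :
    M.restrictEquiv U V ((show Γ(U, V) from a) • s) = a • M.restrictEquiv U V s := by
  have h1 : M.restrictEquiv U V ((show Γ(U, V) from a) • s) =
    (U.ι.appIso _).inv (show Γ(U, V) from a) • M.restrictEquiv U V s := rfl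
  rw [h1]
  congr 1
  rw [Opens.ι_appIso]
  rfl

lemma isFrame_restrictEquiv_iff (M : X.Modules) {U : X.Opens} {V : (U : Scheme.{u}).Opens}
    (e : Γ(M.restrict U.ι, V)) : IsFrame (M.restrictEquiv U V e) ↔ IsFrame e := by
  have key : ∀ (W : (U : Scheme.{u}).Opens) (h : W ≤ V),
      (Function.Bijective fun a : Γ(X, U.ι ''ᵁ W) ↦
        a • M.res (U.ι.image_mono h) (M.restrictEquiv U V e)) ↔
      (Function.Bijective fun a : Γ(U, W) ↦ a • (M.restrict U.ι).res h e) := fun W h ↦ by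
    rw [← Function.Bijective.of_comp_iff' (M.restrictEquiv U W).bijective]
    refine iff_of_eq (congrArg _ (funext fun a ↦ ?_))
    exact (M.restrictEquiv_smul a _).symm
  constructor
  · exact fun he W h ↦ (key W h).mp (he _ _)
  · intro he W h
    obtain ⟨W, rfl⟩ : ∃ W' : (U : Scheme.{u}).Opens, U.ι ''ᵁ W' = W :=
      ⟨U.ι ⁻¹ᵁ W, image_preimage_eq_of_le (h.trans (by
        simpa using U.ι.image_mono (le_top : V ≤ ⊤)))⟩
    have h' : W ≤ V := by simpa using U.ι.preimage_mono h
    exact (key W h').mpr (he _ _)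

/-- A local trivialization and a local frame are the same datum: the frame is the section
corresponding to 1. -/
lemma isLineBundle_iff {L : X.Modules} :
    L.IsLineBundle ↔ ∀ x : X, ∃ (U : X.Opens) (e : Γ(L, U)), x ∈ U ∧ IsFrame e := by
  refine forall_congr' fun x ↦ ⟨?_, ?_⟩
  · rintro ⟨U, hx, ⟨ψ⟩⟩
    let ψ : L.restrict U.ι ≅ structureSheaf (U : Scheme.{u}) := ψ
    have h1 := (isFrame_one (⊤ : (U : Scheme.{u}).Opens)).of_isIso ψ.inv
    exact ⟨_, L.restrictEquiv U ⊤ (ψ.inv.app ⊤ (one ⊤)), by simpa using hx,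
      (isFrame_restrictEquiv_iff _ _).mpr h1⟩
  · rintro ⟨U, e, hx, he⟩
    refine ⟨U, hx, ?_⟩
    have hU : U.ι ''ᵁ ⊤ = U := by simp
    have h1 : IsFrame ((L.restrictEquiv U ⊤).symm (L.res hU.le e)) := by
      rw [← isFrame_restrictEquiv_iff, AddEquiv.apply_symm_apply]
      exact he.res _
    exact h1.nonempty_iso

lemma IsLineBundle.exists_isFrame {L : X.Modules} (hL : L.IsLineBundle) {U : X.Opens} {x : X}
    (hx : x ∈ U) : ∃ (V : X.Opens) (_ : V ≤ U) (e : Γ(L, V)), x ∈ V ∧ IsAffineOpen V ∧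
      IsFrame e := by
  obtain ⟨W, e, hxW, he⟩ := isLineBundle_iff.mp hL x
  obtain ⟨V, hV, hxV, hVW⟩ := exists_isAffineOpen_mem_le (U := U ⊓ W) ⟨hx, hxW⟩
  exact ⟨V, hVW.trans inf_le_left, L.res (hVW.trans inf_le_right) e, hxV, hV, he.res _⟩

lemma IsLineBundle.exists_isFrame₂ {L L' : X.Modules} (hL : L.IsLineBundle) (hL' : L'.IsLineBundle)
    {U : X.Opens} {x : X} (hx : x ∈ U) :
    ∃ (V : X.Opens) (_ : V ≤ U) (e : Γ(L, V)) (e' : Γ(L', V)), x ∈ V ∧ IsAffineOpen V ∧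
      IsFrame e ∧ IsFrame e' := by
  obtain ⟨W, hW, e, hxW, -, he⟩ := hL.exists_isFrame hx
  obtain ⟨V, hV, e', hxV, hVa, he'⟩ := hL'.exists_isFrame hxW
  exact ⟨V, hV.trans hW, L.res hV e, e', hxV, hVa, he.res _, he'⟩

lemma IsLineBundle.tensorObj {L L' : X.Modules} (hL : L.IsLineBundle) (hL' : L'.IsLineBundle) :
    (tensorObj L L').IsLineBundle := by
  refine isLineBundle_iff.mpr fun x ↦ ?_
  obtain ⟨V, -, e, e', hxV, -, he, he'⟩ := hL.exists_isFrame₂ hL' (U := ⊤) (x := x) trivial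
  exact ⟨V, _, hxV, he.tmul he'⟩

lemma isLineBundle_structureSheaf : (structureSheaf X).IsLineBundle :=
  isLineBundle_iff.mpr fun _ ↦ ⟨⊤, one ⊤, trivial, isFrame_one ⊤⟩

/-- The comparison map sends the frame f^*(e ⊗ e') to the frame f^*e ⊗ f^*e'. -/
lemma isIso_pullbackTensor (f : X ⟶ S) {L L' : S.Modules} (hL : L.IsLineBundle)
    (hL' : L'.IsLineBundle) : IsIso (pullbackTensor f L L') := by
  refine isIso_of_isFrame _ fun x ↦ ?_
  obtain ⟨V, -, e, e', hxV, -, he, he'⟩ := hL.exists_isFrame₂ hL' (U := ⊤) (x := f x) trivial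
  refine ⟨f ⁻¹ᵁ V, Modules.pullbackSection f (tmul e e'), hxV, (he.tmul he').pullbackSection f, ?_⟩
  rw [pullbackTensor_app]
  exact (he.pullbackSection f).tmul (he'.pullbackSection f)

lemma tensorHom_tmul {M M' N N' : X.Modules} (φ : M ⟶ M') (ψ : N ⟶ N') {U : X.Opens}
    (s : Γ(M, U)) (t : Γ(N, U)) :
    (tensorHom φ ψ).app U (tmul s t) = tmul (φ.app U s) (ψ.app U t) := by
  have h : PresheafOfModules.sheafificationHomEquiv (𝟙 X.ringCatSheaf.obj)
      (P := presheafTensorObj M N) (tensorHom φ ψ) =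
      (show presheafTensorObj M N ⟶ presheafTensorObj M' N' from
        PresheafOfModules.Monoidal.tensorHom (R := X.presheaf) φ.val ψ.val) ≫
        PresheafOfModules.sheafificationHomEquiv (𝟙 X.ringCatSheaf.obj)
          (P := presheafTensorObj M' N') (𝟙 (Modules.tensorObj M' N')) := by
    refine Eq.trans ?_ ((PresheafOfModules.sheafificationAdjunction
      (𝟙 X.ringCatSheaf.obj)).homEquiv_naturality_left
        (X' := presheafTensorObj M N) (X := presheafTensorObj M' N') (Y := Modules.tensorObj M' N')
        (PresheafOfModules.Monoidal.tensorHom (R := X.presheaf) φ.val ψ.val)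
        (𝟙 (Modules.tensorObj M' N')))
    exact congrArg (PresheafOfModules.sheafificationHomEquiv (𝟙 X.ringCatSheaf.obj)
      (P := presheafTensorObj M N)) (Category.comp_id (tensorHom φ ψ)).symm
  exact congrArg (fun χ ↦ (χ.app (.op U)).hom
    (TensorProduct.tmul Γ(X, U) (M := Γ(M, U)) (N := Γ(N, U)) s t)) h

lemma isIso_tensorHom {M M' N N' : X.Modules} (φ : M ⟶ M') (ψ : N ⟶ N') [IsIso φ] [IsIso ψ] :
    IsIso (tensorHom φ ψ) := by
  refine ⟨tensorHom (inv φ) (inv ψ), ?_, ?_⟩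
  all_goals
    refine tensor_hom_ext fun U s t ↦ ?_
    rw [comp_app_apply, tensorHom_tmul, tensorHom_tmul, ← comp_app_apply, ← comp_app_apply]
    simp only [IsIso.hom_inv_id, IsIso.inv_hom_id]
    rfl

end

end Modules

end AlgebraicGeometry.Scheme

/-! ### Transition units and the homomorphism out of the relative Picard group. -/

namespace AlgebraicGeometry.Scheme

noncomputable section

variable {X S : Scheme.{u}}

namespace Modules

lemma IsFrame.exists_unit {M : X.Modules} {U : X.Opens} {e e' : Γ(M, U)} (he : IsFrame e)
    (he' : IsFrame e') : ∃ u : Γ(X, U)ˣ, e = (u : Γ(X, U)) • e' := by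
  obtain ⟨a, ha⟩ := he'.exists_eq e
  obtain ⟨b, hb⟩ := he.exists_eq e'
  refine ⟨⟨a, b, he.injective ?_, he'.injective ?_⟩, ha⟩
  · rw [mul_smul, ← hb, ← ha, one_smul]
  · rw [mul_smul, ← ha, ← hb, one_smul]

lemma IsFrame.smul {M : X.Modules} {U : X.Opens} {e : Γ(M, U)} (he : IsFrame e) (u : Γ(X, U)ˣ) :
    IsFrame ((u : Γ(X, U)) • e) := by
  intro V h
  have h1 : Function.Bijective fun a : Γ(X, V) ↦
      a * (Units.map (Scheme.res h : Γ(X, U) →* Γ(X, V)) u) := Units.mulRight_bijective _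
  have h2 := (he V h).comp h1
  simpa only [Function.comp_def, res_smul, mul_smul, Units.coe_map, MonoidHom.coe_coe] using h2

variable {f : X ⟶ S}

lemma pullbackSection_injective (hf : ∀ U : S.Opens, Function.Injective (f.app U).hom)
    {L : S.Modules} (hL : L.IsLineBundle) {U : S.Opens} :
    Function.Injective (pullbackSection f : Γ(L, U) → _) := by
  intro s t hst
  refine L.eq_of_locally fun x hx ↦ ?_
  obtain ⟨V, hV, e, hxV, -, he⟩ := hL.exists_isFrame hx
  refine ⟨V, hV, hxV, ?_⟩
  obtain ⟨a, ha⟩ := he.exists_eq (L.res hV s)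
  obtain ⟨b, hb⟩ := he.exists_eq (L.res hV t)
  have h := congrArg (((pullback f).obj L).res (f.preimage_mono hV)) hst
  rw [res_pullbackSection f hV, res_pullbackSection f hV, ha, hb, pullbackSection_smul,
    pullbackSection_smul] at h
  rw [ha, hb, hf V ((he.pullbackSection f).injective h)]

lemma pullback_map_app_pullbackSection {M N : S.Modules} (φ : M ⟶ N) {U : S.Opens} (s : Γ(M, U)) :
    ((pullback f).map φ).app (f ⁻¹ᵁ U) (pullbackSection f s) = pullbackSection f (φ.app U s) :=
  (congrArg (fun ψ ↦ Hom.app ψ U s)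
    ((pullbackPushforwardAdjunction f).unit.naturality φ)).symm

lemma pullback_hom_ext {M : S.Modules} {N : X.Modules} {φ ψ : (pullback f).obj M ⟶ N}
    (h : ∀ (U : S.Opens) (s : Γ(M, U)),
      φ.app (f ⁻¹ᵁ U) (pullbackSection f s) = ψ.app (f ⁻¹ᵁ U) (pullbackSection f s)) : φ = ψ := by
  apply ((pullbackPushforwardAdjunction f).homEquiv M N).injective
  rw [Adjunction.homEquiv_unit, Adjunction.homEquiv_unit]
  exact hom_ext_apply h

lemma homEquiv_symm_app_pullbackSection {M : S.Modules} {N : X.Modules}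
    (φ : M ⟶ (pushforward f).obj N) {U : S.Opens} (s : Γ(M, U)) :
    (((pullbackPushforwardAdjunction f).homEquiv M N).symm φ).app (f ⁻¹ᵁ U)
      (pullbackSection f s) = (show Γ(N, f ⁻¹ᵁ U) from φ.app U s) := by
  have h := ((pullbackPushforwardAdjunction f).homEquiv M N).apply_symm_apply φ
  rw [Adjunction.homEquiv_unit] at h
  exact congrArg (fun ψ ↦ Hom.app ψ U s) h

/-- In suitable frames, the morphism `α` between the pullbacks of two sheaves of modules is the
multiplication with `u`. -/
def IsTransition {L L' : S.Modules} (α : (pullback f).obj L ⟶ (pullback f).obj L') (U : S.Opens)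
    (u : Γ(X, f ⁻¹ᵁ U)ˣ) : Prop :=
  ∃ (e : Γ(L, U)) (e' : Γ(L', U)), IsFrame e ∧ IsFrame e' ∧
    α.app (f ⁻¹ᵁ U) (pullbackSection f e) = (u : Γ(X, f ⁻¹ᵁ U)) • pullbackSection f e'

lemma IsTransition.res {L L' : S.Modules} {α : (pullback f).obj L ⟶ (pullback f).obj L'}
    {U V : S.Opens} {u : Γ(X, f ⁻¹ᵁ U)ˣ} (hu : IsTransition α U u) (h : V ≤ U) :
    IsTransition α V (f.unitRes h u) := by
  obtain ⟨e, e', he, he', hee'⟩ := hu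
  refine ⟨_, _, he.res h, he'.res h, ?_⟩
  have := congrArg (((pullback f).obj L').res (f.preimage_mono h)) hee'
  rwa [← app_res, res_smul, res_pullbackSection, res_pullbackSection] at this

lemma exists_transition {L L' : S.Modules} (α : (pullback f).obj L ⟶ (pullback f).obj L')
    [IsIso α] {U : S.Opens} {e : Γ(L, U)} {e' : Γ(L', U)} (he : IsFrame e) (he' : IsFrame e') :
    ∃ u : Γ(X, f ⁻¹ᵁ U)ˣ,
      α.app (f ⁻¹ᵁ U) (pullbackSection f e) = (u : Γ(X, f ⁻¹ᵁ U)) • pullbackSection f e' :=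
  ((he.pullbackSection f).of_isIso α).exists_unit (he'.pullbackSection f)

lemma exists_isTransition {L L' : S.Modules} (hL : L.IsLineBundle) (hL' : L'.IsLineBundle)
    (α : (pullback f).obj L ⟶ (pullback f).obj L') [IsIso α] {U : S.Opens} {x : S} (hx : x ∈ U) :
    ∃ (V : S.Opens) (_ : V ≤ U) (u : Γ(X, f ⁻¹ᵁ V)ˣ), x ∈ V ∧ IsAffineOpen V ∧
      IsTransition α V u := by
  obtain ⟨V, hV, e, e', hxV, hVa, he, he'⟩ := hL.exists_isFrame₂ hL' hx
  obtain ⟨u, hu⟩ := exists_transition α he he'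
  exact ⟨V, hV, u, hxV, hVa, e, e', he, he', hu⟩

/-- In the given frames α has matrix 1, so it carries pulled-back sections to pulled-back sections.
The preimages are unique because f^* is injective on sections of a line bundle, hence they glue to a
morphism on S. -/
lemma exists_pullback_map_eq (hf : ∀ U : S.Opens, Function.Injective (f.app U).hom)
    {L L' : S.Modules} (hL' : L'.IsLineBundle)
    (α : (pullback f).obj L ⟶ (pullback f).obj L')
    (H : ∀ x : S, ∃ (U : S.Opens) (e : Γ(L, U)) (e' : Γ(L', U)), x ∈ U ∧ IsFrame e ∧ IsFrame e' ∧
      α.app (f ⁻¹ᵁ U) (pullbackSection f e) = pullbackSection f e') :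
    ∃ α₀ : L ≅ L', (pullback f).map α₀.hom = α := by
  have hinj {U : S.Opens} := pullbackSection_injective hf hL' (U := U)
  have key : ∀ (U : S.Opens) (s : Γ(L, U)), ∃ t : Γ(L', U),
      pullbackSection f t = α.app (f ⁻¹ᵁ U) (pullbackSection f s) := fun U s ↦ by
    obtain ⟨t, ht⟩ := L'.exists_of_locally (U := U) (fun V hV t ↦
        pullbackSection f t = α.app (f ⁻¹ᵁ V) (pullbackSection f (L.res hV s)))
      (fun V W hV h t ht ↦ by
        rw [← res_pullbackSection f h, ht, ← app_res, res_pullbackSection f h, res_res])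
      (fun V hV t t' ht ht' ↦ hinj (ht.trans ht'.symm))
      (fun x hx ↦ by
        obtain ⟨V, e, e', hxV, he, he', hee'⟩ := H x
        obtain ⟨a, ha⟩ := (he.res inf_le_right).exists_eq (L.res (inf_le_left : U ⊓ V ≤ U) s)
        refine ⟨U ⊓ V, inf_le_left, a • L'.res inf_le_right e', ⟨hx, hxV⟩, ?_⟩
        rw [ha, pullbackSection_smul, pullbackSection_smul, app_smul, ← res_pullbackSection,
          ← res_pullbackSection, app_res, hee'])
    refine ⟨t, eq_of_locally _ fun x hx ↦ ?_⟩
    obtain ⟨V, hV, hxV, h⟩ := ht (f x) hx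
    refine ⟨f ⁻¹ᵁ V, f.preimage_mono hV, hxV, ?_⟩
    rw [res_pullbackSection f hV, h, ← app_res, res_pullbackSection f hV]
  choose φ hφ using key
  let α₀ : L ⟶ L' := homMk (fun U ↦
    { toFun := φ U
      map_add' := fun s t ↦ hinj (by
        rw [pullbackSection_add, hφ, hφ, hφ, pullbackSection_add, map_add])
      map_smul' := fun a s ↦ hinj (by
        rw [RingHom.id_apply, pullbackSection_smul, hφ, hφ, pullbackSection_smul, app_smul]) })
    (fun U V h s ↦ hinj (by
      change pullbackSection f (L'.res h (φ U s)) = pullbackSection f (φ V (L.res h s))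
      rw [← res_pullbackSection, hφ, hφ, ← app_res, res_pullbackSection]))
  have hα₀ : ∀ (U : S.Opens) (s : Γ(L, U)), pullbackSection f (α₀.app U s) =
    α.app (f ⁻¹ᵁ U) (pullbackSection f s) := hφ
  have : IsIso α₀ := isIso_of_isFrame α₀ fun x ↦ by
    obtain ⟨U, e, e', hxU, he, he', hee'⟩ := H x
    refine ⟨U, e, hxU, he, ?_⟩
    have h : α₀.app U e = e' := hinj ((hα₀ U e).trans hee')
    rwa [h]
  refine ⟨asIso α₀, pullback_hom_ext fun U s ↦ ?_⟩
  rw [pullback_map_app_pullbackSection]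
  exact hα₀ U s

end Modules

open Modules

/-- Inverses are given by α⁻¹ and sums by tensor products, so every class is that of one generator.
Injectivity then needs to be tested on generators only. -/
lemma Hom.RelPic.exists_mk_of {f : X ⟶ S} (x : f.RelPic) :
    ∃ G : f.RelPicGenerator, QuotientAddGroup.mk (.of G) = x := by
  let q : FreeAbelianGroup f.RelPicGenerator →+ f.RelPic := QuotientAddGroup.mk' _
  have hq : ∀ r, f.RelPicRelation r → q r = 0 := fun r hr ↦
    (QuotientAddGroup.eq_zero_iff _).mpr (AddSubgroup.subset_closure hr)
  have hrefl : ∀ (L : S.Modules) (hL : L.IsLineBundle), q (.of ⟨L, L, hL, hL, Iso.refl _⟩) = 0 :=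
    fun L hL ↦ by
      have := hq _ (.pullback L L hL hL (Iso.refl L))
      rwa [Functor.mapIso_refl] at this
  obtain ⟨x, rfl⟩ := QuotientAddGroup.mk'_surjective _ x
  change ∃ G, q (.of G) = q x
  have hneg : ∀ G : f.RelPicGenerator, ∃ G' : f.RelPicGenerator, q (.of G') = -q (.of G) :=
    fun ⟨L₁, L₂, h₁, h₂, α⟩ ↦ by
      have := hq _ (.comp L₁ L₂ L₁ h₁ h₂ h₁ α α.symm)
      rw [Iso.self_symm_id, map_sub, hrefl, sub_zero, map_add] at this
      exact ⟨_, eq_neg_of_add_eq_zero_right this⟩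
  induction x using FreeAbelianGroup.induction_on with
  | zero => exact ⟨_, (hrefl _ isLineBundle_structureSheaf).trans (map_zero q).symm⟩
  | of G => exact ⟨G, rfl⟩
  | neg G => exact (hneg G).imp fun G' h ↦ h.trans (map_neg q _).symm
  | add x y hx hy =>
    obtain ⟨⟨L₁, L₂, h₁, h₂, α⟩, hx⟩ := hx
    obtain ⟨⟨L₁', L₂', h₁', h₂', α'⟩, hy⟩ := hy
    have := isIso_pullbackTensor f h₁ h₁'
    have := isIso_pullbackTensor f h₂ h₂'
    have := isIso_tensorHom α.hom α'.hom
    have := hq _ (.tensor L₁ L₂ L₁' L₂' h₁ h₂ h₁' h₂' (h₁.tensorObj h₁') (h₂.tensorObj h₂') α α'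
      (asIso (pullbackTensor f L₁ L₁' ≫ tensorHom α.hom α'.hom ≫ inv (pullbackTensor f L₂ L₂')))
      (by simp))
    rw [map_sub, map_add, sub_eq_zero] at this
    exact ⟨_, by rw [map_add, ← hx, ← hy, this]⟩

variable {f : X ⟶ S} [∀ U : S.Opens, Algebra ℚ Γ(S, U)] [∀ U : X.Opens, Algebra ℚ Γ(X, U)]

namespace Hom.IsSubintegral

variable (hf : f.IsSubintegral)

lemma log_app {U : S.Opens} (a : Γ(S, U)ˣ) :
    hf.log (Units.map ((f.app U).hom : Γ(S, U) →* Γ(X, f ⁻¹ᵁ U)) a) = 0 := by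
  refine f.quotient_eq_of_locally fun x hx ↦ ?_
  obtain ⟨V, hV, hxV, hVU⟩ := exists_isAffineOpen_mem_le hx
  refine ⟨V, hVU, hxV, ?_⟩
  rw [hf.log_res, map_zero, hf.log_eq_zero_iff hV]
  exact ⟨Units.map (Scheme.res hVU : Γ(S, U) →* Γ(S, V)) a, (f.res_app hVU (a : Γ(S, U))).symm⟩

lemma log_one {U : S.Opens} : hf.log (1 : Γ(X, f ⁻¹ᵁ U)ˣ) = 0 := by
  simpa using hf.log_mul (1 : Γ(X, f ⁻¹ᵁ U)ˣ) 1

/-- A change of frames multiplies the transition unit by units coming from 𝒪_S, whose logarithm is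
zero. -/
lemma log_eq_of_isTransition {L L' : S.Modules} {α : (Modules.pullback f).obj L ⟶ (Modules.pullback f).obj L'}
    {U : S.Opens} {u v : Γ(X, f ⁻¹ᵁ U)ˣ} (hu : IsTransition α U u) (hv : IsTransition α U v) :
    hf.log u = hf.log v := by
  obtain ⟨e₁, e₁', he₁, he₁', h₁⟩ := hu
  obtain ⟨e₂, e₂', he₂, he₂', h₂⟩ := hv
  obtain ⟨a, rfl⟩ := he₂.exists_unit he₁
  obtain ⟨b, rfl⟩ := he₂'.exists_unit he₁'
  rw [pullbackSection_smul, pullbackSection_smul, app_smul, h₁, ← mul_smul, ← mul_smul] at h₂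
  have h := Units.ext ((he₁'.pullbackSection f).injective h₂ :
    ((Units.map ((f.app U).hom : Γ(S, U) →* Γ(X, f ⁻¹ᵁ U)) a * u : Γ(X, f ⁻¹ᵁ U)ˣ) :
      Γ(X, f ⁻¹ᵁ U)) =
      (v * Units.map ((f.app U).hom : Γ(S, U) →* Γ(X, f ⁻¹ᵁ U)) b : Γ(X, f ⁻¹ᵁ U)ˣ))
  simpa [hf.log_mul, hf.log_app] using congrArg hf.log h

lemma exists_transitionClass {L L' : S.Modules} (hL : L.IsLineBundle) (hL' : L'.IsLineBundle)
    (α : (Modules.pullback f).obj L ⟶ (Modules.pullback f).obj L') [IsIso α] :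
    ∃ s : f.quotientSheaf.obj.obj (.op ⊤), ∀ (U : S.Opens) (u : Γ(X, f ⁻¹ᵁ U)ˣ),
      IsTransition α U u → f.quotientRes le_top s = hf.log u := by
  obtain ⟨s, hs⟩ := Scheme.exists_of_locally f.quotientSheaf (U := ⊤)
    (fun V _ s ↦ ∀ (W : S.Opens) (hW : W ≤ V) (u : Γ(X, f ⁻¹ᵁ W)ˣ), IsTransition α W u →
      f.quotientRes hW s = hf.log u)
    (fun V W _ h s hs W' hW' u hu ↦ (f.quotientRes_res h hW' s).trans (hs W' _ u hu))
    (fun V _ s t hs ht ↦ f.quotient_eq_of_locally fun x hx ↦ by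
      obtain ⟨W, hW, u, hxW, -, hu⟩ := exists_isTransition hL hL' α hx
      exact ⟨W, hW, hxW, (hs W hW u hu).trans (ht W hW u hu).symm⟩)
    (fun x hx ↦ by
      obtain ⟨W, hW, u, hxW, -, hu⟩ := exists_isTransition hL hL' α hx
      exact ⟨W, hW, hf.log u, hxW, fun W' hW' u' hu' ↦ (hf.log_res hW' u).trans
        (hf.log_eq_of_isTransition (hu.res hW') hu')⟩)
  refine ⟨s, fun U u hu ↦ f.quotient_eq_of_locally fun x hx ↦ ?_⟩
  obtain ⟨V, hV, hxV, H⟩ := hs x trivial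
  refine ⟨U ⊓ V, inf_le_left, ⟨hx, hxV⟩, ?_⟩
  rw [hf.log_res, ← H (U ⊓ V) inf_le_right _ (hu.res inf_le_left), f.quotientRes_res]
  exact (f.quotientRes_res hV inf_le_right s).symm

/-- The section of `f_* 𝒪_X / 𝒪_S` that is given by the logarithms of the transition units of an
isomorphism between the pullbacks of two line bundles. -/
def transitionClass (G : f.RelPicGenerator) : f.quotientSheaf.obj.obj (.op ⊤) :=
  (hf.exists_transitionClass G.isLineBundle₁ G.isLineBundle₂ G.α.hom).choose

lemma transitionClass_res (G : f.RelPicGenerator) {U : S.Opens} {u : Γ(X, f ⁻¹ᵁ U)ˣ}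
    (hu : IsTransition G.α.hom U u) : f.quotientRes le_top (hf.transitionClass G) = hf.log u :=
  (hf.exists_transitionClass G.isLineBundle₁ G.isLineBundle₂ G.α.hom).choose_spec U u hu

lemma transitionClass_res_of_isFrame {L L' : S.Modules} (hL : L.IsLineBundle)
    (hL' : L'.IsLineBundle) (α : (Modules.pullback f).obj L ≅ (Modules.pullback f).obj L')
    {U : S.Opens} {e : Γ(L, U)} {e' : Γ(L', U)} (he : IsFrame e) (he' : IsFrame e')
    {u : Γ(X, f ⁻¹ᵁ U)ˣ} (hu : α.hom.app (f ⁻¹ᵁ U) (pullbackSection f e) =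
      (u : Γ(X, f ⁻¹ᵁ U)) • pullbackSection f e') :
    f.quotientRes le_top (hf.transitionClass ⟨L, L', hL, hL', α⟩) = hf.log u :=
  hf.transitionClass_res ⟨L, L', hL, hL', α⟩ ⟨e, e', he, he', hu⟩

/-- In local frames, tensor products and compositions both multiply transition units, and a
pulled-back isomorphism has unit 1 in matching frames; additivity of the logarithm does the rest. -/
lemma lift_transitionClass_eq_zero {r : FreeAbelianGroup f.RelPicGenerator}
    (hr : f.RelPicRelation r) : FreeAbelianGroup.lift hf.transitionClass r = 0 := by
  induction hr with
  | tensor L₁ L₂ L₁' L₂' h₁ h₂ h₁' h₂' h₁'' h₂'' α α' γ comm =>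
    rw [map_sub, map_add, FreeAbelianGroup.lift_apply_of, FreeAbelianGroup.lift_apply_of,
      FreeAbelianGroup.lift_apply_of, sub_eq_zero]
    refine f.quotient_eq_of_locally fun x hx ↦ ?_
    obtain ⟨V, hV, e₁, e₂, hxV, -, he₁, he₂⟩ := h₁.exists_isFrame₂ h₂ hx
    obtain ⟨W, hW, e₁', e₂', hxW, -, he₁', he₂'⟩ := h₁'.exists_isFrame₂ h₂' hxV
    refine ⟨W, hW.trans hV, hxW, ?_⟩
    obtain ⟨u, hu⟩ := exists_transition α.hom (he₁.res hW) (he₂.res hW)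
    obtain ⟨u', hu'⟩ := exists_transition α'.hom he₁' he₂'
    rw [map_add, hf.transitionClass_res_of_isFrame h₁ h₂ α (he₁.res hW) (he₂.res hW) hu,
      hf.transitionClass_res_of_isFrame h₁' h₂' α' he₁' he₂' hu', ← hf.log_mul]
    refine (hf.transitionClass_res_of_isFrame h₁'' h₂'' γ ((he₁.res hW).tmul he₁')
      ((he₂.res hW).tmul he₂') ?_).symm
    -- The unit of γ is computed after the comparison map, where γ becomes α ⊗ α'.
    have := isIso_pullbackTensor f h₂ h₂'
    refine (ConcreteCategory.bijective_of_isIso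
      ((pullbackTensor f L₂ L₂').app (f ⁻¹ᵁ W))).injective ?_
    rw [← comp_app_apply, comm, comp_app_apply, pullbackTensor_app, tensorHom_tmul, hu, hu',
      smul_tmul, tmul_smul, app_smul, pullbackTensor_app, ← mul_smul, Units.val_mul]
  | comp L₁ L₂ L₃ h₁ h₂ h₃ α β =>
    rw [map_sub, map_add, FreeAbelianGroup.lift_apply_of, FreeAbelianGroup.lift_apply_of,
      FreeAbelianGroup.lift_apply_of, sub_eq_zero]
    refine f.quotient_eq_of_locally fun x hx ↦ ?_
    obtain ⟨V, hV, e₁, e₂, hxV, -, he₁, he₂⟩ := h₁.exists_isFrame₂ h₂ hx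
    obtain ⟨W, hW, e₃, hxW, -, he₃⟩ := h₃.exists_isFrame hxV
    refine ⟨W, hW.trans hV, hxW, ?_⟩
    obtain ⟨u, hu⟩ := exists_transition α.hom (he₁.res hW) (he₂.res hW)
    obtain ⟨v, hv⟩ := exists_transition β.hom (he₂.res hW) he₃
    rw [map_add, hf.transitionClass_res_of_isFrame h₁ h₂ α (he₁.res hW) (he₂.res hW) hu,
      hf.transitionClass_res_of_isFrame h₂ h₃ β (he₂.res hW) he₃ hv, ← hf.log_mul]
    refine (hf.transitionClass_res_of_isFrame h₁ h₃ _ (he₁.res hW) he₃ ?_).symm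
    rw [Iso.trans_hom, comp_app_apply, hu, app_smul, hv, ← mul_smul, Units.val_mul]
  | pullback L₁ L₂ h₁ h₂ α₀ =>
    rw [FreeAbelianGroup.lift_apply_of]
    refine f.quotient_eq_of_locally fun x hx ↦ ?_
    obtain ⟨V, hV, e, hxV, -, he⟩ := h₁.exists_isFrame hx
    refine ⟨V, hV, hxV, ?_⟩
    rw [map_zero, ← hf.log_one]
    refine hf.transitionClass_res_of_isFrame h₁ h₂ _ he (he.of_isIso α₀.hom) ?_
    rw [Units.val_one, one_smul, Functor.mapIso_hom, pullback_map_app_pullbackSection]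

/-- The homomorphism from the relative Picard group to the global sections of
`f_* 𝒪_X / 𝒪_S`. -/
def relPicHom : f.RelPic →+ f.quotientSheaf.obj.obj (.op ⊤) :=
  QuotientAddGroup.lift _ (FreeAbelianGroup.lift hf.transitionClass)
    ((AddSubgroup.closure_le _).mpr fun _ hr ↦ hf.lift_transitionClass_eq_zero hr)

lemma relPicHom_mk_of (G : f.RelPicGenerator) :
    hf.relPicHom (QuotientAddGroup.mk (.of G)) = hf.transitionClass G :=
  FreeAbelianGroup.lift_apply_of _ _

lemma mk_of_eq_zero {G : f.RelPicGenerator} (hG : hf.transitionClass G = 0) :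
    (QuotientAddGroup.mk (.of G) : f.RelPic) = 0 := by
  obtain ⟨L₁, L₂, h₁, h₂, α⟩ := G
  obtain ⟨α₀, hα₀⟩ := exists_pullback_map_eq hf.injective (L := L₁) h₂ α.hom fun x ↦ by
    obtain ⟨U, -, u, hxU, hU, e, e', he, he', hu⟩ :=
      exists_isTransition h₁ h₂ α.hom (U := ⊤) (x := x) trivial
    have := hf.transitionClass_res ⟨L₁, L₂, h₁, h₂, α⟩ ⟨e, e', he, he', hu⟩
    rw [hG, map_zero, eq_comm, hf.log_eq_zero_iff hU] at this
    obtain ⟨a, ha⟩ := this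
    -- The transition unit comes from 𝒪_S and is absorbed into the second frame.
    refine ⟨U, e, (a : Γ(S, U)) • e', hxU, he, he'.smul a, ?_⟩
    rw [hu, pullbackSection_smul, ha]
  obtain rfl : (Modules.pullback f).mapIso α₀ = α := Iso.ext hα₀
  exact (QuotientAddGroup.eq_zero_iff _).mpr
    (AddSubgroup.subset_closure (.pullback L₁ L₂ h₁ h₂ α₀))

end Hom.IsSubintegral

end

end AlgebraicGeometry.Scheme

/-! ### Surjectivity: the line bundle attached to a section of the quotient. -/

namespace AlgebraicGeometry.Scheme

noncomputable section

variable {X S : Scheme.{u}}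

namespace Modules

/-! ### Subsheaves of modules -/

section

variable (M : X.Modules) (p : ∀ U : X.Opens, Submodule Γ(X, U) Γ(M, U))
  (hres : ∀ (U V : X.Opens) (h : V ≤ U), ∀ s ∈ p U, M.res h s ∈ p V)
  (hloc : ∀ (U : X.Opens) (s : Γ(M, U)),
    (∀ x ∈ U, ∃ (V : X.Opens) (hV : V ≤ U), x ∈ V ∧ M.res hV s ∈ p V) → s ∈ p U)

/-- A family of submodules that is stable under restriction, as a presheaf of submodules. -/
def presheafSubmodule : PresheafOfModules.Submodule M.val where
  obj U := p U.unop
  map {U V} i := fun s hs ↦ hres U.unop V.unop i.unop.le s hs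

lemma isSheaf_presheafSubmodule (hloc : ∀ (U : X.Opens) (s : Γ(M, U)),
    (∀ x ∈ U, ∃ (V : X.Opens) (hV : V ≤ U), x ∈ V ∧ M.res hV s ∈ p V) → s ∈ p U) :
    TopCat.Presheaf.IsSheaf
      (C := Ab.{u}) (X := X) (presheafSubmodule M p hres).toPresheafOfModules.presheaf := by
  rw [TopCat.Presheaf.isSheaf_iff_isSheafUniqueGluing]
  intro ι U sf hsf
  let sf' : ∀ i, p (U i) := sf
  obtain ⟨s, hs, hs'⟩ := TopCat.Sheaf.existsUnique_gluing (X := X) (C := Ab.{u})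
    ⟨M.presheaf, M.isSheaf⟩ U (fun i ↦ (sf' i).1) (fun i j ↦ congrArg Subtype.val (hsf i j))
  have hmem : s ∈ p (iSup U) := hloc _ _ fun x hx ↦ by
    obtain ⟨i, hi⟩ := Opens.mem_iSup.mp hx
    refine ⟨U i, le_iSup U i, hi, ?_⟩
    have h1 : M.res (le_iSup U i) s = (sf' i).1 := hs i
    rw [h1]
    exact (sf' i).2
  refine ⟨(⟨s, hmem⟩ : p (iSup U)), fun i ↦ Subtype.ext (hs i), fun t ht ↦ Subtype.ext ?_⟩
  exact hs' (show p (iSup U) from t).1 fun i ↦ congrArg Subtype.val (ht i)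

/-- A family of submodules that is local, as a sheaf of modules. -/
def subsheaf : X.Modules :=
  ⟨(presheafSubmodule M p hres).toPresheafOfModules, isSheaf_presheafSubmodule M p hres hloc⟩

/-- The inclusion of a subsheaf of modules. -/
def subsheafι : subsheaf M p hres hloc ⟶ M := SheafOfModules.Hom.mk (presheafSubmodule M p hres).ι

lemma subsheafι_injective (U : X.Opens) :
    Function.Injective ((subsheafι M p hres hloc).app U) := fun _ _ h ↦ Subtype.ext h

lemma subsheafι_mem {U : X.Opens} (s : Γ(subsheaf M p hres hloc, U)) :
    (subsheafι M p hres hloc).app U s ∈ p U :=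
  (show p U from s).2

lemma exists_subsheafι_eq {U : X.Opens} {s : Γ(M, U)} (hs : s ∈ p U) :
    ∃ t, (subsheafι M p hres hloc).app U t = s :=
  ⟨(⟨s, hs⟩ : p U), rfl⟩

end

lemma exists_iso_pullback_structureSheaf (f : X ⟶ S) :
    ∃ β : (pullback f).obj (structureSheaf S) ≅ structureSheaf X, ∀ U : S.Opens,
      β.hom.app (f ⁻¹ᵁ U) (pullbackSection f (one U)) = one (f ⁻¹ᵁ U) := by
  obtain ⟨φ, hφ⟩ := ((isFrame_one (⊤ : S.Opens)).isUniversal.pullbackSection f (structureSheaf X)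
    fun V ↦ bijective_res_of_eq _ (inf_top_eq V)).surjective (one (f ⁻¹ᵁ ⊤))
  have hφ : φ.app (f ⁻¹ᵁ ⊤) (pullbackSection f (one ⊤)) = one (f ⁻¹ᵁ ⊤) := hφ
  have hres : ∀ {Y : Scheme.{u}} {U V : Y.Opens} (h : V ≤ U),
      (structureSheaf Y).res h (one U) = one V := fun {Y U V} h ↦ map_one (Scheme.res h)
  have : IsIso φ := isIso_of_isFrame φ fun x ↦ ⟨f ⁻¹ᵁ ⊤, pullbackSection f (one ⊤), trivial,
    (isFrame_one ⊤).pullbackSection f, by rw [hφ]; exact isFrame_one _⟩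
  refine ⟨asIso φ, fun U ↦ ?_⟩
  change φ.app _ _ = _
  rw [← hres (le_top : U ≤ ⊤), ← res_pullbackSection f le_top, app_res, hφ, hres]

end Modules

open Modules

/-- Membership in 𝒪_S is the vanishing of a section of the quotient sheaf, which is a local
condition. -/
lemma Hom.mem_range_app_of_locally {f : X ⟶ S}
    (hf : ∀ U : S.Opens, Function.Injective (f.app U).hom) {U : S.Opens} {b : Γ(X, f ⁻¹ᵁ U)}
    (h : ∀ x ∈ U, ∃ (V : S.Opens) (hV : V ≤ U), x ∈ V ∧ f.res hV b ∈ (f.app V).hom.range) :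
    b ∈ (f.app U).hom.range := by
  rw [← f.toQuotient_eq_zero_iff hf]
  refine f.quotient_eq_of_locally fun x hx ↦ ?_
  obtain ⟨V, hV, hxV, h⟩ := h x hx
  refine ⟨V, hV, hxV, ?_⟩
  rwa [f.quotientRes_toQuotient, map_zero, f.toQuotient_eq_zero_iff hf]

variable {f : X ⟶ S} [∀ U : S.Opens, Algebra ℚ Γ(S, U)] [∀ U : X.Opens, Algebra ℚ Γ(X, U)]

namespace Hom.IsSubintegral

variable (hf : f.IsSubintegral)

lemma mem_range_of_log_eq {U : S.Opens} {u v : Γ(X, f ⁻¹ᵁ U)ˣ} (h : hf.log u = hf.log v) :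
    (↑(u⁻¹ * v) : Γ(X, f ⁻¹ᵁ U)) ∈ (f.app U).hom.range := by
  have h0 : hf.log (u⁻¹ * v) = 0 := by
    have := hf.log_mul u (u⁻¹ * v)
    rwa [mul_inv_cancel_left, h, left_eq_add] at this
  refine mem_range_app_of_locally hf.injective fun x hx ↦ ?_
  obtain ⟨V, hV, hxV, hVU⟩ := exists_isAffineOpen_mem_le hx
  refine ⟨V, hVU, hxV, ?_⟩
  have h1 := hf.log_res hVU (u⁻¹ * v)
  rw [h0, map_zero, eq_comm, hf.log_eq_zero_iff hV] at h1
  obtain ⟨a, ha⟩ := h1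
  exact ⟨a, ha⟩

/-- The sections of `f_* 𝒪_X` over `U` that are locally multiples of units with logarithm `s`. -/
def logSubmodule (s : f.quotientSheaf.obj.obj (.op ⊤)) (U : S.Opens) :
    Submodule Γ(S, U) Γ((pushforward f).obj (structureSheaf X), U) where
  carrier := {t | ∀ (V : S.Opens) (h : V ≤ U) (u : Γ(X, f ⁻¹ᵁ V)ˣ),
    hf.log u = f.quotientRes le_top s → ↑u⁻¹ * f.res h t ∈ (f.app V).hom.range}
  add_mem' {t t'} ht ht' V h u hu := by
    have := add_mem (ht V h u hu) (ht' V h u hu)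
    rw [← mul_add] at this
    convert this
    exact map_add (f.res h) t t'
  zero_mem' V h u hu := by
    have h1 : f.res h (0 : Γ((pushforward f).obj (structureSheaf X), U)) = 0 := map_zero (f.res h)
    rw [h1, mul_zero]
    exact zero_mem _
  smul_mem' a t ht V h u hu := by
    have h1 : f.res h (a • t) = (f.app V).hom (Scheme.res h a) * f.res h t := by
      rw [← f.res_app]
      exact map_mul (f.res h) _ _
    rw [h1, mul_left_comm]
    exact mul_mem ⟨_, rfl⟩ (ht V h u hu)

variable (s : f.quotientSheaf.obj.obj (.op ⊤))

lemma mem_logSubmodule {U : S.Opens} {t : Γ(X, f ⁻¹ᵁ U)} :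
    (show Γ((pushforward f).obj (structureSheaf X), U) from t) ∈ hf.logSubmodule s U ↔
      ∀ (V : S.Opens) (h : V ≤ U) (u : Γ(X, f ⁻¹ᵁ V)ˣ),
        hf.log u = f.quotientRes le_top s → ↑u⁻¹ * f.res h t ∈ (f.app V).hom.range := Iff.rfl

lemma res_mem_logSubmodule (U V : S.Opens) (h : V ≤ U)
    (t : Γ((pushforward f).obj (structureSheaf X), U)) (ht : t ∈ hf.logSubmodule s U) :
    ((pushforward f).obj (structureSheaf X)).res h t ∈ hf.logSubmodule s V := by
  intro W hW u hu
  have := ht W (hW.trans h) u hu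
  have h1 : f.res hW (((pushforward f).obj (structureSheaf X)).res h t) = f.res (hW.trans h) t :=
    f.res_res h hW t
  rwa [h1]

lemma mem_logSubmodule_of_locally (U : S.Opens)
    (t : Γ((pushforward f).obj (structureSheaf X), U))
    (ht : ∀ x ∈ U, ∃ (V : S.Opens) (hV : V ≤ U), x ∈ V ∧
      ((pushforward f).obj (structureSheaf X)).res hV t ∈ hf.logSubmodule s V) :
    t ∈ hf.logSubmodule s U := by
  intro V hV u hu
  refine mem_range_app_of_locally hf.injective fun x hx ↦ ?_
  obtain ⟨W, hW, hxW, h⟩ := ht x (hV hx)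
  refine ⟨V ⊓ W, inf_le_left, ⟨hx, hxW⟩, ?_⟩
  have h1 := h (V ⊓ W) inf_le_right (f.unitRes inf_le_left u)
    (by rw [← hf.log_res, hu, f.quotientRes_res])
  have h2 : f.res (inf_le_right : V ⊓ W ≤ W)
      (((pushforward f).obj (structureSheaf X)).res hW t) =
      f.res (inf_le_left : V ⊓ W ≤ V) (f.res hV t) :=
    (f.res_res hW _ _).trans (f.res_res hV _ _).symm
  rw [h2, ← map_inv] at h1
  rwa [map_mul]

/-- The line bundle of the sections of `f_* 𝒪_X` that are locally multiples of units with
logarithm `s`. -/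
def logSheaf : S.Modules :=
  subsheaf ((pushforward f).obj (structureSheaf X)) (hf.logSubmodule s)
    (hf.res_mem_logSubmodule s) (hf.mem_logSubmodule_of_locally s)

/-- The inclusion of the line bundle attached to `s` into `f_* 𝒪_X`. -/
def logSheafι : hf.logSheaf s ⟶ (pushforward f).obj (structureSheaf X) :=
  subsheafι _ _ _ _

/-- A section of the line bundle attached to `s`, as a section of `f_* 𝒪_X`. -/
def logSheafVal {U : S.Opens} (t : Γ(hf.logSheaf s, U)) : Γ(X, f ⁻¹ᵁ U) :=
  (hf.logSheafι s).app U t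

lemma logSheafVal_injective (U : S.Opens) :
    Function.Injective (hf.logSheafVal s : Γ(hf.logSheaf s, U) → _) :=
  subsheafι_injective _ _ _ _ U

lemma logSheafVal_smul {U : S.Opens} (a : Γ(S, U)) (t : Γ(hf.logSheaf s, U)) :
    hf.logSheafVal s (a • t) = (f.app U).hom a * hf.logSheafVal s t :=
  app_smul (hf.logSheafι s) a t

lemma logSheafVal_res {U V : S.Opens} (h : V ≤ U) (t : Γ(hf.logSheaf s, U)) :
    hf.logSheafVal s ((hf.logSheaf s).res h t) = f.res h (hf.logSheafVal s t) :=
  app_res (hf.logSheafι s) h t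

lemma inv_mul_logSheafVal_mem {U : S.Opens} (t : Γ(hf.logSheaf s, U)) {u : Γ(X, f ⁻¹ᵁ U)ˣ}
    (hu : hf.log u = f.quotientRes le_top s) :
    ↑u⁻¹ * hf.logSheafVal s t ∈ (f.app U).hom.range := by
  have h : ↑u⁻¹ * f.res le_rfl (hf.logSheafVal s t) ∈ (f.app U).hom.range :=
    subsheafι_mem _ _ _ _ t U le_rfl u hu
  rwa [f.res_self] at h

/-- Units with the same logarithm differ by a section of 𝒪_S, so u satisfies the condition against
every other unit with logarithm s. -/
lemma exists_logSheafVal_eq {U : S.Opens} {u : Γ(X, f ⁻¹ᵁ U)ˣ}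
    (hu : hf.log u = f.quotientRes le_top s) : ∃ e : Γ(hf.logSheaf s, U), hf.logSheafVal s e = u :=
  exists_subsheafι_eq _ (hf.logSubmodule s) (hf.res_mem_logSubmodule s)
    (hf.mem_logSubmodule_of_locally s) ((hf.mem_logSubmodule s).mpr fun V h v hv ↦
      hf.mem_range_of_log_eq (u := v) (v := f.unitRes h u)
        (by rw [hv, ← hf.log_res, hu, f.quotientRes_res]))

/-- The unit u itself is the frame: the bundle over U is u 𝒪_S inside f_* 𝒪_X. -/
lemma exists_isFrame_logSheaf {U : S.Opens} {u : Γ(X, f ⁻¹ᵁ U)ˣ}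
    (hu : hf.log u = f.quotientRes le_top s) :
    ∃ e : Γ(hf.logSheaf s, U), IsFrame e ∧
      (hf.logSheafι s).app U e = (u : Γ(X, f ⁻¹ᵁ U)) • one (f ⁻¹ᵁ U) := by
  obtain ⟨e, he⟩ := hf.exists_logSheafVal_eq s hu
  refine ⟨e, fun V h ↦ ?_, he.trans (mul_one (u : Γ(X, f ⁻¹ᵁ U))).symm⟩
  have key : ∀ a : Γ(S, V), hf.logSheafVal s (a • (hf.logSheaf s).res h e) =
      (f.app V).hom a * (f.unitRes h u : Γ(X, f ⁻¹ᵁ V)) := fun a ↦ by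
    rw [logSheafVal_smul, logSheafVal_res, he]
    rfl
  constructor
  · intro a b hab
    have := congrArg (hf.logSheafVal s) hab
    simp only [key] at this
    exact hf.injective V ((f.unitRes h u).isUnit.mul_left_injective this)
  · intro t
    obtain ⟨a, ha⟩ := hf.inv_mul_logSheafVal_mem s t (u := f.unitRes h u)
      (by rw [← hf.log_res, hu, f.quotientRes_res])
    refine ⟨a, hf.logSheafVal_injective s V ((key a).trans ?_)⟩
    rw [ha, mul_comm, Units.mul_inv_cancel_left]

lemma isLineBundle_logSheaf : (hf.logSheaf s).IsLineBundle := by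
  refine isLineBundle_iff.mpr fun x ↦ ?_
  obtain ⟨V, hV, u, -, hxV, hu⟩ := hf.exists_log s (x := x) trivial
  obtain ⟨e, he, -⟩ := hf.exists_isFrame_logSheaf s hu
  exact ⟨V, e, hxV, he⟩

/-- The inclusion of the bundle into f_* 𝒪_X is adjoint to an isomorphism from its pullback to 𝒪_X,
which sends the frame u to u · 1. Thus the transition unit to the trivial bundle is u, with
logarithm s. -/
lemma exists_transitionClass_eq : ∃ G, hf.transitionClass G = s := by
  let φ := ((pullbackPushforwardAdjunction f).homEquiv (hf.logSheaf s) (structureSheaf X)).symm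
    (hf.logSheafι s)
  have hφ : ∀ (U : S.Opens) (t : Γ(hf.logSheaf s, U)), φ.app (f ⁻¹ᵁ U) (pullbackSection f t) =
      (hf.logSheafι s).app U t :=
    fun U t ↦ homEquiv_symm_app_pullbackSection _ t
  have : IsIso φ := isIso_of_isFrame φ fun x ↦ by
    obtain ⟨V, hV, u, -, hxV, hu⟩ := hf.exists_log s (x := f x) trivial
    obtain ⟨e, he, he'⟩ := hf.exists_isFrame_logSheaf s hu
    refine ⟨f ⁻¹ᵁ V, pullbackSection f e, hxV, he.pullbackSection f, ?_⟩
    rw [hφ, he']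
    exact (isFrame_one _).smul u
  obtain ⟨β, hβ⟩ := exists_iso_pullback_structureSheaf f
  refine ⟨⟨hf.logSheaf s, structureSheaf S, hf.isLineBundle_logSheaf s,
    isLineBundle_structureSheaf, asIso φ ≪≫ β.symm⟩, ?_⟩
  refine f.quotient_eq_of_locally fun x hx ↦ ?_
  obtain ⟨V, hV, u, -, hxV, hu⟩ := hf.exists_log s (x := x) trivial
  obtain ⟨e, he, he'⟩ := hf.exists_isFrame_logSheaf s hu
  refine ⟨V, hV, hxV, ?_⟩
  rw [← hu]
  refine hf.transitionClass_res_of_isFrame _ _ _ he (isFrame_one V) ?_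
  refine (ConcreteCategory.bijective_of_isIso (β.hom.app (f ⁻¹ᵁ V))).injective ?_
  rw [← comp_app_apply, app_smul, hβ, Iso.trans_hom, Category.assoc, Iso.symm_hom,
    Iso.inv_hom_id, Category.comp_id]
  exact (hφ V e).trans he'

lemma bijective_relPicHom : Function.Bijective hf.relPicHom := by
  refine ⟨(injective_iff_map_eq_zero _).mpr fun x hx ↦ ?_, fun s ↦ ?_⟩
  · obtain ⟨G, rfl⟩ := Hom.RelPic.exists_mk_of x
    exact hf.mk_of_eq_zero ((hf.relPicHom_mk_of G).symm.trans hx)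
  · obtain ⟨G, hG⟩ := hf.exists_transitionClass_eq s
    exact ⟨_, (hf.relPicHom_mk_of G).trans hG⟩

end Hom.IsSubintegral

/-- The sections of the structure sheaf of a `ℚ`-scheme form a `ℚ`-algebra. -/
abbrev ratAlgebra (Y : Scheme.{u}) [Y.Over (Spec (.of (ULift.{u} ℚ)))] (U : Y.Opens) :
    Algebra ℚ Γ(Y, U) :=
  ((Y.presheaf.map (homOfLE le_top).op).hom.comp
    (((Y ↘ Spec (.of (ULift.{u} ℚ))).appTop.hom.comp
      (Scheme.ΓSpecIso (.of (ULift.{u} ℚ))).inv.hom).comp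
        (ULift.ringEquiv.symm : ℚ ≃+* ULift.{u} ℚ).toRingHom)).toAlgebra

end

end AlgebraicGeometry.Scheme

/-- For a subintegral morphism `f : X ⟶ S` of `ℚ`-schemes, `Pic(f) ≅ H⁰(S, f_* 𝒪_X / 𝒪_S)`. -/
theorem mainTheorem10 {X S : Scheme.{u}} [X.Over (Spec (.of (ULift.{u} ℚ)))]
    [S.Over (Spec (.of (ULift.{u} ℚ)))] (f : X ⟶ S) [f.IsOver (Spec (.of (ULift.{u} ℚ)))]
    (hf : f.IsSubintegral) :
    Nonempty (f.RelPic ≃+ f.quotientSheaf.obj.obj (.op ⊤)) := by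
  let (U : S.Opens) : Algebra ℚ Γ(S, U) := S.ratAlgebra U
  let (U : X.Opens) : Algebra ℚ Γ(X, U) := X.ratAlgebra U
  exact ⟨AddEquiv.ofBijective hf.relPicHom hf.bijective_relPicHom⟩
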